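/- **Setting.** Let $\mathbb{K}\subset\mathbb{C}$ be an imaginary quadratic field and $\mathcal{O}\subset\mathbb{K}$ an order of discriminant $-d$ (so $\mathcal{O}=\mathbb{Z}+\mathbb{Z}\frac{d+\sqrt{-d}}{2}$, $\sqrt{-d}=i\sqrt{d}$), and put $\mathcal{D}^{-1}=\frac{1}{\sqrt{-d}}\mathcal{O}$. Let $V$ be a finite-dimensional $\mathbb{K}$-vector space with a non-degenerate Hermitian pairing $\langle\cdot,\cdot\rangle$ (linear in the first, conjugate-linear in the second variable) of signature $(b_+,b_-)$; write $|\lambda|^2=\langle\lambda,\lambda\rangle$ and $(\lambda,\mu)=\operatorname{Tr}^{\mathbb{K}}_{\mathbb{Q}}\langle\lambda,\mu\rangle$. Let $M\subset V$ be an even $\mathcal{O}$-lattice: a projective $\mathcal{O}$-submodule spanning $V$ over $\mathbb{Q}$, with $\langle M,M\rangle\subseteq\mathcal{D}^{-1}$ and $|\lambda|^2\in\mathbb{Z}$ for all $\lambda\in M$. Put $M^*=\{y\in V:\langle y,M\rangle\subseteq\mathcal{D}^{-1}\}$ and $D_M=M^*/M$ (a finite group). Let $J$ be the action of $\sqrt{-d}\in\mathbb{K}$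 on $V$, and $V_{\mathbb{R}}=V\otimes_{\mathbb{Q}}\mathbb{R}$. Inside $V\otimes_{\mathbb{Q}}\mathbb{C}=V_{\mathbb{C}}\oplus V_{\overline{\mathbb{C}}}$ let $V_{\mathbb{C}}$ and $V_{\overline{\mathbb{C}}}$ be the eigenspaces of $J$ with eigenvalues $\sqrt{-d}$ and $-\sqrt{-d}$, and write $x=x_{\mathbb{C}}+x_{\overline{\mathbb{C}}}$ accordingly. Extend $\langle\cdot,\cdot\rangle$ $\mathbb{C}$-bilinearly to $V\otimes_{\mathbb{Q}}\mathbb{C}$. Fix an orthogonal decomposition $v$: $V_{\mathbb{R}}=v_+\oplus v_-$ into $J$-stable subspaces on which $(\cdot,\cdot)$ is positive, respectively negative, definite, and let $x\mapsto x_{v_\pm}$ be the projections, extended $\mathbb{C}$-linearly. With $\mathbf{e}(z)=e^{2\pi iz}$ and $\mathcal{H}$ the upper half-plane, define for $\tau\in\mathcal{H}$, $\zeta\in V_{\mathbb{C}}$, $\omega\in V_{\overline{\mathbb{C}}}$ $$\Theta_M(\tau,\zeta,\omega;v)=\sum_{\gamma\in D_M}\Big[\sum_{\lambda\in M+\gamma}\mathbf{e}\big(\tau|\lambda_{v_+}|^2+\overline{\tau}|\lambda_{v_-}|^2+\langle\zeta,\lambda\rangle+\langle\lambda,\omega\rangle\big)\Big]\mathfrak{e}_\gamma\in\mathbb{C}[D_M].$$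 Let $\operatorname{U}(1,1)(\mathbb{Z})$ be the group of $A=\binom{a\ b}{c\ e}\in\operatorname{GL}_2(\mathcal{O})$ with $A\binom{0\ -1}{1\ \ 0}\overline{A}^t=\binom{0\ -1}{1\ \ 0}$; it is generated by $T=\binom{1\ 1}{0\ 1}$, $S=\binom{0\ -1}{1\ \ 0}$ and the scalar matrices $\xi$ for roots of unity $\xi\in\mathcal{O}$. Put $A\tau=\frac{a\tau+b}{c\tau+e}$, $j(A,\tau)=c\tau+e$, $j^c(A,\tau)=\overline{c}\tau+\overline{e}$, $j_A'=c$. The Weil representation $\rho_M$ of $\operatorname{U}(1,1)(\mathbb{Z})$ on $\mathbb{C}[D_M]$ is given by $$\rho_M(T)\mathfrak{e}_\gamma=\mathbf{e}(|\gamma|^2)\mathfrak{e}_\gamma,\quad\rho_M(S)\mathfrak{e}_\gamma=\tfrac{i^{b_--b_+}}{\sqrt{|D_M|}}\sum_{\delta\in D_M}\mathbf{e}(-(\gamma,\delta))\mathfrak{e}_\delta,\quad\rho_M(\xi)\mathfrak{e}_\gamma=\xi^{b_--b_+}\mathfrak{e}_{\overline{\xi}\gamma}.$$ Let $\overline{M}$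 be $M$ with the pairing replaced by its negative, let $\{\mathfrak{e}_\gamma^*\}$ be the natural basis of $\mathbb{C}[D_{\overline{M}}]$, and let $[\cdot,\cdot]_M$ be the bilinear pairing of $\mathbb{C}[D_M]$ and $\mathbb{C}[D_{\overline{M}}]$ with $[\mathfrak{e}_\gamma,\mathfrak{e}_\delta^*]_M=\delta_{\gamma,\delta}$. Let $\Gamma\subseteq\operatorname{U}(1,1)(\mathbb{Z})$ be a subgroup of finite index and let $k,l\in\mathbb{Z}$. A function $f$ on $\mathcal{H}$ is said to grow at most linearly exponentially towards the cusps if for every $A\in\operatorname{SL}_2(\mathbb{Z})$ there is, on each vertical strip of bounded width, a bound $|f(A\tau)|\leq Ke^{C\operatorname{Im}\tau}$ for $\operatorname{Im}\tau\geq1$. *Modular forms.* A modular form of weight $(k,l)$ and representation $\rho_{\overline{M}}$ with respect to $\Gamma$ is a smooth function $F:\mathcal{H}\to\mathbb{C}[D_{\overline{M}}]$ whose components grow at most linearly exponentially towards the cusps and with $F(A\tau)=j(A,\tau)^k\overline{j(A,\tau)}^l\rho_{\overline{M}}(A)F(\tau)$ for all $A\in\Gamma$, $\tau\in\mathcal{H}$.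 *Hermitian Jacobi forms.* A Hermitian Jacobi form of weight $(k,l)$ and index $(M,v)$ with respect to $\Gamma$ is a smooth function $\Phi:\mathcal{H}\times V_{\mathbb{C}}\times V_{\overline{\mathbb{C}}}\to\mathbb{C}$, holomorphic in $(\zeta,\omega)$, such that: (1) for all $\sigma,\nu\in M$, $\Phi\big(\tau,\zeta+\tau\sigma_{v_+,\mathbb{C}}+\overline{\tau}\sigma_{v_-,\mathbb{C}}+\nu_{\mathbb{C}},\omega+\tau\sigma_{v_+,\overline{\mathbb{C}}}+\overline{\tau}\sigma_{v_-,\overline{\mathbb{C}}}+\nu_{\overline{\mathbb{C}}}\big)=\mathbf{e}\big(-\tau|\sigma_{v_+}|^2-\overline{\tau}|\sigma_{v_-}|^2-\langle\zeta,\sigma\rangle-\langle\sigma,\omega\rangle\big)\Phi(\tau,\zeta,\omega)$; (2) for all $A\in\Gamma$, $\Phi\Big(A\tau,\frac{\zeta_{v_+}}{j(A,\tau)}+\frac{\zeta_{v_-}}{\overline{j^c(A,\tau)}},\frac{\omega_{v_+}}{j^c(A,\tau)}+\frac{\omega_{v_-}}{\overline{j(A,\tau)}}\Big)=j(A,\tau)^k\overline{j(A,\tau)}^l\,\mathbf{e}\Big(\frac{j_A'\langle\zeta_{v_+},\omega_{v_+}\rangle}{j(A,\tau)}+\frac{\overline{j_A'}\langle\zeta_{v_-},\omega_{v_-}\rangle}{\overline{j(A,\tau)}}\Big)\Phi(\tau,\zeta,\omega)$;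 (3) the functions $f_\lambda$ in the expansion $\Phi(\tau,\zeta,\omega)=\sum_{\lambda\in M^*}f_\lambda(\tau)\,\mathbf{e}\big(\tau|\lambda_{v_+}|^2+\overline{\tau}|\lambda_{v_-}|^2+\langle\zeta,\lambda\rangle+\langle\lambda,\omega\rangle\big)$ (which exists and is unique, by the preceding conditions) grow at most linearly exponentially towards the cusps. **Theorem.** Let $\Phi$ be a Hermitian Jacobi form of weight $(k,l)$ and index $(M,v)$ with respect to $\Gamma$. Then there is a unique function $F:\mathcal{H}\to\mathbb{C}[D_{\overline{M}}]$ with $\Phi(\tau,\zeta,\omega)=[\Theta_M(\tau,\zeta,\omega;v),F(\tau)]_M$ for all $\tau,\zeta,\omega$, and $F$ is a modular form of weight $(k-b_+,l-b_-)$ and representation $\rho_{\overline{M}}$ with respect to $\Gamma$. Conversely, if $F$ is such a modular form, then $(\tau,\zeta,\omega)\mapsto[\Theta_M(\tau,\zeta,\omega;v),F(\tau)]_M$ is a Hermitian Jacobi form of weight $(k,l)$ and index $(M,v)$ with respect to $\Gamma$. -/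

import Mathlib

open scoped TensorProduct

noncomputable section

namespace HermJacobi

/-! ### The imaginary quadratic field and the order -/

/-- `-d` is the discriminant of an order in an imaginary quadratic field. -/
class IsNegDiscriminant (d : ℕ) : Prop where
  pos : 0 < d
  mod_four : d % 4 = 0 ∨ d % 4 = 3

/-- `𝐞(z) = exp(2πiz)`. -/
def expC (z : ℂ) : ℂ := Complex.exp (2 * Real.pi * Complex.I * z)

/-- `√-d = √d · i`. -/
def sqrtNeg (d : ℕ) : ℂ := (Real.sqrt d : ℂ) * Complex.I

theorem sqrtNeg_mul_self (d : ℕ) : sqrtNeg d * sqrtNeg d = -(d : ℂ) := by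
  have h : ((Real.sqrt d : ℂ)) * (Real.sqrt d : ℂ) = (d : ℂ) := by
    rw [← Complex.ofReal_mul, Real.mul_self_sqrt (Nat.cast_nonneg d)]
    simp
  calc sqrtNeg d * sqrtNeg d
      = ((Real.sqrt d : ℂ) * (Real.sqrt d : ℂ)) * (Complex.I * Complex.I) := by
        unfold sqrtNeg; ring
    _ = -(d : ℂ) := by rw [h, Complex.I_mul_I]; ring

theorem conj_sqrtNeg (d : ℕ) : (starRingEnd ℂ) (sqrtNeg d) = -sqrtNeg d := by
  simp [sqrtNeg]

theorem sqrtNeg_ne_zero (d : ℕ) [hd : IsNegDiscriminant d] : sqrtNeg d ≠ 0 := by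
  intro h
  have h1 := sqrtNeg_mul_self d
  rw [h, mul_zero] at h1
  have h2 : (d : ℂ) = 0 := by linear_combination h1
  exact hd.pos.ne' (by exact_mod_cast h2)

/-- The imaginary quadratic field `𝕂 = ℚ(√-d)`, embedded in `ℂ`. -/
abbrev QuadField (d : ℕ) : Subfield ℂ := Subfield.closure {sqrtNeg d}

/-- `√-d` as an element of `𝕂`. -/
def sqrtK (d : ℕ) : QuadField d := ⟨sqrtNeg d, Subfield.subset_closure rfl⟩

/-- `𝒪 = ℤ + ℤ (d + √-d)/2`, the order of discriminant `-d` in `𝕂`.  Every order in every imaginary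
quadratic field is of this form for exactly one `d`. -/
def quadOrder (d : ℕ) [hd : IsNegDiscriminant d] : Subring (QuadField d) where
  carrier := {x | ∃ a b : ℤ, (x : ℂ) = a + b * ((d + sqrtNeg d) / 2)}
  one_mem' := ⟨1, 0, by simp⟩
  zero_mem' := ⟨0, 0, by simp⟩
  add_mem' := by
    rintro x y ⟨a, b, h⟩ ⟨a', b', h'⟩
    refine ⟨a + a', b + b', ?_⟩
    push_cast
    rw [h, h']; ring
  neg_mem' := by
    rintro x ⟨a, b, h⟩
    refine ⟨-a, -b, ?_⟩
    push_cast
    rw [h]; ring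
  mul_mem' := by
    rintro x y ⟨a, b, h⟩ ⟨a', b', h'⟩
    obtain ⟨n, hn⟩ : ∃ n : ℤ, (d : ℤ) * d + d = 4 * n := by
      have h4 : (d * (d + 1)) % 4 = 0 := by
        rcases hd.mod_four with h | h <;> simp [Nat.mul_mod, Nat.add_mod, h]
      refine ⟨((d * (d + 1) / 4 : ℕ) : ℤ), ?_⟩
      have : d * (d + 1) = 4 * (d * (d + 1) / 4) := by omega
      have h5 : ((d * (d + 1) : ℕ) : ℤ) = ((4 * (d * (d + 1) / 4) : ℕ) : ℤ) := congrArg _ this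
      rw [Nat.cast_mul 4] at h5
      rw [Nat.cast_ofNat] at h5
      rw [← h5]
      push_cast
      ring
    have hn' : (d : ℂ) * d + d = 4 * n := by exact_mod_cast hn
    refine ⟨a * a' - b * b' * n, a * b' + b * a' + b * b' * d, ?_⟩
    push_cast
    rw [h, h']
    linear_combination ((b : ℂ) * b' / 4) * (sqrtNeg_mul_self d) - ((b : ℂ) * b' / 4) * hn'

/-- The inverse different `𝒟⁻¹ = (1/√-d) 𝒪`. -/
def invDifferent (d : ℕ) [IsNegDiscriminant d] : Set (QuadField d) :=
  {x | ∃ a ∈ quadOrder d, x = a / sqrtK d}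

/-! ### Even Hermitian lattices -/

/-- A non-degenerate Hermitian space `V` over `𝕂` of signature `(bPos, bNeg)`, together with an even
`𝒪`-lattice `M` in it. -/
structure EvenLattice (d : ℕ) [IsNegDiscriminant d] (V : Type*) [AddCommGroup V]
    [Module (QuadField d) V] [Module ℚ V] where
  /-- the Hermitian pairing `⟨x, y⟩`, linear in `x` and conjugate-linear in `y` -/
  form : V → V → QuadField d
  form_add_left : ∀ x y z, form (x + y) z = form x z + form y z
  form_smul_left : ∀ (a : QuadField d) (x y : V), form (a • x) y = a * form x y
  form_conj : ∀ x y, (starRingEnd ℂ) (form x y : ℂ) = (form y x : ℂ)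
  bPos : ℕ
  bNeg : ℕ
  signature : ∃ b : Module.Basis (Fin bPos ⊕ Fin bNeg) (QuadField d) V,
    (∀ i j, i ≠ j → form (b i) (b j) = 0) ∧
    (∀ i, 0 < (form (b (Sum.inl i)) (b (Sum.inl i)) : ℂ).re) ∧
    (∀ i, (form (b (Sum.inr i)) (b (Sum.inr i)) : ℂ).re < 0)
  /-- the lattice `M` -/
  M : Submodule (quadOrder d) V
  span_eq_top : Submodule.span ℚ (M : Set V) = ⊤
  integral : ∀ x ∈ M, ∀ y ∈ M, form x y ∈ invDifferent d
  projective : Module.Projective (quadOrder d) M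
  even : ∀ x ∈ M, ∃ n : ℤ, (form x x : ℂ) = n

variable {d : ℕ} [hd : IsNegDiscriminant d] {V : Type*} [AddCommGroup V]
  [Module (QuadField d) V] [Module ℚ V]

namespace EvenLattice

variable (L : EvenLattice d V)

theorem form_add_right (x y z : V) : L.form x (y + z) = L.form x y + L.form x z := by
  apply Subtype.ext
  push_cast
  rw [← L.form_conj (y + z) x, L.form_add_left]
  push_cast
  rw [map_add, L.form_conj, L.form_conj]

theorem form_smul_right (a : QuadField d) (x y : V) :
    (L.form x (a • y) : ℂ) = (starRingEnd ℂ) (a : ℂ) * (L.form x y : ℂ) := by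
  rw [← L.form_conj (a • y) x, L.form_smul_left]
  push_cast
  rw [map_mul, L.form_conj]

theorem form_ratSmul_left (q : ℚ) (x y : V) :
    (L.form (q • x) y : ℂ) = (q : ℂ) * (L.form x y : ℂ) := by
  have h : q • x = (q : QuadField d) • x := (Rat.cast_smul_eq_qsmul (QuadField d) q x).symm
  rw [h, L.form_smul_left]
  push_cast
  rfl

theorem form_ratSmul_right (q : ℚ) (x y : V) :
    (L.form x (q • y) : ℂ) = (q : ℂ) * (L.form x y : ℂ) := by
  rw [← L.form_conj (q • y) x, L.form_ratSmul_left, map_mul, L.form_conj]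
  congr 1
  simp

/-- The Hermitian pairing as a `ℚ`-bilinear map into `ℂ`. -/
def formQ : V →ₗ[ℚ] V →ₗ[ℚ] ℂ :=
  LinearMap.mk₂ ℚ (fun x y => (L.form x y : ℂ))
    (fun x y z => by rw [L.form_add_left]; rfl)
    (fun q x y => by rw [L.form_ratSmul_left, Rat.smul_def])
    (fun x y z => by rw [L.form_add_right]; rfl)
    (fun q x y => by rw [L.form_ratSmul_right, Rat.smul_def])

/-- The pairing `(x, y) = Tr ⟨x, y⟩ = 2 Re ⟨x, y⟩` as a `ℚ`-bilinear map into `ℝ`. -/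
def traceForm : V →ₗ[ℚ] V →ₗ[ℚ] ℝ :=
  LinearMap.mk₂ ℚ (fun x y => 2 * (L.form x y : ℂ).re)
    (fun x y z => by rw [L.form_add_left]; push_cast; rw [Complex.add_re]; ring)
    (fun q x y => by
      rw [L.form_ratSmul_left, Rat.smul_def, ← Complex.ofReal_ratCast, Complex.re_ofReal_mul]; ring)
    (fun x y z => by rw [L.form_add_right]; push_cast; rw [Complex.add_re]; ring)
    (fun q x y => by
      rw [L.form_ratSmul_right, Rat.smul_def, ← Complex.ofReal_ratCast, Complex.re_ofReal_mul]
      ring)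

/-! ### The dual lattice and the discriminant group -/

theorem invDifferent_zero : (0 : QuadField d) ∈ invDifferent d :=
  ⟨0, Subring.zero_mem _, by simp⟩

theorem invDifferent_add {x y : QuadField d} (hx : x ∈ invDifferent d) (hy : y ∈ invDifferent d) :
    x + y ∈ invDifferent d := by
  obtain ⟨a, ha, rfl⟩ := hx
  obtain ⟨b, hb, rfl⟩ := hy
  exact ⟨a + b, Subring.add_mem _ ha hb, by ring⟩

theorem invDifferent_mul {x c : QuadField d} (hc : c ∈ quadOrder d) (hx : x ∈ invDifferent d) :
    c * x ∈ invDifferent d := by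
  obtain ⟨a, ha, rfl⟩ := hx
  exact ⟨c * a, Subring.mul_mem _ hc ha, by ring⟩

/-- The dual lattice `M* = {y ∈ V | ⟨y, M⟩ ⊆ 𝒟⁻¹}`. -/
def dual : Submodule (quadOrder d) V where
  carrier := {y | ∀ m ∈ L.M, L.form y m ∈ invDifferent d}
  zero_mem' := fun m _ => by
    have h := L.form_smul_left 0 0 m
    rw [zero_smul, zero_mul] at h
    rw [h]
    exact invDifferent_zero
  add_mem' := fun {x y} hx hy m hm => by
    rw [L.form_add_left]
    exact invDifferent_add (hx m hm) (hy m hm)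
  smul_mem' := fun c x hx m hm => by
    have h : c • x = (c : QuadField d) • x := rfl
    rw [h, L.form_smul_left]
    exact invDifferent_mul c.2 (hx m hm)

/-- The discriminant group `D_M = M*/M` (a finite `𝒪`-module). -/
abbrev Disc : Type _ := L.dual ⧸ L.M.submoduleOf L.dual

instance quadOrder_finite : Module.Finite ℤ (quadOrder d) := by
  have hw : ((d : QuadField d) + sqrtK d) / 2 ∈ quadOrder d :=
    ⟨0, 1, by
      push_cast
      simp only [zero_add, one_mul]
      rfl⟩
  refine ⟨⟨{1, ⟨_, hw⟩}, ?_⟩⟩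
  rw [eq_top_iff]
  rintro ⟨x, a, b, h⟩ -
  have hx : (⟨x, a, b, h⟩ : quadOrder d) = a • (1 : quadOrder d) + b • ⟨_, hw⟩ := by
    apply Subtype.ext
    apply Subtype.ext
    simp only [h, zsmul_eq_mul, Subring.coe_add, Subring.coe_mul, Subring.coe_intCast,
      mul_one]
    push_cast
    rfl
  rw [hx]
  refine Submodule.add_mem _ (Submodule.smul_mem _ _ (Submodule.subset_span (by simp)))
    (Submodule.smul_mem _ _ (Submodule.subset_span (by simp)))

theorem nondegenerate (x : V) (hx : ∀ y, L.form x y = 0) : x = 0 := by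
  obtain ⟨b, hb, hpos, hneg⟩ := L.signature
  have hne : ∀ i, L.form (b i) (b i) ≠ 0 := by
    rintro (i | i) h
    · have := hpos i; rw [h] at this; simp at this
    · have := hneg i; rw [h] at this; simp at this
  let φ : V → V →ₗ[QuadField d] QuadField d := fun y =>
    { toFun := fun x => L.form x y
      map_add' := fun x z => L.form_add_left x z y
      map_smul' := fun a x => L.form_smul_left a x y }
  have key : ∀ j, b.repr x j = 0 := by
    intro j
    have h1 : φ (b j) x = 0 := hx (b j)
    rw [← b.sum_repr x, map_sum] at h1
    rw [Finset.sum_eq_single j] at h1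
    · rw [map_smul, smul_eq_mul] at h1
      exact (mul_eq_zero.mp h1).resolve_right (hne j)
    · intro i _ hij
      rw [map_smul]
      have : φ (b j) (b i) = 0 := hb i j hij
      rw [this, smul_zero]
    · simp
  apply b.repr.injective
  ext j
  rw [key j]
  simp

theorem exists_smul_mem (x : V) : ∃ n : ℤ, n ≠ 0 ∧ n • x ∈ L.M := by
  have hx : x ∈ Submodule.span ℚ (L.M : Set V) := by rw [L.span_eq_top]; trivial
  induction hx using Submodule.span_induction with
  | mem x h => exact ⟨1, one_ne_zero, by simpa using h⟩
  | zero => exact ⟨1, one_ne_zero, by simp⟩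
  | add x y _ _ hx hy =>
    obtain ⟨n, hn, hnx⟩ := hx
    obtain ⟨m, hm, hmy⟩ := hy
    refine ⟨n * m, mul_ne_zero hn hm, ?_⟩
    rw [smul_add]
    refine L.M.add_mem ?_ ?_
    · rw [mul_comm, mul_smul]; exact zsmul_mem hnx m
    · rw [mul_smul]; exact zsmul_mem hmy n
  | smul q x _ hx =>
    obtain ⟨n, hn, hnx⟩ := hx
    refine ⟨q.den * n, mul_ne_zero (by exact_mod_cast q.den_ne_zero) hn, ?_⟩
    have h : ((q.den : ℤ) * n) • q • x = q.num • (n • x) := by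
      rw [← Int.cast_smul_eq_zsmul ℚ, ← Int.cast_smul_eq_zsmul ℚ q.num,
        ← Int.cast_smul_eq_zsmul ℚ n, smul_smul, smul_smul]
      congr 1
      push_cast
      have := Rat.den_mul_eq_num q
      rw [mul_right_comm, this]
    rw [h]
    exact zsmul_mem hnx _

instance dual_finite : Module.Finite ℤ L.dual := by
  have hsp : Submodule.span ℚ (L.M : Set V) = ⊤ := L.span_eq_top
  obtain ⟨b', -, -, -⟩ := L.signature
  have : Module.Finite (QuadField d) V := Module.Finite.of_basis b'
  -- finitely many elements of `M` span `V` over `𝕂`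
  have hspK : Submodule.span (QuadField d) (L.M : Set V) = ⊤ := by
    rw [eq_top_iff]
    intro x _
    obtain ⟨n, hn, hx⟩ := L.exists_smul_mem x
    have h1 : (n : QuadField d) • x ∈ Submodule.span (QuadField d) (L.M : Set V) := by
      rw [Int.cast_smul_eq_zsmul]; exact Submodule.subset_span hx
    have hn' : (n : QuadField d) ≠ 0 := by exact_mod_cast hn
    have h2 := Submodule.smul_mem _ ((n : QuadField d)⁻¹) h1
    rwa [smul_smul, inv_mul_cancel₀ hn', one_smul] at h2
  obtain ⟨s, hsM, hs⟩ := (Submodule.fg_span_iff_fg_span_finset_subset (L.M : Set V)).mp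
    (by rw [hspK]; exact Module.Finite.fg_top)
  rw [hspK] at hs
  have hmem : ∀ (y : L.dual) (m : s), sqrtK d * L.form y m ∈ quadOrder d := by
    intro y m
    obtain ⟨a, ha, h⟩ := y.2 m (hsM m.2)
    have h0 : sqrtK d ≠ 0 := fun h => sqrtNeg_ne_zero d (congrArg Subtype.val h)
    rw [h, mul_div_cancel₀ _ h0]
    exact ha
  let φ : L.dual →+ (s → quadOrder d) :=
    { toFun := fun y m => ⟨sqrtK d * L.form y m, hmem y m⟩
      map_zero' := by
        funext m
        apply Subtype.ext
        have h := L.form_smul_left 0 0 (m : V)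
        rw [zero_smul, zero_mul] at h
        change sqrtK d * L.form 0 m = 0
        rw [h, mul_zero]
      map_add' := fun y z => by
        funext m
        apply Subtype.ext
        change sqrtK d * L.form (y + z) m = sqrtK d * L.form y m + sqrtK d * L.form z m
        rw [L.form_add_left, mul_add] }
  refine Module.Finite.of_injective φ.toIntLinearMap ?_
  rw [AddMonoidHom.coe_toIntLinearMap, injective_iff_map_eq_zero]
  intro y hy
  apply Subtype.ext
  apply L.nondegenerate
  have h0 : sqrtK d ≠ 0 := fun h => sqrtNeg_ne_zero d (congrArg Subtype.val h)
  have hzero : ∀ m ∈ s, L.form y m = 0 := by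
    intro m hm
    have h1 : sqrtK d * L.form y m = 0 := congrArg Subtype.val (congrFun hy ⟨m, hm⟩)
    exact (mul_eq_zero.mp h1).resolve_left h0
  intro x
  have hx : x ∈ Submodule.span (QuadField d) (s : Set V) := by rw [← hs]; trivial
  induction hx using Submodule.span_induction with
  | mem x h => exact hzero x h
  | zero =>
    have := L.form_add_right (y : V) 0 0
    rw [add_zero] at this
    exact left_eq_add.mp this
  | add x z _ _ hx hz => rw [L.form_add_right, hx, hz, add_zero]
  | smul a x _ hx =>
    apply Subtype.ext
    rw [L.form_smul_right, hx]
    simp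

theorem finite_of_torsion {A Q : Type*} [AddCommGroup A] [AddCommGroup Q] [Module.Finite ℤ A]
    (f : A →+ Q) (hf : Function.Surjective f) (ht : ∀ a, ∃ n : ℤ, n ≠ 0 ∧ f (n • a) = 0) :
    Finite Q := by
  have : Module.Finite ℤ Q := Module.Finite.of_surjective f.toIntLinearMap hf
  apply Module.finite_of_fg_torsion
  intro x
  obtain ⟨y, rfl⟩ := hf x
  obtain ⟨n, hn, hy⟩ := ht y
  refine ⟨⟨n, mem_nonZeroDivisors_of_ne_zero hn⟩, ?_⟩
  rw [map_zsmul] at hy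
  exact hy

instance disc_finite : Finite L.Disc :=
  finite_of_torsion (L.M.submoduleOf L.dual).mkQ.toAddMonoidHom (Submodule.mkQ_surjective _)
    (fun y => by
      obtain ⟨n, hn, hy⟩ := L.exists_smul_mem (y : V)
      exact ⟨n, hn, (Submodule.Quotient.mk_eq_zero _).mpr hy⟩)

instance disc_fintype : Fintype L.Disc := Fintype.ofFinite _

instance disc_decidableEq : DecidableEq L.Disc := Classical.decEq _

theorem expC_add (z w : ℂ) : expC (z + w) = expC z * expC w := by
  rw [expC, expC, expC, ← Complex.exp_add]
  congr 1
  ring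

theorem expC_int (n : ℤ) : expC n = 1 := by
  rw [expC, Complex.exp_eq_one_iff]
  exact ⟨n, by ring⟩

theorem trace_invDifferent {x : QuadField d} (hx : x ∈ invDifferent d) :
    ∃ n : ℤ, (x : ℂ) + (starRingEnd ℂ) (x : ℂ) = n := by
  obtain ⟨y, ⟨a, b, h⟩, rfl⟩ := hx
  refine ⟨b, ?_⟩
  have h0 := sqrtNeg_ne_zero d
  push_cast
  rw [h]
  change ((a : ℂ) + b * ((d + sqrtNeg d) / 2)) / sqrtNeg d +
    (starRingEnd ℂ) (((a : ℂ) + b * ((d + sqrtNeg d) / 2)) / sqrtNeg d) = b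
  simp only [map_div₀, map_add, map_mul, conj_sqrtNeg, map_intCast, map_natCast, map_ofNat]
  field_simp
  ring

theorem expC_trace {x y : V} (hx : x ∈ L.dual) (hy : y ∈ L.M) :
    expC (L.form x y + L.form y x) = 1 := by
  obtain ⟨n, hn⟩ := trace_invDifferent (hx y hy)
  rw [← L.form_conj x y, hn, expC_int]

theorem M_le_dual : L.M ≤ L.dual := fun x hx m hm => L.integral x hx m hm

/-- `𝐞(γ²/2) = 𝐞(|λ|²)` for `γ = λ + M ∈ D_M`. -/
def discQuad : L.Disc → ℂ :=
  Quotient.lift (fun x : L.dual => expC (L.form x x)) (by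
    intro x y hxy
    have h : (x - y : V) ∈ L.M := (Submodule.quotientRel_def (L.M.submoduleOf L.dual)).mp hxy
    obtain ⟨m, hm, hxm⟩ : ∃ m ∈ L.M, (x : V) = y + m := ⟨_, h, by abel⟩
    obtain ⟨n, hn⟩ := L.even m hm
    have e : ((L.form (x : V) x : QuadField d) : ℂ) =
        L.form (y : V) y + (L.form (y : V) m + L.form m y) + (L.form m m : ℂ) := by
      rw [hxm, L.form_add_left, L.form_add_right, L.form_add_right]
      push_cast
      ring
    change expC _ = expC _
    rw [e, expC_add, expC_add, L.expC_trace y.2 hm, hn, expC_int, mul_one, mul_one])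

/-- `𝐞((γ, δ)) = 𝐞(⟨λ, μ⟩ + ⟨μ, λ⟩)` for `γ = λ + M` and `δ = μ + M` in `D_M`. -/
def discPair : L.Disc → L.Disc → ℂ :=
  Quotient.lift₂ (fun x y : L.dual => expC (L.form x y + L.form y x)) (by
    intro x y x' y' hx hy
    have h : (x - x' : V) ∈ L.M := (Submodule.quotientRel_def (L.M.submoduleOf L.dual)).mp hx
    have h' : (y - y' : V) ∈ L.M := (Submodule.quotientRel_def (L.M.submoduleOf L.dual)).mp hy
    obtain ⟨m, hm, hxm⟩ : ∃ m ∈ L.M, (x : V) = x' + m := ⟨_, h, by abel⟩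
    obtain ⟨m', hm', hym⟩ : ∃ m ∈ L.M, (y : V) = y' + m := ⟨_, h', by abel⟩
    have e : (L.form (x : V) y : ℂ) + (L.form (y : V) x : ℂ) =
        (L.form (x' : V) y' + L.form (y' : V) x') + (L.form (x' : V) m' + L.form m' x') +
          (L.form (y' : V) m + L.form m y') + ((L.form m m' : ℂ) + L.form m' m) := by
      rw [hxm, hym]
      simp only [L.form_add_left, L.form_add_right]
      push_cast
      ring
    change expC _ = expC _
    rw [e, expC_add, expC_add, expC_add, L.expC_trace x'.2 hm', L.expC_trace y'.2 hm,
      L.expC_trace (L.M_le_dual hm) hm', mul_one, mul_one, mul_one])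

end EvenLattice

/-! ### Complexifications -/

variable (d V) in
/-- The endomorphism `J` of `V`: the action of `√-d ∈ 𝕂`. -/
def opJ : V →ₗ[ℚ] V where
  toFun x := sqrtK d • x
  map_add' x y := smul_add _ x y
  map_smul' q x := smul_comm _ q x

variable (d V) in
/-- `J` on `V_ℝ = V ⊗_ℚ ℝ`. -/
def opJR : ℝ ⊗[ℚ] V →ₗ[ℝ] ℝ ⊗[ℚ] V := (opJ d V).baseChange ℝ

variable (d V) in
/-- `J` on `V ⊗_ℚ ℂ`. -/
def opJC : ℂ ⊗[ℚ] V →ₗ[ℂ] ℂ ⊗[ℚ] V := (opJ d V).baseChange ℂ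

variable (d V) in
/-- `V_ℂ = V ⊗_𝕂 ℂ`, as the subspace of `V ⊗_ℚ ℂ` where `J` acts as the scalar `√-d`. -/
def VC : Submodule ℂ (ℂ ⊗[ℚ] V) := Module.End.eigenspace (opJC d V) (sqrtNeg d)

variable (d V) in
/-- `V_ℂ̄ = V ⊗_𝕂 ℂ` with `𝕂` embedded by the conjugate embedding, as the subspace of `V ⊗_ℚ ℂ`
where `J` acts as the scalar `-√-d`. -/
def VCbar : Submodule ℂ (ℂ ⊗[ℚ] V) := Module.End.eigenspace (opJC d V) (-sqrtNeg d)

theorem opJC_opJC (x : ℂ ⊗[ℚ] V) : opJC d V (opJC d V x) = -(d : ℂ) • x := by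
  have h : ∀ v : V, opJ d V (opJ d V v) = -((d : ℚ) • v) := by
    intro v
    change sqrtK d • sqrtK d • v = _
    have h1 : sqrtK d * sqrtK d = -((d : ℚ) : QuadField d) := by
      apply Subtype.ext
      push_cast
      exact sqrtNeg_mul_self d
    rw [smul_smul, h1, neg_smul, Rat.cast_smul_eq_qsmul]
  induction x using TensorProduct.induction_on with
  | zero => simp
  | add x y hx hy => rw [map_add, map_add, hx, hy, smul_add]
  | tmul z v =>
    simp only [opJC, LinearMap.baseChange_tmul, h, TensorProduct.tmul_neg, TensorProduct.tmul_smul,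
      neg_smul, TensorProduct.smul_tmul', smul_eq_mul]
    congr 2

/-- The component `x_ℂ = x/2 - √-d · Jx/(2d)` of `x ∈ V ⊗_ℚ ℂ = V_ℂ ⊕ V_ℂ̄`. -/
def toVC (x : ℂ ⊗[ℚ] V) : VC d V :=
  ⟨(1 / 2 : ℂ) • x - (sqrtNeg d / (2 * d)) • opJC d V x, by
    have h0 : (d : ℂ) ≠ 0 := by exact_mod_cast hd.pos.ne'
    rw [VC, Module.End.mem_eigenspace_iff, map_sub, map_smul, map_smul, opJC_opJC, smul_sub,
      smul_smul, smul_smul, smul_smul]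
    have e1 : sqrtNeg d / (2 * d) * -(d : ℂ) = -(sqrtNeg d * (1 / 2)) := by field_simp
    have e2 : sqrtNeg d * (sqrtNeg d / (2 * d)) = -(1 / 2 : ℂ) := by
      rw [← mul_div_assoc, sqrtNeg_mul_self]; field_simp
    rw [e1, e2, neg_smul, neg_smul]
    abel⟩

/-- The component `x_ℂ̄ = x/2 + √-d · Jx/(2d)` of `x ∈ V ⊗_ℚ ℂ = V_ℂ ⊕ V_ℂ̄`. -/
def toVCbar (x : ℂ ⊗[ℚ] V) : VCbar d V :=
  ⟨(1 / 2 : ℂ) • x + (sqrtNeg d / (2 * d)) • opJC d V x, by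
    have h0 : (d : ℂ) ≠ 0 := by exact_mod_cast hd.pos.ne'
    rw [VCbar, Module.End.mem_eigenspace_iff, map_add, map_smul, map_smul, opJC_opJC, smul_add,
      smul_smul, smul_smul, smul_smul]
    have e1 : sqrtNeg d / (2 * d) * -(d : ℂ) = -sqrtNeg d * (1 / 2) := by field_simp
    have e2 : -sqrtNeg d * (sqrtNeg d / (2 * d)) = (1 / 2 : ℂ) := by
      rw [neg_mul, ← mul_div_assoc, sqrtNeg_mul_self]; field_simp
    rw [e1, e2]
    abel⟩

namespace EvenLattice

variable (L : EvenLattice d V)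

/-- The real bilinear extension of `(x, y) = Tr ⟨x, y⟩` to `V_ℝ`. -/
def traceFormR : ℝ ⊗[ℚ] V →ₗ[ℝ] ℝ ⊗[ℚ] V →ₗ[ℝ] ℝ :=
  LinearMap.liftBaseChange ℝ
    ((LinearMap.liftBaseChangeEquiv ℝ).toLinearMap.restrictScalars ℚ ∘ₗ L.traceForm)

/-- The extension of `⟨x, y⟩` to `V ⊗_ℚ ℂ`, linear over the extended scalars `ℂ` in both
variables. -/
def formC : ℂ ⊗[ℚ] V →ₗ[ℂ] ℂ ⊗[ℚ] V →ₗ[ℂ] ℂ :=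
  LinearMap.liftBaseChange ℂ
    ((LinearMap.liftBaseChangeEquiv ℂ).toLinearMap.restrictScalars ℚ ∘ₗ L.formQ)

theorem traceFormR_tmul (r s : ℝ) (x y : V) :
    L.traceFormR (r ⊗ₜ x) (s ⊗ₜ y) = r * (s * (2 * (L.form x y : ℂ).re)) := rfl

theorem formC_tmul (z w : ℂ) (x y : V) :
    L.formC (z ⊗ₜ x) (w ⊗ₜ y) = z * (w * (L.form x y : ℂ)) := rfl

end EvenLattice

/-! ### The Grassmannian -/

/-- An element `V_ℝ = v₊ ⊕ v₋` of `Gr^J(V_ℝ)`. -/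
structure GrJ (L : EvenLattice d V) where
  pos : Submodule ℝ (ℝ ⊗[ℚ] V)
  neg : Submodule ℝ (ℝ ⊗[ℚ] V)
  isCompl : IsCompl pos neg
  pos_def : ∀ x ∈ pos, x ≠ 0 → 0 < L.traceFormR x x
  neg_def : ∀ x ∈ neg, x ≠ 0 → L.traceFormR x x < 0
  orthogonal : ∀ x ∈ pos, ∀ y ∈ neg, L.traceFormR x y = 0
  J_pos : ∀ x ∈ pos, opJR d V x ∈ pos
  J_neg : ∀ x ∈ neg, opJR d V x ∈ neg

/-- The `ℂ`-linear extension to `V ⊗_ℚ ℂ` of an endomorphism of `V_ℝ`. -/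
def extendC (p : ℝ ⊗[ℚ] V →ₗ[ℝ] ℝ ⊗[ℚ] V) : ℂ ⊗[ℚ] V →ₗ[ℂ] ℂ ⊗[ℚ] V :=
  (TensorProduct.AlgebraTensorModule.cancelBaseChange ℚ ℝ ℂ ℂ V).toLinearMap ∘ₗ
    p.baseChange ℂ ∘ₗ
      (TensorProduct.AlgebraTensorModule.cancelBaseChange ℚ ℝ ℂ ℂ V).symm.toLinearMap

theorem extendC_comp (p q : ℝ ⊗[ℚ] V →ₗ[ℝ] ℝ ⊗[ℚ] V) :
    extendC (p ∘ₗ q) = extendC p ∘ₗ extendC q := by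
  apply LinearMap.ext
  intro x
  simp [extendC, LinearMap.baseChange_comp]

theorem extendC_opJR : extendC (opJR d V) = opJC d V := by
  apply TensorProduct.AlgebraTensorModule.ext
  intro z v
  simp [extendC, opJR, opJC]

theorem projection_comm {E : Type*} [AddCommGroup E] [Module ℝ E] {p q : Submodule ℝ E}
    (h : IsCompl p q) (f : E →ₗ[ℝ] E) (hp : ∀ x ∈ p, f x ∈ p) (hq : ∀ x ∈ q, f x ∈ q) :
    p.projection q h ∘ₗ f = f ∘ₗ p.projection q h := by
  apply LinearMap.ext
  intro x
  have hx := Submodule.projection_add_projection_eq_self h x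
  have h1 := hp _ (Submodule.projection_apply_mem h x)
  have h2 := hq _ (Submodule.projection_apply_mem h.symm x)
  change p.projection q h (f x) = f (p.projection q h x)
  conv_lhs => rw [← hx]
  rw [map_add, map_add, Submodule.projection_apply_of_mem_left h h1,
    Submodule.projection_apply_of_mem_right h h2, add_zero]

namespace GrJ

variable {L : EvenLattice d V} (v : GrJ L)

/-- The orthogonal projection `x ↦ x_{v₊}` on `V ⊗_ℚ ℂ`. -/
def projPos : ℂ ⊗[ℚ] V →ₗ[ℂ] ℂ ⊗[ℚ] V := extendC (v.pos.projection v.neg v.isCompl)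

/-- The orthogonal projection `x ↦ x_{v₋}` on `V ⊗_ℚ ℂ`. -/
def projNeg : ℂ ⊗[ℚ] V →ₗ[ℂ] ℂ ⊗[ℚ] V := extendC (v.neg.projection v.pos v.isCompl.symm)

theorem projPos_opJC (x : ℂ ⊗[ℚ] V) : v.projPos (opJC d V x) = opJC d V (v.projPos x) := by
  have h := congrArg extendC (projection_comm v.isCompl (opJR d V) v.J_pos v.J_neg)
  rw [extendC_comp, extendC_comp, extendC_opJR] at h
  exact LinearMap.congr_fun h x

theorem projNeg_opJC (x : ℂ ⊗[ℚ] V) : v.projNeg (opJC d V x) = opJC d V (v.projNeg x) := by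
  have h := congrArg extendC (projection_comm v.isCompl.symm (opJR d V) v.J_neg v.J_pos)
  rw [extendC_comp, extendC_comp, extendC_opJR] at h
  exact LinearMap.congr_fun h x

/-- `ζ ↦ ζ_{v₊}` on `V_ℂ`. -/
def posC : VC d V →ₗ[ℂ] VC d V := v.projPos.restrict (fun x hx => by
  rw [VC, Module.End.mem_eigenspace_iff] at hx ⊢
  rw [← projPos_opJC, hx, map_smul])

/-- `ζ ↦ ζ_{v₋}` on `V_ℂ`. -/
def negC : VC d V →ₗ[ℂ] VC d V := v.projNeg.restrict (fun x hx => by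
  rw [VC, Module.End.mem_eigenspace_iff] at hx ⊢
  rw [← projNeg_opJC, hx, map_smul])

/-- `ω ↦ ω_{v₊}` on `V_ℂ̄`. -/
def posCbar : VCbar d V →ₗ[ℂ] VCbar d V := v.projPos.restrict (fun x hx => by
  rw [VCbar, Module.End.mem_eigenspace_iff] at hx ⊢
  rw [← projPos_opJC, hx, map_smul])

/-- `ω ↦ ω_{v₋}` on `V_ℂ̄`. -/
def negCbar : VCbar d V →ₗ[ℂ] VCbar d V := v.projNeg.restrict (fun x hx => by
  rw [VCbar, Module.End.mem_eigenspace_iff] at hx ⊢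
  rw [← projNeg_opJC, hx, map_smul])

/-- `|λ_{v₊}|²` for `λ ∈ V`. -/
def normPos (x : V) : ℂ := L.formC (v.projPos (1 ⊗ₜ x)) (v.projPos (1 ⊗ₜ x))

/-- `|λ_{v₋}|²` for `λ ∈ V` (a non-positive number). -/
def normNeg (x : V) : ℂ := L.formC (v.projNeg (1 ⊗ₜ x)) (v.projNeg (1 ⊗ₜ x))

end GrJ

/-! ### The unitary group `U(1,1)(ℤ)` -/

/-- The matrix `(0, -1; 1, 0)`. -/
def matJ : Matrix (Fin 2) (Fin 2) ℂ := !![0, -1; 1, 0]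

/-- `U(1,1)(ℝ)`: the matrices `A ∈ GL₂(ℂ)` with `A J A* = J`, where `J = (0, -1; 1, 0)`. -/
def unitaryR : Subgroup (GL (Fin 2) ℂ) where
  carrier := {A | (A : Matrix (Fin 2) (Fin 2) ℂ) * matJ * (A : Matrix (Fin 2) (Fin 2) ℂ).conjTranspose
    = matJ}
  one_mem' := by simp
  mul_mem' := by
    intro A B hA hB
    simp only [Set.mem_ofPred_eq] at hA hB ⊢
    rw [Units.val_mul, Matrix.conjTranspose_mul]
    calc (A : Matrix (Fin 2) (Fin 2) ℂ) * B * matJ * ((B : Matrix (Fin 2) (Fin 2) ℂ).conjTranspose *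
          (A : Matrix (Fin 2) (Fin 2) ℂ).conjTranspose)
        = A * (B * matJ * (B : Matrix (Fin 2) (Fin 2) ℂ).conjTranspose) *
          (A : Matrix (Fin 2) (Fin 2) ℂ).conjTranspose := by simp only [Matrix.mul_assoc]
      _ = matJ := by rw [hB, hA]
  inv_mem' := by
    intro A hA
    simp only [Set.mem_ofPred_eq] at hA ⊢
    have h1 : ((A⁻¹ : GL (Fin 2) ℂ) : Matrix (Fin 2) (Fin 2) ℂ) * A = 1 := by
      rw [← Units.val_mul, inv_mul_cancel]; rfl
    have h2 := congrArg Matrix.conjTranspose h1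
    rw [Matrix.conjTranspose_mul, Matrix.conjTranspose_one] at h2
    calc ((A⁻¹ : GL (Fin 2) ℂ) : Matrix (Fin 2) (Fin 2) ℂ) * matJ *
          ((A⁻¹ : GL (Fin 2) ℂ) : Matrix (Fin 2) (Fin 2) ℂ).conjTranspose
        = (((A⁻¹ : GL (Fin 2) ℂ) : Matrix (Fin 2) (Fin 2) ℂ) * A) * matJ *
          ((A : Matrix (Fin 2) (Fin 2) ℂ).conjTranspose *
            ((A⁻¹ : GL (Fin 2) ℂ) : Matrix (Fin 2) (Fin 2) ℂ).conjTranspose) := by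
          conv_lhs => rw [← hA]
          simp only [Matrix.mul_assoc]
      _ = matJ := by rw [h1, h2, Matrix.one_mul, Matrix.mul_one]

/-- The embedding `𝒪 → ℂ`. -/
def embO (d : ℕ) [IsNegDiscriminant d] : quadOrder d →+* ℂ :=
  (QuadField d).subtype.comp (quadOrder d).subtype

/-- `U(1,1)(ℤ)`: the elements of `U(1,1)(ℝ)` with entries in `𝒪`. -/
def unitaryZ (d : ℕ) [IsNegDiscriminant d] : Subgroup (GL (Fin 2) (quadOrder d)) :=
  unitaryR.comap (Matrix.GeneralLinearGroup.map (embO d))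

/-- The entries of `A ∈ U(1,1)(ℤ)` as complex numbers. -/
def entry (A : unitaryZ d) (i j : Fin 2) : ℂ := embO d ((A : GL (Fin 2) (quadOrder d)) i j)

/-- `j(A, τ) = cτ + e` for `A = (a, b; c, e)`. -/
def fj (A : unitaryZ d) (τ : UpperHalfPlane) : ℂ := entry A 1 0 * τ + entry A 1 1

/-- `j^c(A, τ) = c̄τ + ē`. -/
def fjc (A : unitaryZ d) (τ : UpperHalfPlane) : ℂ :=
  (starRingEnd ℂ) (entry A 1 0) * τ + (starRingEnd ℂ) (entry A 1 1)

theorem im_mobius (A : unitaryZ d) (τ : UpperHalfPlane) :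
    0 < ((entry A 0 0 * τ + entry A 0 1) / fj A τ).im := by
  obtain ⟨a, ha⟩ : ∃ a, a = entry A 0 0 := ⟨_, rfl⟩
  obtain ⟨b, hb⟩ : ∃ b, b = entry A 0 1 := ⟨_, rfl⟩
  obtain ⟨c, hc⟩ : ∃ c, c = entry A 1 0 := ⟨_, rfl⟩
  obtain ⟨e, he⟩ : ∃ e, e = entry A 1 1 := ⟨_, rfl⟩
  have hfj : fj A τ = c * τ + e := by rw [hc, he]; rfl
  rw [hfj, ← ha, ← hb]
  obtain ⟨B, hB⟩ : ∃ B : Matrix (Fin 2) (Fin 2) ℂ, B = !![a, b; c, e] := ⟨_, rfl⟩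
  have h1 : B * matJ * B.conjTranspose = matJ := by
    have hBA : B = fun i j => entry A i j := by
      rw [hB, ha, hb, hc, he]
      ext i j; fin_cases i <;> fin_cases j <;> rfl
    rw [hBA]
    exact A.2
  have hJ : matJ * matJ = -1 := by
    ext i j; fin_cases i <;> fin_cases j <;> simp [matJ, Matrix.mul_apply, Fin.sum_univ_two]
  have h2 : B * (-(matJ * B.conjTranspose * matJ)) = 1 := by
    rw [Matrix.mul_neg, ← Matrix.mul_assoc, ← Matrix.mul_assoc, h1, hJ, neg_neg]
  have h3 := mul_eq_one_comm.mp h2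
  have h4 : B.conjTranspose * matJ * B = matJ := by
    calc B.conjTranspose * matJ * B = -(matJ * matJ) * (B.conjTranspose * matJ * B) := by
          rw [hJ, neg_neg, Matrix.one_mul]
      _ = matJ * (-(matJ * B.conjTranspose * matJ) * B) := by
          simp only [Matrix.mul_assoc, Matrix.neg_mul, Matrix.mul_neg]
      _ = matJ := by rw [h3, Matrix.mul_one]
  have h00 := congrFun (congrFun h4 0) 0
  have h01 := congrFun (congrFun h4 0) 1
  have h10 := congrFun (congrFun h4 1) 0
  have h11 := congrFun (congrFun h4 1) 1
  rw [hB] at h00 h01 h10 h11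
  simp [matJ, Matrix.mul_apply, Fin.sum_univ_two] at h00 h01 h10 h11
  set σ := starRingEnd ℂ
  have key : σ (c * τ + e) * (a * τ + b) - σ (a * τ + b) * (c * τ + e) = τ - σ (τ : ℂ) := by
    simp only [map_add, map_mul]
    linear_combination (σ (τ : ℂ) * τ) * h00 + σ (τ : ℂ) * h01 + (τ : ℂ) * h10 + h11
  have hτ : 0 < (τ : ℂ).im := τ.2
  have hne : c * τ + e ≠ 0 := by
    intro h
    rw [h, map_zero, zero_mul, mul_zero, sub_zero] at key
    have := congrArg Complex.im key
    rw [Complex.sub_im, Complex.conj_im, Complex.zero_im] at this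
    linarith
  have hs : 0 < Complex.normSq (c * τ + e) := Complex.normSq_pos.mpr hne
  have him : (σ (c * τ + e) * (a * τ + b)).im = (τ : ℂ).im := by
    have hk := congrArg Complex.im key
    simp only [Complex.sub_im, Complex.mul_im, σ, Complex.conj_re, Complex.conj_im] at hk ⊢
    linarith
  rw [Complex.div_im]
  rw [← sub_div]
  apply div_pos _ hs
  simp only [Complex.mul_im, σ, Complex.conj_re, Complex.conj_im] at him
  linarith

/-- The action `Aτ = (aτ + b)/(cτ + e)`. -/
def act (A : unitaryZ d) (τ : UpperHalfPlane) : UpperHalfPlane :=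
  ⟨(entry A 0 0 * τ + entry A 0 1) / fj A τ, im_mobius A τ⟩

/-! ### The Weil representation -/

namespace EvenLattice

variable (L : EvenLattice d V)

/-- The graph of the Weil representation on `ℂ[D]` of the discriminant form on the group `D = D_M` with
`𝐞(γ²/2) = q γ`, `𝐞((γ, δ)) = b γ δ` and signature determined by `s = b₋ - b₊`.  It is the
multiplicative closure of the pairs formed by the generators `T`, `S` and the scalar matrices
`ξ ∈ μ(𝒪)` and their images, which act by `T : 𝔢_γ ↦ q(γ) 𝔢_γ`,
`S : 𝔢_γ ↦ (i^s / √|D|) ∑_δ b(γ, δ)⁻¹ 𝔢_δ` and `ξ : 𝔢_γ ↦ ξ^s 𝔢_{ξ̄γ}` (here `ξ̄ = ξ⁻¹`).  Matrices are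
written in the basis `𝔢_γ`, with column index `γ`.  (As `S` and `ST` have finite order, `S` and `T`
generate `SL₂(ℤ)` as a monoid.) -/
def weilGraph (q : L.Disc → ℂ) (b : L.Disc → L.Disc → ℂ) (s : ℤ) :
    Submonoid (GL (Fin 2) (quadOrder d) × Matrix L.Disc L.Disc ℂ) :=
  Submonoid.closure
    ({(Matrix.SpecialLinearGroup.mapGL (quadOrder d) ModularGroup.T, Matrix.diagonal q),
      (Matrix.SpecialLinearGroup.mapGL (quadOrder d) ModularGroup.S,
        Matrix.of fun δ γ => Complex.I ^ s / (Real.sqrt (Nat.card L.Disc) : ℂ) * (b γ δ)⁻¹)} ∪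
      {P | ∃ ξ : (quadOrder d)ˣ, IsOfFinOrder ξ ∧
        P = (Matrix.GeneralLinearGroup.scalar (Fin 2) ξ,
          Matrix.of fun δ γ => if δ = (ξ⁻¹ : (quadOrder d)ˣ) • γ then (embO d ξ) ^ s else 0)})

/-- The Weil representation with the above data: the unique matrix `R` such that `(A, R)` is in the
graph. -/
def weilOf (q : L.Disc → ℂ) (b : L.Disc → L.Disc → ℂ) (s : ℤ) (A : unitaryZ d) :
    Matrix L.Disc L.Disc ℂ :=
  Classical.epsilon fun R => ((A : GL (Fin 2) (quadOrder d)), R) ∈ L.weilGraph q b s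

/-- The Weil representation `ρ_M` of `U(1,1)(ℤ)` on `ℂ[D_M]`. -/
def weilRep (A : unitaryZ d) : Matrix L.Disc L.Disc ℂ :=
  L.weilOf L.discQuad L.discPair (L.bNeg - L.bPos) A

/-- The Weil representation `ρ_M̄` of `U(1,1)(ℤ)` on `ℂ[D_M̄]`, where `M̄` is `M` with all pairings
multiplied by `-1`.  The group `D_M̄` is `D_M`, and `𝔢_γ*` is the basis vector indexed by `γ`. -/
def weilRepBar (A : unitaryZ d) : Matrix L.Disc L.Disc ℂ :=
  L.weilOf (fun γ => (L.discQuad γ)⁻¹) (fun γ δ => (L.discPair γ δ)⁻¹) (L.bPos - L.bNeg) A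

/-! ### Theta functions -/

/-- `𝐞(τ|λ_{v₊}|² + τ̄|λ_{v₋}|² + ⟨ζ, λ⟩ + ⟨λ, ω⟩)`. -/
def thetaTerm (v : GrJ L) (τ : UpperHalfPlane) (ζ : VC d V) (ω : VCbar d V) (x : V) : ℂ :=
  expC (τ * v.normPos x + (starRingEnd ℂ) (τ : ℂ) * v.normNeg x + L.formC ζ (1 ⊗ₜ x)
    + L.formC (1 ⊗ₜ x) ω)

/-- The Hermitian Jacobi–Siegel theta function `Θ_M(τ, ζ, ω; v) ∈ ℂ[D_M]`: its `γ`-component is the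
sum over `λ ∈ M + γ` of `thetaTerm`. -/
def theta (v : GrJ L) (τ : UpperHalfPlane) (ζ : VC d V) (ω : VCbar d V) : L.Disc → ℂ :=
  fun γ => ∑' x : {x : L.dual // (L.M.submoduleOf L.dual).mkQ x = γ},
    L.thetaTerm v τ ζ ω (x : L.dual)

/-- The bilinear pairing `[·,·]_M` of `ℂ[D_M]` with `ℂ[D_M̄]`, for which the bases `𝔢_γ` and `𝔢_γ*`
are dual. -/
def discPairing (X F : L.Disc → ℂ) : ℂ := ∑ γ, X γ * F γ

end EvenLattice

/-! ### Modular forms and Hermitian Jacobi forms -/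

/-- `f` grows at most linearly exponentially towards every cusp: for every `A ∈ SL₂(ℤ)`, `f(Aτ)` is
`O(exp(C Im τ))` as `Im τ → ∞`, uniformly in vertical strips of bounded width. -/
def LinExpGrowth (f : UpperHalfPlane → ℂ) : Prop :=
  ∀ (A : Matrix.SpecialLinearGroup (Fin 2) ℤ) (R : ℝ), ∃ K C : ℝ, ∀ τ : UpperHalfPlane,
    |τ.re| ≤ R → 1 ≤ τ.im → ‖f (A • τ)‖ ≤ K * Real.exp (C * τ.im)

/-- Smoothness on the upper half-plane. -/
def SmoothH (f : UpperHalfPlane → ℂ) : Prop :=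
  ContDiffOn ℝ (⊤ : ℕ∞) (fun z : ℂ => f (UpperHalfPlane.ofComplex z)) {z | 0 < z.im}

/-- Smoothness of a function on `ℋ × E₁ × E₂` for complex vector spaces `E₁`, `E₂`, in linear
coordinates on `E₁` and `E₂`. -/
def SmoothProd {E₁ E₂ : Type*} [AddCommGroup E₁] [Module ℂ E₁] [AddCommGroup E₂] [Module ℂ E₂]
    (Φ : UpperHalfPlane → E₁ → E₂ → ℂ) : Prop :=
  ∀ (m n : ℕ) (a : (Fin m → ℂ) ≃ₗ[ℂ] E₁) (b : (Fin n → ℂ) ≃ₗ[ℂ] E₂),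
    ContDiffOn ℝ (⊤ : ℕ∞) (fun p : ℂ × (Fin m → ℂ) × (Fin n → ℂ) =>
      Φ (UpperHalfPlane.ofComplex p.1) (a p.2.1) (b p.2.2)) {p | 0 < p.1.im}

/-- Holomorphy of a function on `E₁ × E₂`, in linear coordinates. -/
def HoloProd {E₁ E₂ : Type*} [AddCommGroup E₁] [Module ℂ E₁] [AddCommGroup E₂] [Module ℂ E₂]
    (φ : E₁ → E₂ → ℂ) : Prop :=
  ∀ (m n : ℕ) (a : (Fin m → ℂ) ≃ₗ[ℂ] E₁) (b : (Fin n → ℂ) ≃ₗ[ℂ] E₂),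
    Differentiable ℂ (fun p : (Fin m → ℂ) × (Fin n → ℂ) => φ (a p.1) (b p.2))

/-- `F : ℋ → ℂ[D_M̄]` is a modular form of weight `(k, l)` and representation `ρ_M̄` with respect to
`Γ`. -/
structure IsModularForm (L : EvenLattice d V) (k l : ℤ) (Γ : Subgroup (unitaryZ d))
    (F : UpperHalfPlane → L.Disc → ℂ) : Prop where
  modular : ∀ A ∈ Γ, ∀ τ, F (act A τ) =
    (fj A τ ^ k * (starRingEnd ℂ) (fj A τ) ^ l) • (L.weilRepBar A).mulVec (F τ)
  smooth : ∀ γ, SmoothH fun τ => F τ γ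
  growth : ∀ γ, LinExpGrowth fun τ => F τ γ

/-- The functions `f_λ`, `λ ∈ M*`, are the coefficients of the theta-type Fourier expansion of `Φ`:
`Φ(τ, ζ, ω) = ∑_{λ ∈ M*} f_λ(τ) 𝐞(τ|λ_{v₊}|² + τ̄|λ_{v₋}|² + ⟨ζ, λ⟩ + ⟨λ, ω⟩)`. -/
def IsFourierExpansion (L : EvenLattice d V) (v : GrJ L)
    (Φ : UpperHalfPlane → VC d V → VCbar d V → ℂ) (f : L.dual → UpperHalfPlane → ℂ) : Prop :=
  ∀ τ ζ ω, HasSum (fun x : L.dual => f x τ * L.thetaTerm v τ ζ ω x) (Φ τ ζ ω)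

/-- `Φ` is a Hermitian Jacobi form of weight `(k, l)` and index `(M, v)` with respect to `Γ`.
In `growth`, the family `f` is unique (uniqueness of Fourier expansions) and it exists as soon as the
conditions `smooth`, `holomorphic` and `periodic` hold. -/
structure IsHermitianJacobiForm (L : EvenLattice d V) (v : GrJ L) (k l : ℤ)
    (Γ : Subgroup (unitaryZ d)) (Φ : UpperHalfPlane → VC d V → VCbar d V → ℂ) : Prop where
  smooth : SmoothProd Φ
  holomorphic : ∀ τ, HoloProd (Φ τ)
  periodic : ∀ σ ∈ L.M, ∀ ν ∈ L.M, ∀ (τ : UpperHalfPlane) (ζ : VC d V) (ω : VCbar d V),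
    Φ τ
      (ζ + (τ : ℂ) • toVC (v.projPos (1 ⊗ₜ σ)) + (starRingEnd ℂ) (τ : ℂ) • toVC (v.projNeg (1 ⊗ₜ σ))
        + toVC (1 ⊗ₜ ν))
      (ω + (τ : ℂ) • toVCbar (v.projPos (1 ⊗ₜ σ))
        + (starRingEnd ℂ) (τ : ℂ) • toVCbar (v.projNeg (1 ⊗ₜ σ)) + toVCbar (1 ⊗ₜ ν)) =
    expC (-(τ * v.normPos σ) - (starRingEnd ℂ) (τ : ℂ) * v.normNeg σ
      - L.formC ζ (1 ⊗ₜ σ) - L.formC (1 ⊗ₜ σ) ω) * Φ τ ζ ω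
  modular : ∀ A ∈ Γ, ∀ (τ : UpperHalfPlane) (ζ : VC d V) (ω : VCbar d V),
    Φ (act A τ)
      ((fj A τ)⁻¹ • v.posC ζ + ((starRingEnd ℂ) (fjc A τ))⁻¹ • v.negC ζ)
      ((fjc A τ)⁻¹ • v.posCbar ω + ((starRingEnd ℂ) (fj A τ))⁻¹ • v.negCbar ω) =
    fj A τ ^ k * (starRingEnd ℂ) (fj A τ) ^ l *
      expC (entry A 1 0 * L.formC (v.posC ζ) (v.posCbar ω) / fj A τ
        + (starRingEnd ℂ) (entry A 1 0) * L.formC (v.negC ζ) (v.negCbar ω) /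
          (starRingEnd ℂ) (fj A τ)) * Φ τ ζ ω
  growth : ∀ f, IsFourierExpansion L v Φ f → ∀ x, LinExpGrowth (f x)

end HermJacobi

end

/-! Put z = ζ + ω ∈ V ⊗ ℂ. The extended pairing vanishes when its second argument lies in V_ℂ or its
first lies in V_ℂ̄, so ⟨ζ, λ⟩ + ⟨λ, ω⟩ = (z, λ) for the bilinear trace form. For fixed τ a Hermitian
Jacobi form is therefore one entire function of z. Periodicity under M gives it a Fourier expansion
over the trace dual of M, which is M* because 𝒟⁻¹ is the trace dual of 𝒪
(`EvenLattice.exists_expansion`). The translation law for τσ_{v₊} + τ̄σ_{v₋} says exactly that the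
normalized coefficients satisfy f_{λ-σ} = f_λ. Hence f_λ depends only on λ + M, and collecting the
cosets gives Φ = [Θ_M, F] with F_γ = f_λ (`EvenLattice.exists_theta_decomposition`). Uniqueness of
Fourier coefficients makes the components of Θ_M linearly independent as functions of z
(`EvenLattice.thetaZ_independent`), hence F unique.

Modularity on either side then rests on the theta transformation law `EvenLattice.theta_act`: Θ_M
has weight (b₊, b₋) and transforms by the complex conjugate of the matrix of ρ_M̄. This matrix is
unitary, so the pairing with F is invariant, and by independence the laws for Φ and for F are
equivalent. The group U(1,1)(ℤ) consists of the products of roots of unity with elements of SL₂(ℤ).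
The generators T and ξ act on Θ_M by inspection, and S acts by Poisson summation of a shifted
Gaussian. Only the sign of the Poisson constant C is tracked: applying S twice at τ = i and
comparing coefficients gives C²|D_M| = 1 and the orthogonality of the characters of D_M, so no
covolume is needed. The matrix of ρ_M̄ is a choice from a multiplicatively generated graph; the law
is proved for every pair in the graph, so it holds for the chosen matrix without first showing that
the graph is single-valued.

Indefinite signature costs nothing: in an orthogonal real frame adapted to v the theta term is 𝐞(∑
β_i y_i² + w_i y_i) with β_i = τ or -τ̄, both in the upper half-plane. Thus all convergence and
smoothness comes from one positive definite series `thetaSeries`, holomorphic in (β, w). Finally F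
is smooth because it solves, near each point, a linear system whose matrix of theta values is
invertible (Cramer's rule), and its growth is that of the f_λ, since these are its components. -/

noncomputable section

namespace HermJacobi

set_option linter.unusedSectionVars false

section Analysis

open MeasureTheory Filter Topology Set

/-! ### Fourier series of periodic functions on ℝ^ι -/

section Fourier

variable {ι : Type*} [Fintype ι]

/-- The half-open unit box with lower corner `a`. -/
def unitBox (a : ι → ℝ) : Set (ι → ℝ) := {x | ∀ i, x i ∈ Ioc (a i) (a i + 1)}

/-- The vector of integers `n`, as a real vector. -/
def intVec (n : ι → ℤ) : ι → ℝ := fun i => n i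

/-- `f` is periodic with respect to the standard lattice. -/
def IsIntPeriodic (f : (ι → ℝ) → ℂ) : Prop := ∀ (x : ι → ℝ) (n : ι → ℤ), f (x + intVec n) = f x

/-- The Fourier coefficient of a periodic function, as an integral over the unit box. -/
def boxCoeff (f : (ι → ℝ) → ℂ) (n : ι → ℤ) : ℂ :=
  ∫ x in unitBox (0 : ι → ℝ), expC (-∑ i, (n i : ℂ) * x i) * f x

theorem expC_ne_zero (z : ℂ) : expC z ≠ 0 := Complex.exp_ne_zero _

theorem expC_zero : expC 0 = 1 := by simp [expC]

theorem expC_neg (z : ℂ) : expC (-z) = (expC z)⁻¹ := by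
  rw [expC, expC, mul_neg, Complex.exp_neg]

theorem norm_expC (z : ℂ) : ‖expC z‖ = Real.exp (-(2 * Real.pi * z.im)) := by
  rw [expC, Complex.norm_exp]
  congr 1
  simp

theorem continuous_expC : Continuous expC := by unfold expC; fun_prop

theorem expC_sum {κ : Type*} (s : Finset κ) (f : κ → ℂ) :
    expC (∑ i ∈ s, f i) = ∏ i ∈ s, expC (f i) := by
  simp only [expC, Finset.mul_sum, Complex.exp_sum]

theorem conj_expC (z : ℂ) : (starRingEnd ℂ) (expC z) = expC (-(starRingEnd ℂ) z) := by
  rw [expC, expC, ← Complex.exp_conj]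
  congr 1
  simp only [map_mul, Complex.conj_ofReal, Complex.conj_I, map_ofNat]
  ring

theorem expC_intDot (m n : ι → ℤ) : expC (∑ i, (m i : ℂ) * (intVec n i : ℂ)) = 1 := by
  have : (∑ i, (m i : ℂ) * (intVec n i : ℂ)) = ((∑ i, m i * n i : ℤ) : ℂ) := by
    push_cast; rfl
  rw [this, EvenLattice.expC_int]

theorem mFourier_coe (n : ι → ℤ) (x : ι → ℝ) :
    UnitAddTorus.mFourier n (fun i => (x i : UnitAddCircle)) = expC (∑ i, (n i : ℂ) * x i) := by
  rw [expC_sum]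
  simp only [UnitAddTorus.mFourier, ContinuousMap.coe_mk]
  refine Finset.prod_congr rfl fun i _ => ?_
  rw [fourier_coe_apply, expC]
  congr 1
  push_cast
  ring

/-- The function on the torus induced by a periodic function. -/
def torusLift (f : (ι → ℝ) → ℂ) (t : UnitAddTorus ι) : ℂ :=
  f fun i => (AddCircle.equivIoc 1 0 (t i) : ℝ)

theorem torusLift_coe {f : (ι → ℝ) → ℂ} (hf : IsIntPeriodic f) (x : ι → ℝ) :
    torusLift f (fun i => (x i : UnitAddCircle)) = f x := by
  have h : ∀ i, ∃ n : ℤ, x i + n = (AddCircle.equivIoc 1 0 (x i : UnitAddCircle) : ℝ) := by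
    intro i
    have h1 : ((AddCircle.equivIoc 1 0 (x i : UnitAddCircle) : ℝ) : UnitAddCircle) = x i :=
      (AddCircle.equivIoc (1 : ℝ) 0).symm_apply_apply (x i : UnitAddCircle)
    obtain ⟨n, hn⟩ := AddSubgroup.mem_zmultiples_iff.mp (QuotientAddGroup.eq.mp h1.symm)
    refine ⟨n, ?_⟩
    rw [zsmul_eq_mul, mul_one] at hn
    linarith
  choose n hn using h
  rw [torusLift, ← hf x n]
  congr 1
  funext i
  exact (hn i).symm

/-- A product of open quotient maps is again one, so continuity on the torus can be tested after
pulling back to ℝ^ι. -/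
theorem isQuotientMap_torus :
    IsOpenQuotientMap (fun (x : ι → ℝ) => (fun i => (x i : UnitAddCircle) : UnitAddTorus ι)) :=
  IsOpenQuotientMap.piMap (fun _ => QuotientAddGroup.isOpenQuotientMap_mk)

theorem continuous_torusLift {f : (ι → ℝ) → ℂ} (hf : IsIntPeriodic f) (hc : Continuous f) :
    Continuous (torusLift f) := by
  rw [isQuotientMap_torus.isQuotientMap.continuous_iff]
  have : torusLift f ∘ (fun (x : ι → ℝ) => (fun i => (x i : UnitAddCircle) : UnitAddTorus ι)) = f :=
    funext fun x => torusLift_coe hf x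
  rw [this]
  exact hc

/-- The corner `a` is arbitrary because the torus integral does not see the choice of fundamental
box. -/
theorem mFourierCoeff_torusLift {f : (ι → ℝ) → ℂ} (hf : IsIntPeriodic f) (n : ι → ℤ) (a : ι → ℝ) :
    UnitAddTorus.mFourierCoeff (torusLift f) n =
      ∫ x in unitBox a, expC (-∑ i, (n i : ℂ) * x i) * f x := by
  rw [UnitAddTorus.mFourierCoeff_eq_integral _ _ a]
  refine integral_congr_ae (Eventually.of_forall fun x => ?_)
  simp only [torusLift_coe hf, mFourier_coe, smul_eq_mul]
  simp

/-- Both integrals are the zeroth Fourier coefficient of the same function on the torus. -/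
theorem integral_unitBox_eq {f : (ι → ℝ) → ℂ} (hf : IsIntPeriodic f) (a : ι → ℝ) :
    ∫ x in unitBox a, f x = ∫ x in unitBox 0, f x := by
  have h := mFourierCoeff_torusLift hf 0 a
  rw [mFourierCoeff_torusLift hf 0 0] at h
  simpa [expC_zero] using h.symm

theorem hasSum_boxCoeff {f : (ι → ℝ) → ℂ} (hf : IsIntPeriodic f) (hc : Continuous f)
    (hs : Summable (boxCoeff f)) (x : ι → ℝ) :
    HasSum (fun n => boxCoeff f n * expC (∑ i, (n i : ℂ) * x i)) (f x) := by
  have h0 : ∀ n, UnitAddTorus.mFourierCoeff (torusLift f) n = boxCoeff f n :=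
    fun n => mFourierCoeff_torusLift hf n 0
  have h1 : Summable (UnitAddTorus.mFourierCoeff (⟨_, continuous_torusLift hf hc⟩ : C(UnitAddTorus ι, ℂ))) :=
    hs.congr fun n => (h0 n).symm
  have h2 := UnitAddTorus.hasSum_mFourier_series_apply_of_summable h1 (fun i => (x i : UnitAddCircle))
  simp only [ContinuousMap.coe_mk, torusLift_coe hf, mFourier_coe, h0, smul_eq_mul] at h2
  exact h2

theorem unitBox_eq_pi (a : ι → ℝ) : unitBox a = Set.univ.pi fun i => Ioc (a i) (a i + 1) := by
  ext x; simp [unitBox]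

theorem measurableSet_unitBox (a : ι → ℝ) : MeasurableSet (unitBox a) := by
  rw [unitBox_eq_pi]
  exact MeasurableSet.univ_pi fun i => measurableSet_Ioc

theorem unitBox_subset_Icc (a : ι → ℝ) : unitBox a ⊆ Icc a (a + 1) := fun _ hx =>
  ⟨fun i => (hx i).1.le, fun i => (hx i).2⟩

theorem volume_unitBox (a : ι → ℝ) : volume (unitBox a) = 1 := by
  rw [unitBox_eq_pi, Real.volume_pi_Ioc]
  simp

theorem integrableOn_unitBox {f : (ι → ℝ) → ℂ} (hf : Continuous f) (a : ι → ℝ) :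
    IntegrableOn f (unitBox a) :=
  (hf.integrableOn_Icc).mono_set (unitBox_subset_Icc a)

theorem isIntPeriodic_expC (n : ι → ℤ) : IsIntPeriodic fun x => expC (∑ i, (n i : ℂ) * x i) := by
  intro x m
  have : (∑ i, (n i : ℂ) * ((x + intVec m) i : ℝ)) =
      ∑ i, (n i : ℂ) * x i + ∑ i, (n i : ℂ) * (intVec m i : ℂ) := by
    rw [← Finset.sum_add_distrib]
    refine Finset.sum_congr rfl fun i _ => ?_
    rw [Pi.add_apply]
    push_cast; ring
  simp only [this, EvenLattice.expC_add, expC_intDot, mul_one]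

/-- For n ≠ 0 choose c with 𝐞(n·c) ≠ 1. Translating the box by c leaves the integral unchanged by
periodicity, but also multiplies it by 𝐞(n·c), so it vanishes. -/
theorem integral_expC_unitBox (n : ι → ℤ) :
    ∫ x in unitBox (0 : ι → ℝ), expC (∑ i, (n i : ℂ) * x i) = if n = 0 then 1 else 0 := by
  split_ifs with h
  · subst h
    simp [expC_zero, measureReal_def, volume_unitBox]
  · obtain ⟨j, hj⟩ := Function.ne_iff.mp h
    classical
    have hc : ∃ c : ι → ℝ, expC (∑ i, (n i : ℂ) * c i) ≠ 1 := by
      -- Here n·c = 1/2, and 𝐞(1/2) = -1.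
      refine ⟨Pi.single j (1 / (2 * n j)), ?_⟩
      have : (∑ i, (n i : ℂ) * ((Pi.single j (1 / (2 * n j)) : ι → ℝ) i : ℝ)) = 1 / 2 := by
        rw [Finset.sum_eq_single j]
        · simp only [Pi.single_eq_same]
          have : (n j : ℂ) ≠ 0 := by exact_mod_cast hj
          push_cast
          field_simp
        · intro i _ hij; simp [hij]
        · simp
      rw [this, expC]
      have : 2 * (Real.pi : ℂ) * Complex.I * (1 / 2) = Real.pi * Complex.I := by ring
      rw [this, Complex.exp_pi_mul_I]
      norm_num
    obtain ⟨c, hc⟩ := hc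
    have h1 : ∫ x in unitBox c, expC (∑ i, (n i : ℂ) * x i) =
        ∫ x in unitBox 0, expC (∑ i, (n i : ℂ) * x i) := integral_unitBox_eq (isIntPeriodic_expC n) c
    have h2 : ∫ x in unitBox c, expC (∑ i, (n i : ℂ) * x i) =
        ∫ x in unitBox (0 : ι → ℝ), expC (∑ i, (n i : ℂ) * ((c + x) i : ℝ)) := by
      have hpre : (fun x => c + x) ⁻¹' unitBox c = unitBox (0 : ι → ℝ) := by
        ext x
        simp only [unitBox, mem_preimage, mem_ofPred_eq, Pi.add_apply, mem_Ioc, Pi.zero_apply]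
        refine forall_congr' fun i => ⟨fun h => ⟨by linarith [h.1], by linarith [h.2]⟩,
          fun h => ⟨by linarith [h.1], by linarith [h.2]⟩⟩
      rw [← hpre]
      exact ((measurePreserving_add_left volume c).setIntegral_preimage_emb
        (measurableEmbedding_addLeft c) (fun x => expC (∑ i, (n i : ℂ) * x i)) (unitBox c)).symm
    have h3 : ∀ x : ι → ℝ, expC (∑ i, (n i : ℂ) * ((c + x) i : ℝ)) =
        expC (∑ i, (n i : ℂ) * c i) * expC (∑ i, (n i : ℂ) * x i) := by
      intro x
      rw [← EvenLattice.expC_add, ← Finset.sum_add_distrib]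
      congr 1
      refine Finset.sum_congr rfl fun i _ => ?_
      rw [Pi.add_apply]; push_cast; ring
    simp_rw [h3] at h2
    rw [integral_const_mul, h1] at h2
    by_contra hne
    exact hc (mul_right_cancel₀ hne (by rw [one_mul]; exact h2.symm))

/-- Uniqueness of the coefficients of an absolutely convergent Fourier series. -/
theorem eq_boxCoeff_of_hasSum {a : (ι → ℤ) → ℂ} (ha : Summable a) {f : (ι → ℝ) → ℂ}
    (h : ∀ x : ι → ℝ, HasSum (fun n => a n * expC (∑ i, (n i : ℂ) * x i)) (f x)) (m : ι → ℤ) :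
    boxCoeff f m = a m := by
  have hne : ∀ (n : ι → ℤ) (x : ι → ℝ), ‖expC (∑ i, (n i : ℂ) * x i)‖ = 1 := by
    intro n x
    rw [norm_expC]; simp
  -- The series twisted by 𝐞(-m·x): its termwise integral over the box keeps only n = m.
  set F : (ι → ℤ) → (ι → ℝ) → ℂ := fun n x => a n * expC (∑ i, ((n - m) i : ℂ) * x i) with hF
  have hval : ∀ n, ∫ x in unitBox 0, F n x = if n = m then a m else 0 := by
    intro n
    simp only [hF]
    rw [integral_const_mul]
    have := integral_expC_unitBox (n - m)
    push_cast [Pi.sub_apply] at this ⊢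
    rw [this]
    by_cases hnm : n = m
    · simp [hnm]
    · simp [hnm, sub_eq_zero]
  have hint : ∀ n, Integrable (F n) (volume.restrict (unitBox 0)) := by
    intro n
    apply integrableOn_unitBox
    have := continuous_expC
    fun_prop
  have hsum : Summable fun n => ∫ x in unitBox 0, ‖F n x‖ := by
    refine ha.norm.congr fun n => ?_
    simp only [hF, norm_mul]
    have : ∀ x : ι → ℝ, ‖a n‖ * ‖expC (∑ i, ((n - m) i : ℂ) * x i)‖ = ‖a n‖ := by
      intro x
      have := hne (n - m) x
      rw [this, mul_one]
    simp_rw [this]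
    simp [measureReal_def, volume_unitBox]
  have h1 := integral_tsum_of_summable_integral_norm hint hsum
  simp_rw [hval] at h1
  rw [tsum_ite_eq] at h1
  rw [h1, boxCoeff]
  refine integral_congr_ae (Eventually.of_forall fun x => ?_)
  have h2 := (h x).mul_left (expC (-∑ i, (m i : ℂ) * x i))
  simp only
  rw [← h2.tsum_eq]
  refine tsum_congr fun n => ?_
  simp only [hF]
  rw [mul_left_comm, ← EvenLattice.expC_add]
  congr 2
  rw [← Finset.sum_neg_distrib, ← Finset.sum_add_distrib]
  refine Finset.sum_congr rfl fun i _ => ?_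
  push_cast [Pi.sub_apply]; ring

end Fourier

/-! ### Poisson summation for the standard lattice -/

section Poisson

variable {ι : Type*} [Fintype ι]

theorem iUnion_unitBox : ⋃ n : ι → ℤ, unitBox (intVec n) = univ := by
  refine eq_univ_of_forall fun x => mem_iUnion.mpr ⟨fun i => ⌈x i⌉ - 1, fun i => ?_⟩
  have h1 := Int.ceil_lt_add_one (x i)
  have h2 := Int.le_ceil (x i)
  simp only [intVec, mem_Ioc]
  push_cast
  constructor <;> linarith

theorem pairwise_disjoint_unitBox :
    Pairwise (Function.onFun Disjoint fun n : ι → ℤ => unitBox (intVec n)) := by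
  intro n m hnm
  rw [Function.onFun, Set.disjoint_left]
  intro x hx hy
  apply hnm
  funext i
  have h1 := hx i
  have h2 := hy i
  simp only [intVec, mem_Ioc] at h1 h2
  have h3 : (n i : ℝ) < m i + 1 := by linarith
  have h4 : (m i : ℝ) < n i + 1 := by linarith
  have h5 : n i < m i + 1 := by exact_mod_cast h3
  have h6 : m i < n i + 1 := by exact_mod_cast h4
  omega

theorem setIntegral_unitBox_add {E : Type*} [NormedAddCommGroup E] [NormedSpace ℝ E]
    (g : (ι → ℝ) → E) (c : ι → ℝ) :
    ∫ x in unitBox (0 : ι → ℝ), g (x + c) = ∫ x in unitBox c, g x := by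
  have hpre : (fun x => x + c) ⁻¹' unitBox c = unitBox (0 : ι → ℝ) := by
    ext x
    simp only [unitBox, mem_preimage, mem_ofPred_eq, Pi.add_apply, mem_Ioc, Pi.zero_apply]
    refine forall_congr' fun i => ⟨fun h => ⟨by linarith [h.1], by linarith [h.2]⟩,
      fun h => ⟨by linarith [h.1], by linarith [h.2]⟩⟩
  rw [← hpre]
  exact (measurePreserving_add_right volume c).setIntegral_preimage_emb
    (measurableEmbedding_addRight c) g (unitBox c)

/-- The integral translates of the half-open box tile ℝ^ι. -/
theorem hasSum_integral_unitBox {E : Type*} [NormedAddCommGroup E] [NormedSpace ℝ E]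
    {g : (ι → ℝ) → E} (hg : Integrable g) :
    HasSum (fun n : ι → ℤ => ∫ x in unitBox (0 : ι → ℝ), g (x + intVec n)) (∫ x, g x) := by
  have h := hasSum_integral_iUnion (μ := volume) (f := g)
    (s := fun n : ι → ℤ => unitBox (intVec n)) (fun n => measurableSet_unitBox _)
    pairwise_disjoint_unitBox hg.integrableOn
  rw [iUnion_unitBox, setIntegral_univ] at h
  simpa only [setIntegral_unitBox_add] using h

theorem integrableOn_unitBox_add {E : Type*} [NormedAddCommGroup E]
    {g : (ι → ℝ) → E} (hg : Integrable g) (c : ι → ℝ) :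
    Integrable (fun x => g (x + c)) (volume.restrict (unitBox (0 : ι → ℝ))) :=
  ((measurePreserving_add_right volume c).integrable_comp_of_integrable hg).integrableOn

/-- The Fourier transform over `ℝ^ι`, at integral frequencies. -/
def intFourier (f : (ι → ℝ) → ℂ) (n : ι → ℤ) : ℂ := ∫ x, expC (-∑ i, (n i : ℂ) * x i) * f x

/-- The Poisson summation formula for the standard lattice. -/
theorem hasSum_intFourier {f : (ι → ℝ) → ℂ} (hf : Integrable f)
    (hc : Continuous fun x => ∑' n : ι → ℤ, f (x + intVec n)) (hs : Summable (intFourier f)) :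
    HasSum (intFourier f) (∑' n : ι → ℤ, f (intVec n)) := by
  set F : (ι → ℝ) → ℂ := fun x => ∑' n : ι → ℤ, f (x + intVec n) with hF
  have hper : IsIntPeriodic F := by
    intro x m
    simp only [hF]
    rw [← (Equiv.addRight (-m)).tsum_eq]
    refine tsum_congr fun n => ?_
    congr 1
    funext i
    simp [intVec]
    ring
  -- Unfolding: the character is invariant under integral shifts, so the integral of the
  -- periodization over one box is the integral of f over all boxes.
  have hcoeff : ∀ m, boxCoeff F m = intFourier f m := by
    intro m
    have hcont : Continuous fun x : ι → ℝ => expC (-∑ i, (m i : ℂ) * x i) := by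
      have := continuous_expC
      fun_prop
    have hnorm : ∀ x : ι → ℝ, ‖expC (-∑ i, (m i : ℂ) * x i)‖ = 1 := by
      intro x; rw [norm_expC]; simp
    have hg : Integrable fun x : ι → ℝ => expC (-∑ i, (m i : ℂ) * x i) * f x :=
      hf.bdd_mul hcont.aestronglyMeasurable (c := 1) (Eventually.of_forall fun x => (hnorm x).le)
    have hterm : ∀ (n : ι → ℤ) (x : ι → ℝ),
        expC (-∑ i, (m i : ℂ) * ((x + intVec n) i : ℝ)) = expC (-∑ i, (m i : ℂ) * x i) := by
      intro n x
      have := isIntPeriodic_expC (-m) x n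
      simpa using this
    have h1 := hasSum_integral_unitBox hg
    have h2 := (hasSum_integral_unitBox hg.norm).summable
    have h3 := integral_tsum_of_summable_integral_norm
      (fun n => integrableOn_unitBox_add hg (intVec n)) h2
    rw [h1.tsum_eq] at h3
    rw [intFourier, h3, boxCoeff]
    refine integral_congr_ae (Eventually.of_forall fun x => ?_)
    simp only [hterm, tsum_mul_left, hF]
  -- Poisson summation is the Fourier series of the periodization, read at x = 0.
  have h := hasSum_boxCoeff hper hc (by rw [funext hcoeff]; exact hs) 0
  have h0 : F 0 = ∑' n : ι → ℤ, f (intVec n) := by simp only [hF, zero_add]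
  rw [← h0]
  refine h.congr_fun fun n => ?_
  simp [hcoeff, expC_zero]

end Poisson

/-! ### Fourier expansion of entire periodic functions -/

section Entire

variable {ι : Type*} [Fintype ι]

/-- The complexification of a real vector. -/
def cvec (x : ι → ℝ) : ι → ℂ := fun i => x i

theorem continuous_cvec : Continuous (cvec : (ι → ℝ) → ι → ℂ) := by unfold cvec; fun_prop

/-- Differentiation under the integral sign. A bound for G over K times a disc of radius 2 bounds
the derivative on the disc of radius 1 by Cauchy's estimate, which is the required domination. -/
theorem differentiable_integral_of_continuous {α : Type*} [TopologicalSpace α] [MeasurableSpace α]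
    [OpensMeasurableSpace α] [T2Space α] {μ : Measure α} [SigmaFinite μ] [IsFiniteMeasureOnCompacts μ]
    [SecondCountableTopology α] {K s : Set α}
    (hK : IsCompact K) (hsK : s ⊆ K) (hsm : MeasurableSet s) {G : α → ℂ → ℂ}
    (hG : Continuous (Function.uncurry G)) (hd : ∀ x, Differentiable ℂ (G x)) :
    Differentiable ℂ fun t => ∫ x in s, G x t ∂μ := by
  intro t₀
  obtain ⟨C, hC⟩ := (hK.prod (isCompact_closedBall t₀ 2)).exists_bound_of_continuousOn hG.continuousOn
  have hfin : μ s < ⊤ := lt_of_le_of_lt (measure_mono hsK) hK.measure_lt_top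
  have : IsFiniteMeasure (μ.restrict s) := ⟨by simpa using hfin⟩
  have hmeas : ∀ t, AEStronglyMeasurable (fun x => G x t) (μ.restrict s) := fun t =>
    (hG.comp (Continuous.prodMk_left t)).aestronglyMeasurable
  refine (hasDerivAt_integral_of_dominated_loc_of_deriv_le (μ := μ.restrict s)
    (F := fun t x => G x t) (F' := fun t x => deriv (G x) t) (bound := fun _ => C)
    (Metric.ball_mem_nhds t₀ one_pos) (Eventually.of_forall hmeas) ?_ ?_ ?_ ?_ ?_).2.differentiableAt
  · refine Integrable.of_bound (hmeas t₀) C ?_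
    filter_upwards [ae_restrict_mem hsm] with x hx
    exact hC (x, t₀) ⟨hsK hx, by simp⟩
  · have h1 : Measurable fun p : α × ℂ => deriv (G p.1) p.2 := measurable_deriv_with_param hG
    exact (h1.comp (measurable_id.prodMk measurable_const)).aestronglyMeasurable
  · filter_upwards [ae_restrict_mem hsm] with x hx t ht
    have := Complex.norm_deriv_le_of_forall_mem_sphere_norm_le (f := G x) (c := t) (C := C) one_pos
      (hd x).diffContOnCl (fun z hz => hC (x, z) ⟨hsK hx, by
        rw [mem_sphere_iff_norm] at hz
        rw [Metric.mem_ball, dist_eq_norm] at ht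
        rw [Metric.mem_closedBall, dist_eq_norm]
        calc ‖z - t₀‖ = ‖(z - t) + (t - t₀)‖ := by ring_nf
          _ ≤ ‖z - t‖ + ‖t - t₀‖ := norm_add_le _ _
          _ ≤ 2 := by linarith⟩)
    simpa using this
  · exact integrable_const C
  · exact Eventually.of_forall fun x t _ => ((hd x) t).hasDerivAt

/-- A summable exponential majorant over `ℤ^ι`. -/
theorem summable_exp_neg_sum_abs {c : ℝ} (hc : 0 < c) :
    Summable fun n : ι → ℤ => Real.exp (-(c * ∑ i, |(n i : ℝ)|)) := by
  classical
  have h1 : Summable fun k : ℤ => Real.exp (-(c * |(k : ℝ)|)) := by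
    have hnat : Summable fun k : ℕ => Real.exp (-(c * k)) := by
      have := Real.summable_exp_nat_mul_iff.mpr (neg_lt_zero.mpr hc)
      refine this.congr fun k => ?_
      ring_nf
    refine Summable.of_nat_of_neg ?_ ?_ <;> simpa using hnat
  refine summable_of_sum_le (c := ∏ _i : ι, ∑' k : ℤ, Real.exp (-(c * |(k : ℝ)|)))
    (fun n => (Real.exp_pos _).le) fun u => ?_
  -- A finite set lies in the product of its coordinate projections, over which the sum factors into
  -- one-dimensional geometric sums.
  have hsub : u ⊆ Fintype.piFinset fun i => u.image fun n => n i := by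
    intro n hn
    rw [Fintype.mem_piFinset]
    exact fun i => Finset.mem_image_of_mem _ hn
  calc ∑ n ∈ u, Real.exp (-(c * ∑ i, |(n i : ℝ)|))
      ≤ ∑ n ∈ Fintype.piFinset fun i => u.image fun n : ι → ℤ => n i, Real.exp (-(c * ∑ i, |(n i : ℝ)|)) :=
        Finset.sum_le_sum_of_subset_of_nonneg hsub fun _ _ _ => (Real.exp_pos _).le
    _ = ∑ n ∈ Fintype.piFinset fun i => u.image fun n : ι → ℤ => n i, ∏ i, Real.exp (-(c * |(n i : ℝ)|)) := by
        refine Finset.sum_congr rfl fun n _ => ?_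
        rw [← Real.exp_sum, Finset.mul_sum, Finset.sum_neg_distrib]
    _ = ∏ i, ∑ k ∈ u.image (fun n : ι → ℤ => n i), Real.exp (-(c * |(k : ℝ)|)) := by
        rw [Finset.prod_univ_sum]
    _ ≤ ∏ _i : ι, ∑' k : ℤ, Real.exp (-(c * |(k : ℝ)|)) :=
        Finset.prod_le_prod (fun i _ => Finset.sum_nonneg fun _ _ => (Real.exp_pos _).le)
          fun i _ => h1.sum_le_tsum _ fun _ _ => (Real.exp_pos _).le

/-- The Fourier expansion of an entire function which is periodic under the standard lattice. -/
theorem exists_hasSum_of_entire_periodic {φ : (ι → ℂ) → ℂ} (hφ : Differentiable ℂ φ)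
    (hper : ∀ (z : ι → ℂ) (n : ι → ℤ), φ (z + cvec (intVec n)) = φ z) :
    ∃ a : (ι → ℤ) → ℂ, ∀ z : ι → ℂ, HasSum (fun n => a n * expC (∑ i, (n i : ℂ) * z i)) (φ z) := by
  classical
  have hcont := hφ.continuous
  have hexp := continuous_expC
  -- the integrand
  set g : (ι → ℤ) → (ι → ℂ) → ℂ := fun n z => expC (-∑ i, (n i : ℂ) * z i) * φ z with hg
  have hgper : ∀ n z m, g n (z + cvec (intVec m)) = g n z := by
    intro n z m
    simp only [hg, hper]
    congr 1
    have : -∑ i, (n i : ℂ) * (z + cvec (intVec m)) i =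
        -∑ i, (n i : ℂ) * z i + ∑ i, ((-n) i : ℂ) * (intVec m i : ℂ) := by
      simp only [Pi.add_apply, mul_add, Finset.sum_add_distrib, cvec]
      simp
      ring
    rw [this, EvenLattice.expC_add, ]
    have := expC_intDot (-n) m
    push_cast [Pi.neg_apply] at this ⊢
    rw [this, mul_one]
  have hgd : ∀ n, Differentiable ℂ (g n) := by
    intro n
    have : Differentiable ℂ expC := by unfold expC; fun_prop
    exact (this.comp (by fun_prop)).mul hφ
  have hgc : ∀ n, Continuous (g n) := fun n => (hgd n).continuous
  -- independence of the base point
  have hconst : ∀ n (w : ι → ℝ), ∫ x in unitBox (0 : ι → ℝ), g n (cvec x + Complex.I • cvec w) =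
      ∫ x in unitBox (0 : ι → ℝ), g n (cvec x) := by
    intro n w
    -- As a function of t the integral is entire, and real shifts of t only move the box, which
    -- periodicity absorbs. So its derivative vanishes and its values at t = i and t = 0 agree. This
    -- is the contour shift.
    set h : ℂ → ℂ := fun t => ∫ x in unitBox (0 : ι → ℝ), g n (cvec x + t • cvec w) with hh
    have hd : Differentiable ℂ h := by
      refine differentiable_integral_of_continuous (isCompact_Icc (a := (0 : ι → ℝ)) (b := 0 + 1))
        (unitBox_subset_Icc 0) (measurableSet_unitBox 0) ?_ ?_
      · have := hgc n
        have := continuous_cvec (ι := ι)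
        simp only [Function.uncurry_def]
        fun_prop
      · intro x
        have := hgd n
        fun_prop
    have hreal : ∀ (t : ℂ) (s : ℝ), h (t + s) = h t := by
      intro t s
      have hp : IsIntPeriodic fun x : ι → ℝ => g n (cvec x + t • cvec w) := by
        intro x m
        simp only
        rw [← hgper n (cvec x + t • cvec w) m]
        congr 1
        funext i
        simp [cvec]
        ring
      have h1 := integral_unitBox_eq hp (s • w)
      rw [← setIntegral_unitBox_add] at h1
      simp only [hh]
      rw [← h1]
      refine integral_congr_ae (Eventually.of_forall fun x => ?_)
      simp only
      congr 1
      funext i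
      simp [cvec]
      ring
    have hderiv : ∀ t, deriv h t = 0 := by
      intro t
      have h1 : HasDerivAt (fun s : ℝ => h (t + s)) (deriv h t) 0 := by
        have h2 : HasDerivAt h (deriv h t) (t + ((0 : ℝ) : ℂ)) := by
          simpa using (hd t).hasDerivAt
        have h3 : HasDerivAt (fun s : ℝ => t + (s : ℂ)) 1 0 := by
          simpa using (Complex.ofRealCLM.hasDerivAt (x := (0 : ℝ))).const_add t
        have h4 := HasDerivAt.comp (0 : ℝ) h2 h3
        simpa [Function.comp_def] using h4
      simp_rw [hreal] at h1
      exact h1.unique (hasDerivAt_const 0 (h t))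
    have := is_const_of_deriv_eq_zero hd hderiv Complex.I 0
    simpa [hh] using this
  set a : (ι → ℤ) → ℂ := fun n => ∫ x in unitBox (0 : ι → ℝ), g n (cvec x) with ha
  -- coefficients of horizontal slices
  have hslice : ∀ n (w : ι → ℝ), boxCoeff (fun x => φ (cvec x + Complex.I • cvec w)) n =
      a n * expC (∑ i, (n i : ℂ) * (Complex.I * w i)) := by
    intro n w
    simp only [ha]
    rw [← hconst n w, mul_comm, ← integral_const_mul, boxCoeff]
    refine integral_congr_ae (Eventually.of_forall fun x => ?_)
    simp only [hg]
    rw [← mul_assoc, ← EvenLattice.expC_add]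
    congr 2
    simp only [Pi.add_apply, Pi.smul_apply, smul_eq_mul, cvec, mul_add, Finset.sum_add_distrib]
    ring
  have hbound : ∀ w : ι → ℝ, ∃ C, ∀ n, ‖a n‖ * Real.exp (-(2 * Real.pi * ∑ i, n i * w i)) ≤ C := by
    intro w
    have hcw : Continuous fun x : ι → ℝ => φ (cvec x + Complex.I • cvec w) := by
      have := continuous_cvec (ι := ι)
      fun_prop
    obtain ⟨C, hC⟩ := (isCompact_Icc (a := (0 : ι → ℝ)) (b := 0 + 1)).exists_bound_of_continuousOn
      hcw.continuousOn
    refine ⟨C, fun n => ?_⟩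
    have him : (∑ i, (n i : ℂ) * (Complex.I * w i)).im = ∑ i, n i * w i := by
      rw [Complex.im_sum]
      refine Finset.sum_congr rfl fun i _ => ?_
      simp
    rw [← him, ← norm_expC, ← norm_mul, ← hslice, boxCoeff]
    have h1 := norm_setIntegral_le_of_norm_le_const (μ := volume) (s := unitBox (0 : ι → ℝ)) (C := C)
      (f := fun x => expC (-∑ i, (n i : ℂ) * x i) * φ (cvec x + Complex.I • cvec w))
      (by rw [volume_unitBox]; simp)
      (fun x hx => by
        rw [norm_mul, norm_expC]
        have : (-∑ i, (n i : ℂ) * x i).im = 0 := by simp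
        rw [this]
        simpa using hC x (unitBox_subset_Icc 0 hx))
    simpa [measureReal_def, volume_unitBox] using h1
  have hsumm : ∀ w : ι → ℝ, Summable fun n => a n * expC (∑ i, (n i : ℂ) * (Complex.I * w i)) := by
    intro w
    choose C hC using hbound
    -- The coefficient bound is used at height w - sgn(n) instead of w, which gains the factor
    -- exp(-2π ∑|n_i|). There are finitely many sign patterns, so one constant D serves all n.
    set sg : (ι → ℤ) → ι → SignType := fun n i => SignType.sign (n i) with hsg
    set D : ℝ := ∑ s : ι → SignType, |C (fun i => w i - ((s i : ℤ) : ℝ))| with hD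
    refine Summable.of_norm_bounded (g := fun n => D * Real.exp (-(2 * Real.pi * ∑ i, |(n i : ℝ)|)))
      ((summable_exp_neg_sum_abs (by positivity)).mul_left D) fun n => ?_
    have him : (∑ i, (n i : ℂ) * (Complex.I * w i)).im = ∑ i, n i * w i := by
      rw [Complex.im_sum]
      refine Finset.sum_congr rfl fun i _ => ?_
      simp
    rw [norm_mul, norm_expC, him]
    have h1 := hC (fun i => w i - ((sg n i : ℤ) : ℝ)) n
    have h2 : C (fun i => w i - ((sg n i : ℤ) : ℝ)) ≤ D :=
      (le_abs_self _).trans (Finset.single_le_sum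
        (f := fun s : ι → SignType => |C (fun i => w i - ((s i : ℤ) : ℝ))|)
        (fun _ _ => abs_nonneg _) (Finset.mem_univ (sg n)))
    have h3 : ∑ i, (n i : ℝ) * (w i - ((sg n i : ℤ) : ℝ)) =
        ∑ i, (n i : ℝ) * w i - ∑ i, |(n i : ℝ)| := by
      rw [← Finset.sum_sub_distrib]
      refine Finset.sum_congr rfl fun i _ => ?_
      have : ((|n i| : ℤ) : ℝ) = (n i : ℝ) * ((sg n i : ℤ) : ℝ) := by
        rw [← Int.cast_mul]
        congr 1
        simp only [hsg]
        exact (self_mul_sign (n i)).symm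
      rw [← Int.cast_abs, this]
      ring
    rw [h3] at h1
    have h4 : ‖a n‖ * Real.exp (-(2 * Real.pi * ∑ i, n i * w i)) =
        ‖a n‖ * Real.exp (-(2 * Real.pi * (∑ i, (n i : ℝ) * w i - ∑ i, |(n i : ℝ)|))) *
          Real.exp (-(2 * Real.pi * ∑ i, |(n i : ℝ)|)) := by
      rw [mul_assoc ‖a n‖, ← Real.exp_add]
      congr 2
      ring
    rw [h4]
    exact mul_le_mul_of_nonneg_right (h1.trans h2) (Real.exp_pos _).le
  refine ⟨a, fun z => ?_⟩
  set x : ι → ℝ := fun i => (z i).re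
  set w : ι → ℝ := fun i => (z i).im
  have hz : z = cvec x + Complex.I • cvec w := by
    funext i
    simp only [Pi.add_apply, Pi.smul_apply, cvec, smul_eq_mul, x, w]
    rw [mul_comm, Complex.re_add_im]
  have hp : IsIntPeriodic fun x : ι → ℝ => φ (cvec x + Complex.I • cvec w) := by
    intro x m
    simp only
    rw [← hper (cvec x + Complex.I • cvec w) m]
    congr 1
    funext i
    simp [cvec]
    ring
  have hcw : Continuous fun x : ι → ℝ => φ (cvec x + Complex.I • cvec w) := by
    have := continuous_cvec (ι := ι)
    fun_prop
  have h := hasSum_boxCoeff hp hcw ((hsumm w).congr fun n => (hslice n w).symm) x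
  rw [hz]
  refine h.congr_fun fun n => ?_
  rw [hslice, mul_assoc, ← EvenLattice.expC_add]
  congr 2
  rw [← Finset.sum_add_distrib]
  refine Finset.sum_congr rfl fun i _ => ?_
  simp only [Pi.add_apply, Pi.smul_apply, cvec, smul_eq_mul]
  ring

end Entire

/-! ### Smoothness of series of exponentials of linear forms -/

section ExpSeries

variable {E : Type} [NormedAddCommGroup E] [NormedSpace ℂ E] {X : Type*}

/-- Local domination of all the moments of the family `exp ∘ ℓ x` on the set `U`. -/
def LocallyDominated (ℓ : X → E →L[ℂ] ℂ) (U : Set E) : Prop :=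
  ∀ p ∈ U, ∀ k : ℕ, ∃ r > 0, Metric.ball p r ⊆ U ∧ ∃ u : X → ℝ, Summable u ∧
    ∀ q ∈ Metric.ball p r, ∀ x, ‖ℓ x‖ ^ k * ‖Complex.exp (ℓ x q)‖ ≤ u x

/-- Differentiating a term brings down one factor ℓ x, so coefficients of order ‖ℓ x‖^k need the
moment k + 1. -/
theorem LocallyDominated.hasFDerivAt {ℓ : X → E →L[ℂ] ℂ} {U : Set E} (H : LocallyDominated ℓ U)
    {F : Type} [NormedAddCommGroup F] [NormedSpace ℂ F] [CompleteSpace F] {c : X → F} {k : ℕ} {K : ℝ}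
    (hc : ∀ x, ‖c x‖ ≤ K * ‖ℓ x‖ ^ k) {p : E} (hp : p ∈ U) :
    HasFDerivAt (fun p => ∑' x, Complex.exp (ℓ x p) • c x)
      (∑' x, Complex.exp (ℓ x p) • (ℓ x).smulRight (c x)) p := by
  obtain ⟨r, hr, -, u, hu, hb⟩ := H p hp (k + 1)
  obtain ⟨r', hr', -, u', hu', hb'⟩ := H p hp k
  have hK : ∀ x (q : E), ‖Complex.exp (ℓ x q) • c x‖ ≤ K * (‖ℓ x‖ ^ k * ‖Complex.exp (ℓ x q)‖) := by
    intro x q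
    rw [norm_smul]
    calc ‖Complex.exp (ℓ x q)‖ * ‖c x‖ ≤ ‖Complex.exp (ℓ x q)‖ * (K * ‖ℓ x‖ ^ k) :=
          mul_le_mul_of_nonneg_left (hc x) (norm_nonneg _)
      _ = _ := by ring
  have h0 : Summable fun x => Complex.exp (ℓ x p) • c x := by
    refine Summable.of_norm_bounded (g := fun x => |K| * u' x) (hu'.mul_left _) fun x => ?_
    refine (hK x p).trans ?_
    refine (mul_le_mul_of_nonneg_right (le_abs_self K) (by positivity)).trans ?_
    exact mul_le_mul_of_nonneg_left (hb' p (Metric.mem_ball_self hr') x) (abs_nonneg K)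
  refine hasFDerivAt_tsum_of_isPreconnected (𝕜 := ℂ) (u := fun x => |K| * u x) (hu.mul_left _)
    (Metric.isOpen_ball (x := p) (ε := r)) (convex_ball p r).isPreconnected
    (f' := fun x q => Complex.exp (ℓ x q) • (ℓ x).smulRight (c x)) ?_ ?_
    (Metric.mem_ball_self hr) h0 (Metric.mem_ball_self hr)
  · intro x q _
    have h1 : HasFDerivAt (fun q => Complex.exp (ℓ x q)) (Complex.exp (ℓ x q) • ℓ x) q :=
      (ℓ x).hasFDerivAt.cexp
    convert h1.smul_const (c x) using 1
    ext v
    simp [mul_smul]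
  · intro x q hq
    rw [norm_smul, ContinuousLinearMap.norm_smulRight_apply]
    calc ‖Complex.exp (ℓ x q)‖ * (‖ℓ x‖ * ‖c x‖)
        ≤ ‖Complex.exp (ℓ x q)‖ * (‖ℓ x‖ * (|K| * ‖ℓ x‖ ^ k)) := by
          gcongr
          exact (hc x).trans (mul_le_mul_of_nonneg_right (le_abs_self K) (by positivity))
      _ = |K| * (‖ℓ x‖ ^ (k + 1) * ‖Complex.exp (ℓ x q)‖) := by ring
      _ ≤ |K| * u x := mul_le_mul_of_nonneg_left (hb q hq x) (abs_nonneg K)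

theorem LocallyDominated.isOpen {ℓ : X → E →L[ℂ] ℂ} {U : Set E} (H : LocallyDominated ℓ U) :
    IsOpen U :=
  Metric.isOpen_iff.mpr fun p hp => let ⟨r, hr, h, _⟩ := H p hp 0; ⟨r, hr, h⟩

/-- The derivative is a series of the same kind, with coefficients ℓ x ⊗ c x in E →L[ℂ] F and growth
order k + 1. The induction on n therefore runs over all target spaces F and all coefficients at
once, and E and F live in one universe so that E →L[ℂ] F is again admissible. -/
theorem LocallyDominated.contDiffOn_nat {ℓ : X → E →L[ℂ] ℂ} {U : Set E}
    (H : LocallyDominated ℓ U) (n : ℕ) :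
    ∀ {F : Type} [NormedAddCommGroup F] [NormedSpace ℂ F] [CompleteSpace F] {c : X → F} {k : ℕ} {K : ℝ}
    (_ : ∀ x, ‖c x‖ ≤ K * ‖ℓ x‖ ^ k),
    ContDiffOn ℂ n (fun p => ∑' x, Complex.exp (ℓ x p) • c x) U := by
  induction n with
  | zero =>
    intro F _ _ _ c k K hc
    rw [Nat.cast_zero, contDiffOn_zero]
    exact fun p hp => (H.hasFDerivAt hc hp).continuousAt.continuousWithinAt
  | succ n ih =>
    intro F _ _ _ c k K hc
    rw [Nat.cast_succ, contDiffOn_succ_iff_fderiv_of_isOpen H.isOpen]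
    refine ⟨fun p hp => (H.hasFDerivAt hc hp).differentiableAt.differentiableWithinAt, by simp, ?_⟩
    refine (ih (c := fun x => (ℓ x).smulRight (c x)) (k := k + 1) (K := K) fun x => ?_).congr
      fun p hp => (H.hasFDerivAt hc hp).fderiv
    rw [ContinuousLinearMap.norm_smulRight_apply]
    calc ‖ℓ x‖ * ‖c x‖ ≤ ‖ℓ x‖ * (K * ‖ℓ x‖ ^ k) := mul_le_mul_of_nonneg_left (hc x) (norm_nonneg _)
      _ = K * ‖ℓ x‖ ^ (k + 1) := by ring

theorem LocallyDominated.contDiffOn {ℓ : X → E →L[ℂ] ℂ} {U : Set E} (H : LocallyDominated ℓ U) :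
    ContDiffOn ℂ (⊤ : ℕ∞) (fun p => ∑' x, Complex.exp (ℓ x p)) U := by
  rw [contDiffOn_infty]
  intro n
  have := H.contDiffOn_nat n (F := ℂ) (c := fun _ => 1) (k := 0) (K := 1) (by simp)
  simpa using this

end ExpSeries

/-! ### The positive definite theta series -/

section ThetaSeries

variable {ι κ : Type} [Fintype ι] [Fintype κ] {X : Type*}

/-- The exponent of the theta series. -/
def thetaExponent (y : ι → ℝ) (p : (ι → ℂ) × (ι → ℂ)) : ℂ :=
  ∑ i, (p.1 i * (y i : ℂ) ^ 2 + p.2 i * y i)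

/-- The domain of the theta series. -/
def thetaDomain (ι : Type) : Set ((ι → ℂ) × (ι → ℂ)) := {p | ∀ i, 0 < (p.1 i).im}

/-- The theta series `∑_x 𝐞(∑_i β_i y_i(x)² + w_i y_i(x))` of a family `y` of real vectors. -/
def thetaSeries (y : X → ι → ℝ) (p : (ι → ℂ) × (ι → ℂ)) : ℂ := ∑' x, expC (thetaExponent (y x) p)

/-- The family `y` is so sparse that its exponential sums converge. -/
def Sparse (y : X → ι → ℝ) : Prop := ∀ c > 0, Summable fun x => Real.exp (-(c * ∑ i, |y x i|))

/-- An injection into ℤ^κ whose coordinates are bounded by ∑|y_i| compares the sum with a convergent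
exponential sum over ℤ^κ. -/
theorem sparse_of_le {y : X → ι → ℝ} {D : X → κ → ℤ} (hD : Function.Injective D) {C : ℝ}
    (h : ∀ x j, |(D x j : ℝ)| ≤ C * ∑ i, |y x i|) : Sparse y := by
  intro c hc
  -- The summand 1 keeps B positive when κ is empty or C = 0.
  set B : ℝ := Fintype.card κ * |C| + 1
  have hB : 0 < B := by positivity
  have h1 := (summable_exp_neg_sum_abs (ι := κ) (c := c / B) (by positivity)).comp_injective hD
  refine Summable.of_nonneg_of_le (fun x => (Real.exp_pos _).le) (fun x => ?_) h1
  rw [Function.comp_apply, Real.exp_le_exp, neg_le_neg_iff]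
  have hs : 0 ≤ ∑ i, |y x i| := Finset.sum_nonneg fun i _ => abs_nonneg _
  have h2 : ∑ j, |(D x j : ℝ)| ≤ B * ∑ i, |y x i| := by
    calc ∑ j, |(D x j : ℝ)| ≤ ∑ _j : κ, |C| * ∑ i, |y x i| :=
          Finset.sum_le_sum fun j _ => (h x j).trans (mul_le_mul_of_nonneg_right (le_abs_self C) hs)
      _ = Fintype.card κ * |C| * ∑ i, |y x i| := by simp [mul_assoc]
      _ ≤ B * ∑ i, |y x i| := mul_le_mul_of_nonneg_right (by simp [B]) hs
  rw [div_mul_eq_mul_div, div_le_iff₀ hB]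
  nlinarith

/-- The exponent as a continuous linear form. -/
def thetaLin (y : ι → ℝ) : (ι → ℂ) × (ι → ℂ) →L[ℂ] ℂ :=
  (2 * Real.pi * Complex.I) • ∑ i, (((y i : ℂ) ^ 2) •
      (ContinuousLinearMap.proj i ∘L ContinuousLinearMap.fst ℂ (ι → ℂ) (ι → ℂ)) +
    (y i : ℂ) • (ContinuousLinearMap.proj i ∘L ContinuousLinearMap.snd ℂ (ι → ℂ) (ι → ℂ)))

theorem thetaLin_apply (y : ι → ℝ) (p : (ι → ℂ) × (ι → ℂ)) :
    thetaLin y p = 2 * Real.pi * Complex.I * thetaExponent y p := by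
  simp only [thetaLin, thetaExponent, smul_apply, sum_apply,
    add_apply, ContinuousLinearMap.comp_apply, ContinuousLinearMap.proj_apply,
    ContinuousLinearMap.coe_fst', ContinuousLinearMap.coe_snd', smul_eq_mul]
  congr 1
  exact Finset.sum_congr rfl fun i _ => by ring

theorem exp_thetaLin (y : ι → ℝ) (p : (ι → ℂ) × (ι → ℂ)) :
    Complex.exp (thetaLin y p) = expC (thetaExponent y p) := by
  rw [thetaLin_apply, expC]

theorem norm_thetaLin_le (y : ι → ℝ) :
    ‖thetaLin y‖ ≤ 2 * Real.pi * (∑ i, y i ^ 2 + ∑ i, |y i|) := by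
  refine ContinuousLinearMap.opNorm_le_bound _
    (by have := Real.pi_pos; positivity) fun p => ?_
  rw [thetaLin_apply, norm_mul]
  have h1 : ‖(2 * Real.pi * Complex.I : ℂ)‖ = 2 * Real.pi := by
    simp [abs_of_pos Real.pi_pos]
  rw [h1, thetaExponent, ← Finset.sum_add_distrib, mul_assoc (2 * Real.pi) _ ‖p‖, Finset.sum_mul]
  refine mul_le_mul_of_nonneg_left ?_ (by have := Real.pi_pos; positivity)
  refine (norm_sum_le _ _).trans (Finset.sum_le_sum fun i _ => ?_)
  have h2 : ‖p.1 i‖ ≤ ‖p‖ := (norm_le_pi_norm p.1 i).trans (norm_fst_le p)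
  have h3 : ‖p.2 i‖ ≤ ‖p‖ := (norm_le_pi_norm p.2 i).trans (norm_snd_le p)
  refine (norm_add_le _ _).trans ?_
  rw [norm_mul, norm_mul, norm_pow, Complex.norm_real, Real.norm_eq_abs, sq_abs]
  nlinarith [sq_nonneg (y i), abs_nonneg (y i)]

/-- The quadratic decay exp(-2πδ ∑ y_i²) pays for the linear term exp(2πR ∑|y_i|), for the moment of
order k, and still leaves exp(-∑|y_i|), uniformly in y. -/
theorem pow_mul_norm_exp_thetaLin_le {δ R : ℝ} (hδ : 0 < δ) (k : ℕ) :
    ∃ K : ℝ, ∀ (y : ι → ℝ) (p : (ι → ℂ) × (ι → ℂ)), (∀ i, δ ≤ (p.1 i).im) → (∀ i, ‖p.2 i‖ ≤ R) →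
      ‖thetaLin y‖ ^ k * ‖Complex.exp (thetaLin y p)‖ ≤ K * Real.exp (-(1 * ∑ i, |y i|)) := by
  have hpi := Real.pi_pos
  -- The moment is bounded by k!/ε^k times exp(ε·2π(∑ y_i² + ∑|y_i|)). With ε ≤ δ/2 this uses at
  -- most half of the quadratic decay, with ε ≤ 1/(2π) at most exp(∑|y_i|).
  set ε : ℝ := min (δ / 2) (1 / (2 * Real.pi)) with hε
  have hε0 : 0 < ε := by positivity
  -- Per coordinate, the maximum of (2πR + 2)t - πδt², with 2πR for the linear term, 1 for the
  -- moment and 1 for the remaining decay.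
  set A : ℝ := Fintype.card ι * ((2 * Real.pi * R + 2) ^ 2 / (4 * Real.pi * δ)) with hA
  refine ⟨(k.factorial : ℝ) / ε ^ k * Real.exp A, fun y p h1 h2 => ?_⟩
  set q := ∑ i, y i ^ 2 with hq
  set s := ∑ i, |y i| with hs
  have hq0 : 0 ≤ q := Finset.sum_nonneg fun i _ => sq_nonneg _
  have hs0 : 0 ≤ s := Finset.sum_nonneg fun i _ => abs_nonneg _
  have hpow : ‖thetaLin y‖ ^ k ≤ (k.factorial : ℝ) / ε ^ k * Real.exp (ε * (2 * Real.pi * (q + s))) := by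
    have h3 : ‖thetaLin y‖ ^ k ≤ (2 * Real.pi * (q + s)) ^ k :=
      pow_le_pow_left₀ (norm_nonneg _) (norm_thetaLin_le y) k
    have h4 := Real.pow_div_factorial_le_exp (x := ε * (2 * Real.pi * (q + s))) (by positivity) k
    rw [mul_pow, div_le_iff₀ (by positivity)] at h4
    refine h3.trans ?_
    rw [div_mul_eq_mul_div, le_div_iff₀ (by positivity)]
    linarith
  have hexp : ‖Complex.exp (thetaLin y p)‖ ≤ Real.exp (-(2 * Real.pi * δ * q) + 2 * Real.pi * R * s) := by
    rw [exp_thetaLin, norm_expC, Real.exp_le_exp]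
    have h5 : δ * q - R * s ≤ (thetaExponent y p).im := by
      rw [thetaExponent, Complex.im_sum, hq, hs, Finset.mul_sum, Finset.mul_sum,
        ← Finset.sum_sub_distrib]
      refine Finset.sum_le_sum fun i _ => ?_
      have e1 : (p.1 i * (y i : ℂ) ^ 2 + p.2 i * y i).im = (p.1 i).im * y i ^ 2 + (p.2 i).im * y i := by
        rw [← Complex.ofReal_pow, Complex.add_im, Complex.im_mul_ofReal, Complex.im_mul_ofReal]
      rw [e1]
      have e2 : -(R * |y i|) ≤ (p.2 i).im * y i := by
        have : |(p.2 i).im * y i| ≤ R * |y i| := by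
          rw [abs_mul]
          exact mul_le_mul_of_nonneg_right ((Complex.abs_im_le_norm _).trans (h2 i)) (abs_nonneg _)
        exact (abs_le.mp this).1
      nlinarith [h1 i, sq_nonneg (y i)]
    nlinarith
  have hquad : (2 * Real.pi * R + 2) * s ≤ A + Real.pi * δ * q := by
    have e : A = ∑ _i : ι, (2 * Real.pi * R + 2) ^ 2 / (4 * Real.pi * δ) := by simp [hA]
    rw [e, hs, hq, Finset.mul_sum, Finset.mul_sum, ← Finset.sum_add_distrib]
    refine Finset.sum_le_sum fun i _ => ?_
    rw [← sq_abs (y i), ← sub_le_iff_le_add, le_div_iff₀ (by positivity)]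
    nlinarith [sq_nonneg ((2 * Real.pi * R + 2) - 2 * Real.pi * δ * |y i|)]
  have hfin : ε * (2 * Real.pi * (q + s)) + (-(2 * Real.pi * δ * q) + 2 * Real.pi * R * s) ≤
      A + -(1 * s) := by
    have e1 : ε * (2 * Real.pi) * q ≤ Real.pi * δ * q := by
      refine mul_le_mul_of_nonneg_right ?_ hq0
      have : ε ≤ δ / 2 := min_le_left _ _
      nlinarith
    have e2 : ε * (2 * Real.pi) * s ≤ 1 * s := by
      refine mul_le_mul_of_nonneg_right ?_ hs0
      have : ε ≤ 1 / (2 * Real.pi) := min_le_right _ _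
      rwa [le_div_iff₀ (by positivity)] at this
    nlinarith
  calc ‖thetaLin y‖ ^ k * ‖Complex.exp (thetaLin y p)‖
      ≤ ((k.factorial : ℝ) / ε ^ k * Real.exp (ε * (2 * Real.pi * (q + s)))) *
        Real.exp (-(2 * Real.pi * δ * q) + 2 * Real.pi * R * s) :=
        mul_le_mul hpow hexp (norm_nonneg _) (by positivity)
    _ = (k.factorial : ℝ) / ε ^ k * Real.exp (ε * (2 * Real.pi * (q + s)) +
        (-(2 * Real.pi * δ * q) + 2 * Real.pi * R * s)) := by rw [mul_assoc, ← Real.exp_add]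
    _ ≤ (k.factorial : ℝ) / ε ^ k * Real.exp (A + -(1 * s)) := by gcongr
    _ = _ := by rw [Real.exp_add, mul_assoc]

/-- Near p the quadratic parameters keep imaginary part at least some δ > 0 and the linear ones stay
bounded, so the uniform bound applies with a summable majorant. -/
theorem Sparse.locallyDominated {y : X → ι → ℝ} (hy : Sparse y) :
    LocallyDominated (fun x => thetaLin (y x)) (thetaDomain ι) := by
  intro p hp k
  obtain ⟨δ, hδp, hδ⟩ : ∃ δ : ℝ, (∀ i, 2 * δ < (p.1 i).im) ∧ 0 < δ := by
    have h1 : ∀ᶠ δ : ℝ in 𝓝[>] 0, ∀ i, 2 * δ < (p.1 i).im := by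
      rw [eventually_all]
      intro i
      refine (eventually_nhdsWithin_of_eventually_nhds ?_)
      have : ContinuousAt (fun δ : ℝ => 2 * δ) 0 := by fun_prop
      exact this.eventually_lt_const (by simpa using hp i)
    exact (h1.and self_mem_nhdsWithin).exists
  obtain ⟨K, hK⟩ := pow_mul_norm_exp_thetaLin_le (ι := ι) hδ (R := ‖p.2‖ + 1) k
  have him : ∀ q ∈ Metric.ball p (min δ 1), ∀ i, δ ≤ (q.1 i).im := by
    intro q hq i
    rw [Metric.mem_ball, dist_eq_norm] at hq
    have h1 : |(q.1 i - p.1 i).im| ≤ ‖q - p‖ := (Complex.abs_im_le_norm _).trans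
      ((norm_le_pi_norm (q.1 - p.1) i).trans (norm_fst_le (q - p)))
    rw [Complex.sub_im] at h1
    have h2 := (abs_le.mp h1).1
    have h3 := hq.trans_le (min_le_left _ _)
    linarith [hδp i]
  refine ⟨min δ 1, by positivity, fun q hq i => hδ.trans_le (him q hq i), _, (hy 1 one_pos).mul_left K,
    fun q hq x => hK (y x) q (him q hq) fun i => ?_⟩
  rw [Metric.mem_ball, dist_eq_norm] at hq
  have h1 : ‖q.2 i - p.2 i‖ ≤ ‖q - p‖ := (norm_le_pi_norm (q.2 - p.2) i).trans (norm_snd_le (q - p))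
  have h2 : ‖q.2 i‖ ≤ ‖p.2 i‖ + ‖q.2 i - p.2 i‖ := by
    simpa using norm_add_le (p.2 i) (q.2 i - p.2 i)
  have h3 := norm_le_pi_norm p.2 i
  have h4 := hq.trans_le (min_le_right _ _)
  linarith

theorem Sparse.contDiffOn {y : X → ι → ℝ} (hy : Sparse y) :
    ContDiffOn ℂ (⊤ : ℕ∞) (thetaSeries y) (thetaDomain ι) := by
  refine hy.locallyDominated.contDiffOn.congr fun p _ => ?_
  simp only [thetaSeries, exp_thetaLin]

theorem Sparse.summable {y : X → ι → ℝ} (hy : Sparse y) {p : (ι → ℂ) × (ι → ℂ)}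
    (hp : p ∈ thetaDomain ι) : Summable fun x => expC (thetaExponent (y x) p) := by
  obtain ⟨r, hr, -, u, hu, hb⟩ := hy.locallyDominated p hp 0
  refine Summable.of_norm_bounded hu fun x => ?_
  simpa [exp_thetaLin] using hb p (Metric.mem_ball_self hr) x

theorem isOpen_thetaDomain : IsOpen (thetaDomain ι) := by
  have : thetaDomain ι = ⋂ i, {p : (ι → ℂ) × (ι → ℂ) | 0 < (p.1 i).im} := by
    ext p; simp [thetaDomain]
  rw [this]
  refine isOpen_iInter_of_finite fun i => isOpen_lt continuous_const ?_
  fun_prop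

end ThetaSeries

/-! ### Gaussian integrals and inversion of theta series -/

section Inversion

variable {ι κ : Type} [Fintype ι] [Fintype κ]

/-- Change of variables along a linear equivalence, up to an unspecified positive constant. -/
theorem exists_integral_comp_linearEquiv (A : (κ → ℝ) ≃ₗ[ℝ] (ι → ℝ)) :
    ∃ C : ℝ, 0 < C ∧ (∀ g : (ι → ℝ) → ℂ, ∫ x, g (A x) = (C : ℂ) * ∫ y, g y) ∧
      ∀ g : (ι → ℝ) → ℂ, Integrable g → Integrable fun x => g (A x) := by
  -- The image of Lebesgue measure is a Haar measure, hence a positive multiple of Lebesgue measure.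
  -- Its value is never needed.
  have hA : Measure.IsAddHaarMeasure (Measure.map A (volume : Measure (κ → ℝ))) :=
    A.toContinuousLinearEquiv.isAddHaarMeasure_map volume
  obtain ⟨c, hc0, hc⟩ : ∃ c : NNReal, 0 < c ∧
      Measure.map A (volume : Measure (κ → ℝ)) = c • (volume : Measure (ι → ℝ)) :=
    ⟨_, Measure.addHaarScalarFactor_pos_of_isAddHaarMeasure _ _,
      Measure.isAddLeftInvariant_eq_smul _ _⟩
  have hcont : Continuous A := A.toLinearMap.continuous_of_finiteDimensional
  have hemb : MeasurableEmbedding A :=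
    A.toContinuousLinearEquiv.toHomeomorph.measurableEmbedding
  refine ⟨c, hc0, fun g => ?_, fun g hg => ?_⟩
  · rw [← hemb.integral_map, hc, integral_smul_nnreal_measure]
    rfl
  · have h : Integrable g (Measure.map A (volume : Measure (κ → ℝ))) := by
      rw [hc]; exact hg.smul_measure_nnreal
    exact (hemb.integrable_map_iff).mp h

theorem re_two_pi_I_div_pos {β : ℂ} (hβ : 0 < β.im) : 0 < (2 * Real.pi * Complex.I / β).re := by
  have hβ0 : β ≠ 0 := by rintro rfl; simp at hβ
  have h1 : 0 < Complex.normSq β := Complex.normSq_pos.mpr hβ0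
  rw [Complex.div_re]
  have := Real.pi_pos
  simp
  positivity

theorem neg_inv_im_pos {β : ℂ} (hβ : 0 < β.im) : 0 < (-β⁻¹).im := by
  have hβ0 : β ≠ 0 := by rintro rfl; simp at hβ
  have h1 : 0 < Complex.normSq β := Complex.normSq_pos.mpr hβ0
  rw [Complex.neg_im, Complex.inv_im, neg_div, neg_neg]
  positivity

/-- The Fourier transform of a complex Gaussian with shift. -/
theorem integral_gaussian_shift (b s l : ι → ℂ) (hb : ∀ i, 0 < (b i).im) :
    Integrable (fun y : ι → ℝ => expC (-∑ i, l i * y i) * expC (-∑ i, (y i - s i) ^ 2 / b i)) ∧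
    ∫ y : ι → ℝ, expC (-∑ i, l i * y i) * expC (-∑ i, (y i - s i) ^ 2 / b i) =
      (∏ i, (b i / (2 * Complex.I)) ^ (1 / 2 : ℂ)) * expC (∑ i, (b i * l i ^ 2 / 4 - s i * l i)) := by
  have hb0 : ∀ i, b i ≠ 0 := fun i h => by have := hb i; rw [h] at this; simp at this
  have hpi : (Real.pi : ℂ) ≠ 0 := by exact_mod_cast Real.pi_ne_zero
  have hre : ∀ i, 0 < (2 * Real.pi * Complex.I / b i).re := fun i => re_two_pi_I_div_pos (hb i)
  -- Expanding the squares leaves a Gaussian with quadratic coefficients 2πi/b_i, of positive real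
  -- part, and linear coefficients c_i.
  set c : ι → ℂ := fun i => 2 * Real.pi * Complex.I * (2 * s i / b i - l i) with hc
  have hpt : ∀ y : ι → ℝ, expC (-∑ i, l i * y i) * expC (-∑ i, (y i - s i) ^ 2 / b i) =
      expC (-∑ i, s i ^ 2 / b i) *
        Complex.exp (-∑ i, (2 * Real.pi * Complex.I / b i) * (y i : ℂ) ^ 2 + ∑ i, c i * y i) := by
    intro y
    simp only [expC, ← Complex.exp_add]
    congr 1
    simp only [hc, ← Finset.sum_neg_distrib, Finset.mul_sum, ← Finset.sum_add_distrib]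
    refine Finset.sum_congr rfl fun i _ => ?_
    have := hb0 i
    field_simp
    ring
  simp_rw [hpt]
  refine ⟨(GaussianFourier.integrable_cexp_neg_sum_mul_add hre c).const_mul _, ?_⟩
  rw [integral_const_mul, GaussianFourier.integral_cexp_neg_sum_mul_add hre c,
    Finset.prod_mul_distrib, mul_left_comm]
  have h1 : ∀ i, (Real.pi : ℂ) / (2 * Real.pi * Complex.I / b i) = b i / (2 * Complex.I) := by
    intro i
    have := hb0 i
    have := Complex.I_ne_zero
    field_simp
  simp only [h1]
  congr 1
  rw [← Complex.exp_sum, expC, expC, ← Complex.exp_add]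
  congr 1
  simp only [hc, ← Finset.sum_neg_distrib, Finset.mul_sum, ← Finset.sum_add_distrib]
  refine Finset.sum_congr rfl fun i _ => ?_
  have := hb0 i
  have := Complex.I_ne_zero
  field_simp
  ring

/-- The inversion formula for theta series of the lattice `A(ℤ^κ)` with dual family `l`. -/
theorem exists_theta_inversion (A : (κ → ℝ) ≃ₗ[ℝ] (ι → ℝ)) (l : (κ → ℤ) → ι → ℝ)
    (hl : ∀ m x, ∑ i, l m i * A x i = ∑ j, (m j : ℝ) * x j) :
    ∃ C : ℝ, 0 < C ∧ ∀ (b s : ι → ℂ), (∀ i, 0 < (b i).im) →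
      HasSum (fun m : κ → ℤ => (C : ℂ) * (∏ i, (b i / (2 * Complex.I)) ^ (1 / 2 : ℂ)) *
          expC (∑ i, (b i * (l m i : ℂ) ^ 2 / 4 - s i * l m i)))
        (∑' n : κ → ℤ, expC (-∑ i, ((A (intVec n) i : ℂ) - s i) ^ 2 / b i)) := by
  classical
  obtain ⟨C, hC, hCi, hCint⟩ := exists_integral_comp_linearEquiv A
  refine ⟨C, hC, fun b s hb => ?_⟩
  have hb0 : ∀ i, b i ≠ 0 := fun i h => by have := hb i; rw [h] at this; simp at this
  set f : (κ → ℝ) → ℂ := fun x => expC (-∑ i, ((A x i : ℂ) - s i) ^ 2 / b i) with hf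
  have hlm : ∀ (m : κ → ℤ) (x : κ → ℝ), (∑ j, (m j : ℂ) * x j) = ∑ i, (l m i : ℂ) * (A x i : ℂ) := by
    intro m x
    have := hl m x
    have h2 := congrArg (fun r : ℝ => (r : ℂ)) this
    push_cast at h2
    exact h2.symm
  have hF : ∀ m, intFourier f m = (C : ℂ) * (∏ i, (b i / (2 * Complex.I)) ^ (1 / 2 : ℂ)) *
          expC (∑ i, (b i * (l m i : ℂ) ^ 2 / 4 - s i * l m i)) := by
    intro m
    simp only [intFourier, hf, hlm]
    rw [hCi fun y => expC (-∑ i, (l m i : ℂ) * y i) * expC (-∑ i, ((y i : ℂ) - s i) ^ 2 / b i),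
      (integral_gaussian_shift b s (fun i => l m i) hb).2, mul_assoc]
  have hfi : Integrable f := by
    have := hCint _ (integral_gaussian_shift b s 0 hb).1
    simpa [expC_zero, hf] using this
  -- sparsity of the lattice and of its dual
  have hspl : Sparse l := by
    set K : ℝ := ∑ j, ∑ i, |A (Pi.single j 1) i|
    refine sparse_of_le (D := id) Function.injective_id (C := K) fun m j => ?_
    have h1 := hl m (Pi.single j 1)
    have h2 : ∑ j', (m j' : ℝ) * (Pi.single j 1 : κ → ℝ) j' = m j := by
      rw [Finset.sum_eq_single j (fun k _ hk => by simp [hk]) (by simp)]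
      simp
    rw [h2] at h1
    simp only [id]
    rw [← h1, Finset.mul_sum]
    refine (Finset.abs_sum_le_sum_abs _ _).trans (Finset.sum_le_sum fun i _ => ?_)
    rw [abs_mul, mul_comm]
    refine mul_le_mul_of_nonneg_right ?_ (abs_nonneg _)
    calc |A (Pi.single j 1) i| ≤ ∑ i, |A (Pi.single j 1) i| :=
          Finset.single_le_sum (f := fun i => |A (Pi.single j 1) i|) (fun _ _ => abs_nonneg _)
            (Finset.mem_univ i)
      _ ≤ K := Finset.single_le_sum (f := fun j => ∑ i, |A (Pi.single j 1) i|)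
            (fun _ _ => Finset.sum_nonneg fun _ _ => abs_nonneg _) (Finset.mem_univ j)
  have hspA : Sparse fun n : κ → ℤ => A (intVec n) := by
    set B := A.symm.toLinearMap.toContinuousLinearMap
    refine sparse_of_le (D := id) Function.injective_id (C := ‖B‖) fun n j => ?_
    have h1 : (intVec n : κ → ℝ) = B (A (intVec n)) := (A.symm_apply_apply _).symm
    have h2 : |(n j : ℝ)| ≤ ‖(intVec n : κ → ℝ)‖ := norm_le_pi_norm (intVec n : κ → ℝ) j
    refine h2.trans ?_
    calc ‖(intVec n : κ → ℝ)‖ ≤ ‖B‖ * ‖A (intVec n)‖ := by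
          conv_lhs => rw [h1]
          exact B.le_opNorm _
      _ ≤ ‖B‖ * ∑ i, |A (intVec n) i| := by
          refine mul_le_mul_of_nonneg_left ?_ (norm_nonneg _)
          refine (pi_norm_le_iff_of_nonneg (Finset.sum_nonneg fun _ _ => abs_nonneg _)).mpr fun i => ?_
          exact Finset.single_le_sum (f := fun i => |A (intVec n) i|) (fun _ _ => abs_nonneg _)
            (Finset.mem_univ i)
  have hs : Summable (intFourier f) := by
    have h1 := hspl.summable (p := (fun i => b i / 4, fun i => -s i)) (fun i => by
      have := hb i
      have e : b i / 4 = ((1 / 4 : ℝ) : ℂ) * b i := by push_cast; ring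
      simp only
      rw [e, Complex.im_ofReal_mul]
      positivity)
    rw [funext hF]
    refine (h1.mul_left ((C : ℂ) * ∏ i, (b i / (2 * Complex.I)) ^ (1 / 2 : ℂ))).congr fun m => ?_
    congr 2
    rw [thetaExponent]
    exact Finset.sum_congr rfl fun i _ => by ring
  have hcont : Continuous fun x => ∑' n : κ → ℤ, f (x + intVec n) := by
    have hexp := continuous_expC
    have hAc : Continuous A := A.toLinearMap.continuous_of_finiteDimensional
    -- Expanding the square around A x writes the periodization as an exponential times a theta
    -- series with parameters -1/b_i in the upper half-plane and linear part continuous in x.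
    -- Continuity thus follows from that of the theta series.
    have e : (fun x => ∑' n : κ → ℤ, f (x + intVec n)) = fun x : κ → ℝ =>
        expC (-∑ i, ((A x i : ℂ) - s i) ^ 2 / b i) *
        thetaSeries (fun n : κ → ℤ => A (intVec n))
          (fun i => -(b i)⁻¹, fun i => -2 * ((A x i : ℂ) - s i) / b i) := by
      funext x
      rw [thetaSeries, ← tsum_mul_left]
      refine tsum_congr fun n => ?_
      simp only [hf]
      rw [← EvenLattice.expC_add]
      congr 1
      rw [thetaExponent, ← Finset.sum_neg_distrib, ← Finset.sum_neg_distrib,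
        ← Finset.sum_add_distrib]
      refine Finset.sum_congr rfl fun i _ => ?_
      rw [map_add, Pi.add_apply]
      push_cast
      ring
    rw [e]
    have hth : Continuous fun x : κ → ℝ => thetaSeries (fun n : κ → ℤ => A (intVec n))
          (fun i => -(b i)⁻¹, fun i => -2 * ((A x i : ℂ) - s i) / b i) := by
      have h1 := hspA.contDiffOn.continuousOn
      refine h1.comp_continuous (by fun_prop) fun x i => neg_inv_im_pos (hb i)
    exact Continuous.mul (by fun_prop) hth
  have h := hasSum_intFourier hfi hcont hs
  rw [funext hF] at h
  exact h

end Inversion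

end Analysis

/-! ### The dual lattice as trace dual, and integral coordinates -/

variable {d : ℕ} [hd : IsNegDiscriminant d] {V : Type*} [AddCommGroup V]
  [Module (QuadField d) V] [Module ℚ V]

open scoped MatrixGroups

/-- The set ℚ + ℚ√-d is already a field: the norm a² + db² vanishes only at zero because d > 0. -/
theorem exists_rat_add_mul_sqrtNeg (x : QuadField d) :
    ∃ a b : ℚ, (x : ℂ) = a + b * sqrtNeg d := by
  obtain ⟨x, hx⟩ := x
  have hs := sqrtNeg_mul_self d
  simp only
  induction hx using Subfield.closure_induction with
  | mem x h =>
    rw [Set.mem_singleton_iff] at h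
    exact ⟨0, 1, by simp [h]⟩
  | one => exact ⟨1, 0, by simp⟩
  | add x y _ _ hx hy =>
    obtain ⟨a, b, rfl⟩ := hx
    obtain ⟨a', b', rfl⟩ := hy
    exact ⟨a + a', b + b', by push_cast; ring⟩
  | neg x _ hx =>
    obtain ⟨a, b, rfl⟩ := hx
    exact ⟨-a, -b, by push_cast; ring⟩
  | mul x y _ _ hx hy =>
    obtain ⟨a, b, rfl⟩ := hx
    obtain ⟨a', b', rfl⟩ := hy
    exact ⟨a * a' - b * b' * d, a * b' + b * a', by push_cast; linear_combination (b : ℂ) * b' * hs⟩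
  | inv x _ hx =>
    obtain ⟨a, b, rfl⟩ := hx
    by_cases h0 : (a : ℂ) + b * sqrtNeg d = 0
    · exact ⟨0, 0, by simp [h0]⟩
    have hd0 : (0 : ℚ) < d := by exact_mod_cast hd.pos
    have hn : a * a + d * (b * b) ≠ 0 := by
      intro h
      have ha : a = 0 := by nlinarith [mul_self_nonneg a, mul_self_nonneg b, mul_nonneg hd0.le (mul_self_nonneg b)]
      have hb : b = 0 := by
        subst ha
        simp at h
        rcases h with h | h
        · exact absurd h hd.pos.ne'
        · exact h
      exact h0 (by simp [ha, hb])
    have hn' : (a : ℂ) * a + d * (b * b) ≠ 0 := by exact_mod_cast hn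
    refine ⟨a / (a * a + d * (b * b)), -b / (a * a + d * (b * b)), ?_⟩
    push_cast
    refine inv_eq_of_mul_eq_one_left ?_
    have e : ((a : ℂ) / (a * a + d * (b * b)) + -b / (a * a + d * (b * b)) * sqrtNeg d) *
        (a + b * sqrtNeg d) = (a * a - b * b * (sqrtNeg d * sqrtNeg d)) / (a * a + d * (b * b)) := by
      ring
    rw [e, hs, div_eq_one_iff_eq hn']
    ring

namespace EvenLattice

variable (L : EvenLattice d V)

/-- The `ℂ`-bilinear extension of the trace form. -/
def bil : ℂ ⊗[ℚ] V →ₗ[ℂ] ℂ ⊗[ℚ] V →ₗ[ℂ] ℂ := L.formC + L.formC.flip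

theorem bil_apply (z w : ℂ ⊗[ℚ] V) : L.bil z w = L.formC z w + L.formC w z := rfl

theorem bil_tmul (x y : V) :
    L.bil (1 ⊗ₜ x) (1 ⊗ₜ y) = (L.form x y : ℂ) + L.form y x := by
  rw [bil_apply, formC_tmul, formC_tmul]; simp

/-- The inverse different is the trace dual of 𝒪: integrality of the traces against the two
ℤ-generators 1 and (d + √-d)/2 suffices. Hence M* is the dual of M for the trace form, and no other
frequencies enter the Fourier expansion. -/
theorem form_mem_invDifferent_of_trace {x m : V} (hm : m ∈ L.M)
    (h : ∀ y ∈ L.M, ∃ n : ℤ, (L.form y x : ℂ) + L.form x y = n) : L.form x m ∈ invDifferent d := by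
  have hs := sqrtNeg_mul_self d
  have hs0 := sqrtNeg_ne_zero d
  obtain ⟨a, b, hab⟩ := exists_rat_add_mul_sqrtNeg (L.form x m)
  obtain ⟨p, hp⟩ := h m hm
  have hw : ((d : QuadField d) + sqrtK d) / 2 ∈ quadOrder d :=
    ⟨0, 1, by push_cast; simp only [zero_add, one_mul]; rfl⟩
  obtain ⟨q, hq⟩ := h ((⟨_, hw⟩ : quadOrder d) • m) (L.M.smul_mem _ hm)
  have e : (⟨_, hw⟩ : quadOrder d) • m = (((d : QuadField d) + sqrtK d) / 2) • m := rfl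
  have ew : ((((d : QuadField d) + sqrtK d) / 2 : QuadField d) : ℂ) = (d + sqrtNeg d) / 2 := by
    push_cast; rfl
  rw [← L.form_conj x, hab] at hp
  rw [e, ← L.form_conj x, L.form_smul_right, hab, ew] at hq
  simp only [map_add, map_mul, map_div₀, conj_sqrtNeg, map_natCast, map_ofNat, map_ratCast,
    map_neg] at hp hq
  -- With w = (d + √-d)/2, the traces p of ⟨x, m⟩ and q of w̄⟨x, m⟩ determine ⟨x, m⟩ = (pw - q)/√-d.
  refine ⟨-(q : QuadField d) + p * (((d : QuadField d) + sqrtK d) / 2), ⟨-q, p, by push_cast; rfl⟩, ?_⟩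
  apply Subtype.ext
  push_cast
  change _ = (-(q : ℂ) + p * ((d + sqrtNeg d) / 2)) / sqrtNeg d
  rw [hab, eq_div_iff hs0, ← hp, ← hq]
  ring

end EvenLattice

/-- Integral coordinates: a `ℤ`-basis of `M` and the dual coordinates on `M*`. -/
structure LatticeFrame (L : EvenLattice d V) where
  N : ℕ
  b : Module.Basis (Fin N) ℚ V
  mem_M : ∀ m, m ∈ L.M ↔ ∃ n : Fin N → ℤ, m = ∑ j, n j • b j
  D : L.dual ≃+ (Fin N → ℤ)
  bil_b : ∀ (x : L.dual) j, L.bil (1 ⊗ₜ b j) (1 ⊗ₜ (x : V)) = D x j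

-- M is finitely generated over ℤ, as a submodule of M*, and torsion-free, so it is free, and a
-- ℤ-basis of M is a ℚ-basis of V. Pairing with it under the trace form is a bijection V → ℚ^N by
-- non-degeneracy, and M* is the preimage of ℤ^N.
open EvenLattice in
theorem exists_latticeFrame (L : EvenLattice d V) : Nonempty (LatticeFrame L) := by
  have hfin : Module.Finite ℤ L.M := by
    refine Module.Finite.of_injective
      (AddMonoidHom.toIntLinearMap ({ toFun := fun x => ⟨x, L.M_le_dual x.2⟩
                                      map_zero' := rfl
                                      map_add' := fun _ _ => rfl } : L.M →+ L.dual)) ?_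
    intro x y h
    exact Subtype.ext (congrArg (fun z : L.dual => (z : V)) h)
  have htf : Module.IsTorsionFree ℤ L.M := by
    have : Module.IsTorsionFree ℤ V := by
      have := Module.IsTorsionFree.trans_faithfulSMul ℤ ℚ V
      exact this
    exact Function.Injective.moduleIsTorsionFree (fun x : L.M => (x : V)) Subtype.val_injective
      (fun _ _ => rfl)
  have hfree : Module.Free ℤ L.M := inferInstance
  set bM := Module.finBasis ℤ L.M
  set N := Module.finrank ℤ L.M
  set e : Fin N → V := fun j => bM j with he
  have hmem : ∀ m, m ∈ L.M ↔ ∃ n : Fin N → ℤ, m = ∑ j, n j • e j := by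
    intro m
    constructor
    · intro hm
      refine ⟨fun j => bM.repr ⟨m, hm⟩ j, ?_⟩
      have h := bM.sum_repr ⟨m, hm⟩
      have h2 := congrArg (fun z : L.M => (z : V)) h
      simp only [AddSubmonoidClass.coe_finsetSum] at h2
      exact h2.symm
    · rintro ⟨n, rfl⟩
      exact sum_mem fun j _ => zsmul_mem (bM j).2 _
  have hli : LinearIndependent ℚ e := by
    rw [← LinearIndependent.iff_fractionRing ℤ ℚ]
    exact bM.linearIndependent.map' (AddMonoidHom.toIntLinearMap L.M.toAddSubgroup.subtype)
      (by
        rw [LinearMap.ker_eq_bot]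
        exact Subtype.val_injective)
  have hsp : ⊤ ≤ Submodule.span ℚ (Set.range e) := by
    rw [← L.span_eq_top, Submodule.span_le]
    intro m hm
    obtain ⟨n, rfl⟩ := (hmem m).mp hm
    refine sum_mem fun j _ => ?_
    exact zsmul_mem (Submodule.subset_span (Set.mem_range_self j)) (n j)
  set b := Module.Basis.mk hli hsp with hb
  have hbe : ∀ j, b j = e j := fun j => Module.Basis.mk_apply hli hsp j
  -- the rational trace pairing with the basis
  have hrat : ∀ x y : V, ∃ r : ℚ, L.bil (1 ⊗ₜ x) (1 ⊗ₜ y) = r := by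
    intro x y
    obtain ⟨a, c, h⟩ := exists_rat_add_mul_sqrtNeg (L.form x y)
    refine ⟨2 * a, ?_⟩
    rw [bil_tmul, ← L.form_conj x y, h]
    simp only [map_add, map_mul, conj_sqrtNeg, map_ratCast]
    push_cast; ring
  choose r hr using hrat
  set T : V →ₗ[ℚ] (Fin N → ℚ) :=
    { toFun := fun x j => r (e j) x
      map_add' := fun x y => by
        funext j
        have : ((r (e j) (x + y) : ℚ) : ℂ) = ((r (e j) x + r (e j) y : ℚ) : ℂ) := by
          push_cast
          rw [← hr, ← hr, ← hr, TensorProduct.tmul_add, map_add]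
        exact_mod_cast this
      map_smul' := fun c x => by
        funext j
        have : ((r (e j) (c • x) : ℚ) : ℂ) = ((c * r (e j) x : ℚ) : ℂ) := by
          push_cast
          rw [← hr, ← hr, TensorProduct.tmul_smul, ← algebraMap_smul ℂ c ((1 : ℂ) ⊗ₜ[ℚ] x), map_smul]
          simp
        exact_mod_cast this } with hT
  have hTapp : ∀ x j, L.bil (1 ⊗ₜ e j) (1 ⊗ₜ x) = (T x j : ℂ) := fun x j => hr _ _
  have hTinj : Function.Injective T := by
    rw [injective_iff_map_eq_zero]
    intro x hx
    have h1 : ∀ y : V, L.bil (1 ⊗ₜ y) (1 ⊗ₜ x) = 0 := by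
      intro y
      have hy : y ∈ Submodule.span ℚ (Set.range e) := hsp trivial
      induction hy using Submodule.span_induction with
      | mem y h =>
        obtain ⟨j, rfl⟩ := h
        rw [hTapp, hx]; simp
      | zero => simp
      | add y z _ _ hy hz => rw [TensorProduct.tmul_add, map_add, LinearMap.add_apply, hy, hz, add_zero]
      | smul c y _ hy =>
        rw [TensorProduct.tmul_smul, ← algebraMap_smul ℂ c ((1 : ℂ) ⊗ₜ[ℚ] y), map_smul,
          LinearMap.smul_apply, hy, smul_zero]
    apply L.nondegenerate
    intro y
    have h2 := h1 y
    -- Testing on √-d·y as well as on y separates ⟨x, y⟩ from its conjugate, so a vanishing trace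
    -- pairing forces a vanishing Hermitian pairing.
    have h3 := h1 (sqrtK d • y)
    rw [bil_tmul] at h2 h3
    rw [L.form_smul_left, L.form_smul_right] at h3
    have hsK : ((sqrtK d : QuadField d) : ℂ) = sqrtNeg d := rfl
    push_cast at h3
    rw [hsK, conj_sqrtNeg] at h3
    have h4 : (L.form x y : ℂ) * (2 * sqrtNeg d) = 0 := by
      linear_combination sqrtNeg d * h2 - h3
    have h5 := (mul_eq_zero.mp h4).resolve_right (mul_ne_zero two_ne_zero (sqrtNeg_ne_zero d))
    exact Subtype.ext (by push_cast; exact h5)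
  have : Module.Finite ℚ V := Module.Finite.of_basis b
  have hTsurj : Function.Surjective T :=
    (LinearMap.injective_iff_surjective_of_finrank_eq_finrank
      (by rw [Module.finrank_eq_card_basis b]; simp)).mp hTinj
  have hdual : ∀ x : V, x ∈ L.dual ↔ ∃ n : Fin N → ℤ, ∀ j, T x j = n j := by
    intro x
    constructor
    · intro hx
      have : ∀ j, ∃ n : ℤ, T x j = n := by
        intro j
        obtain ⟨n, hn⟩ := trace_invDifferent (hx (e j) (bM j).2)
        refine ⟨n, ?_⟩
        have h2 := hTapp x j
        rw [bil_tmul, add_comm, ← L.form_conj x (e j), hn] at h2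
        exact_mod_cast h2.symm
      choose n hn using this
      exact ⟨n, hn⟩
    · rintro ⟨n, hn⟩ m hm
      refine L.form_mem_invDifferent_of_trace hm fun y hy => ?_
      obtain ⟨k, rfl⟩ := (hmem y).mp hy
      refine ⟨∑ j, k j * n j, ?_⟩
      rw [← bil_tmul, TensorProduct.tmul_sum, map_sum, LinearMap.sum_apply]
      push_cast
      refine Finset.sum_congr rfl fun j _ => ?_
      have h2 := hTapp x j
      rw [hn] at h2
      rw [TensorProduct.tmul_smul, map_zsmul, LinearMap.smul_apply, h2, zsmul_eq_mul]
      push_cast; rfl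
  have hchoose : ∀ x : L.dual, ∃ n : Fin N → ℤ, ∀ j, T x j = n j := fun x => (hdual x).mp x.2
  choose D hD using hchoose
  have hDadd : ∀ x y, D (x + y) = D x + D y := by
    intro x y
    funext j
    have : ((D (x + y) j : ℤ) : ℚ) = ((D x j + D y j : ℤ) : ℚ) := by
      push_cast
      rw [← hD, ← hD, ← hD]
      have : ((x + y : L.dual) : V) = x + y := rfl
      rw [this, map_add]; rfl
    exact_mod_cast this
  have hbij : Function.Bijective D := by
    constructor
    · intro x y hxy
      apply Subtype.ext
      apply hTinj
      funext j
      rw [hD, hD, hxy]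
    · intro n
      obtain ⟨x, hx⟩ := hTsurj fun j => n j
      have hx' : x ∈ L.dual := (hdual x).mpr ⟨n, fun j => congrFun hx j⟩
      refine ⟨⟨x, hx'⟩, ?_⟩
      funext j
      have h1 := hD ⟨x, hx'⟩ j
      have h2 := congrFun hx j
      rw [h2] at h1
      exact_mod_cast h1.symm
  refine ⟨⟨N, b, fun m => ?_, AddEquiv.mk' (Equiv.ofBijective D hbij) hDadd, fun x j => ?_⟩⟩
  · rw [hmem]; simp only [hbe]
  · rw [hbe, hTapp, hD, Rat.cast_intCast]
    rfl

/-! ### Real quadratic forms: orthogonal bases and Sylvester's law -/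

section RealForms

variable {E : Type*} [AddCommGroup E] [Module ℝ E] [FiniteDimensional ℝ E]

/-- An orthogonal basis, normalized to `B b b = 2ε`, for a symmetric form with `ε B` positive
definite. -/
theorem exists_orthonormal_basis (B : E →ₗ[ℝ] E →ₗ[ℝ] ℝ) (hB : ∀ x y, B x y = B y x) {ε : ℝ}
    (hε : ε * ε = 1) (hdef : ∀ x, x ≠ 0 → 0 < ε * B x x) :
    ∃ b : Module.Basis (Fin (Module.finrank ℝ E)) ℝ E,
      ∀ i j, B (b i) (b j) = if i = j then 2 * ε else 0 := by
  have hsymm : LinearMap.IsSymm (B : LinearMap.BilinForm ℝ E) := ⟨fun x y => by simpa using hB x y⟩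
  obtain ⟨u, hu⟩ := LinearMap.BilinForm.exists_orthogonal_basis hsymm
  have hpos : ∀ i, 0 < ε * B (u i) (u i) := fun i => hdef _ (u.ne_zero i)
  -- Scaling to εB(b, b) = 2 rather than 1 fits the trace form, for which (λ, λ) = 2|λ|². Then
  -- |λ_{v₊}|² becomes a plain sum of squares.
  set w : Fin (Module.finrank ℝ E) → ℝ := fun i => Real.sqrt (2 / (ε * B (u i) (u i))) with hw
  have hw0 : ∀ i, IsUnit (w i) := fun i =>
    (Real.sqrt_pos.mpr (div_pos two_pos (hpos i))).ne'.isUnit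
  refine ⟨u.isUnitSMul hw0, fun i j => ?_⟩
  rw [Module.Basis.isUnitSMul_apply, Module.Basis.isUnitSMul_apply, LinearMap.map_smul₂,
    map_smul, smul_eq_mul, smul_eq_mul]
  split_ifs with h
  · subst h
    have h1 : w i * w i = 2 / (ε * B (u i) (u i)) :=
      Real.mul_self_sqrt (div_pos two_pos (hpos i)).le
    have h2 : ε * B (u i) (u i) ≠ 0 := (hpos i).ne'
    have h3 : B (u i) (u i) = ε * (ε * B (u i) (u i)) := by rw [← mul_assoc, hε, one_mul]
    rw [← mul_assoc, h1, h3, ← mul_assoc ε ε, hε, one_mul]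
    rw [div_mul_eq_mul_div, div_eq_iff h2]
    ring
  · have : B (u i) (u j) = 0 := hu h
    rw [this, mul_zero, mul_zero]

theorem apply_sum_self_of_orthogonal {κ : Type*} [Fintype κ] (B : E →ₗ[ℝ] E →ₗ[ℝ] ℝ) (c : κ → E)
    (hc : ∀ i j, i ≠ j → B (c i) (c j) = 0) (a : κ → ℝ) :
    B (∑ i, a i • c i) (∑ i, a i • c i) = ∑ i, a i ^ 2 * B (c i) (c i) := by
  rw [LinearMap.map_sum₂]
  refine Finset.sum_congr rfl fun i _ => ?_
  rw [map_sum, Finset.sum_eq_single i]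
  · simp only [map_smul, LinearMap.smul_apply, smul_eq_mul]; ring
  · intro j _ hij
    simp [hc i j hij.symm]
  · simp

/-- Sylvester's law of inertia. -/
theorem finrank_eq_of_isCompl_definite {κ₁ κ₂ : Type*} [Fintype κ₁] [Fintype κ₂]
    (B : E →ₗ[ℝ] E →ₗ[ℝ] ℝ) (c : Module.Basis (κ₁ ⊕ κ₂) ℝ E)
    (hc : ∀ i j, i ≠ j → B (c i) (c j) = 0) (h₁ : ∀ i, 0 < B (c (Sum.inl i)) (c (Sum.inl i)))
    (h₂ : ∀ i, B (c (Sum.inr i)) (c (Sum.inr i)) < 0) {p n : Submodule ℝ E} (hpn : IsCompl p n)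
    (hp : ∀ x ∈ p, x ≠ 0 → 0 < B x x) (hn : ∀ x ∈ n, x ≠ 0 → B x x < 0) :
    Module.finrank ℝ p = Fintype.card κ₁ ∧ Module.finrank ℝ n = Fintype.card κ₂ := by
  have hdim := Submodule.finrank_add_eq_of_isCompl hpn
  have hE : Module.finrank ℝ E = Fintype.card κ₁ + Fintype.card κ₂ := by
    rw [Module.finrank_eq_card_basis c, Fintype.card_sum]
  set P := Submodule.span ℝ (Set.range fun i => c (Sum.inl i))
  set N := Submodule.span ℝ (Set.range fun i => c (Sum.inr i))
  have hP : Module.finrank ℝ P = Fintype.card κ₁ :=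
    finrank_span_eq_card (c.linearIndependent.comp _ Sum.inl_injective)
  have hN : Module.finrank ℝ N = Fintype.card κ₂ :=
    finrank_span_eq_card (c.linearIndependent.comp _ Sum.inr_injective)
  have hPpos : ∀ x ∈ P, 0 ≤ B x x := by
    intro x hx
    obtain ⟨a, rfl⟩ := (Submodule.mem_span_range_iff_exists_fun ℝ).mp hx
    rw [apply_sum_self_of_orthogonal B _ (fun i j hij => hc _ _ (Sum.inl_injective.ne hij))]
    exact Finset.sum_nonneg fun i _ => mul_nonneg (sq_nonneg _) (h₁ i).le
  have hNneg : ∀ x ∈ N, B x x ≤ 0 := by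
    intro x hx
    obtain ⟨a, rfl⟩ := (Submodule.mem_span_range_iff_exists_fun ℝ).mp hx
    rw [apply_sum_self_of_orthogonal B _ (fun i j hij => hc _ _ (Sum.inr_injective.ne hij))]
    exact Finset.sum_nonpos fun i _ => mul_nonpos_of_nonneg_of_nonpos (sq_nonneg _) (h₂ i).le
  -- p meets the span of the negative basis vectors only in 0, and n meets that of the positive ones
  -- only in 0. Since the dimensions on both sides add up to that of E, the two resulting
  -- inequalities are equalities.
  have d1 : Disjoint p N := by
    rw [Submodule.disjoint_def]
    intro x hx hx'
    by_contra h0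
    exact absurd (hp x hx h0) (not_lt.mpr (hNneg x hx'))
  have d2 : Disjoint n P := by
    rw [Submodule.disjoint_def]
    intro x hx hx'
    by_contra h0
    exact absurd (hn x hx h0) (not_lt.mpr (hPpos x hx'))
  have e1 := Submodule.finrank_add_finrank_le_of_disjoint d1
  have e2 := Submodule.finrank_add_finrank_le_of_disjoint d2
  omega

end RealForms

/-- The index set of an orthogonal frame of `V_ℝ`. -/
abbrev FrameIndex (L : EvenLattice d V) : Type := Fin (2 * L.bPos) ⊕ Fin (2 * L.bNeg)

/-- The sign of a frame vector. -/
def frameSign (L : EvenLattice d V) : FrameIndex L → ℝ := Sum.elim (fun _ => 1) (fun _ => -1)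

/-- Orthogonal coordinates on `V ⊗ ℂ` adapted to the decomposition `v`. -/
structure ThetaFrame (L : EvenLattice d V) (v : GrJ L) where
  κ : (ℂ ⊗[ℚ] V) ≃ₗ[ℂ] (FrameIndex L → ℂ)
  y : V → FrameIndex L → ℝ
  κ_tmul : ∀ x i, κ (1 ⊗ₜ x) i = y x i
  bil_eq : ∀ z w, L.bil z w = 2 * ∑ i, (frameSign L i : ℂ) * (κ z i * κ w i)
  projPos_inl : ∀ z i, κ (v.projPos z) (Sum.inl i) = κ z (Sum.inl i)
  projPos_inr : ∀ z i, κ (v.projPos z) (Sum.inr i) = 0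
  projNeg_inl : ∀ z i, κ (v.projNeg z) (Sum.inl i) = 0
  projNeg_inr : ∀ z i, κ (v.projNeg z) (Sum.inr i) = κ z (Sum.inr i)

/-! ### Orthogonal frames of V_ℝ adapted to the decomposition v -/

namespace EvenLattice

variable (L : EvenLattice d V)

theorem traceFormR_comm (x y : ℝ ⊗[ℚ] V) : L.traceFormR x y = L.traceFormR y x := by
  induction x using TensorProduct.induction_on with
  | zero => simp
  | add x x' hx hx' => rw [map_add, map_add, LinearMap.add_apply, hx, hx']
  | tmul r x =>
    induction y using TensorProduct.induction_on with
    | zero => simp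
    | add y y' hy hy' => rw [map_add, map_add, LinearMap.add_apply, hy, hy']
    | tmul s y =>
      rw [traceFormR_tmul, traceFormR_tmul, ← L.form_conj y x, Complex.conj_re]
      ring

/-- On real vectors ⟨x, y⟩ + ⟨y, x⟩ is twice a real part, so the symmetrized complex form extends
the real trace form. -/
theorem bil_cancelBaseChange (x y : ℝ ⊗[ℚ] V) :
    L.bil (TensorProduct.AlgebraTensorModule.cancelBaseChange ℚ ℝ ℂ ℂ V (1 ⊗ₜ x))
      (TensorProduct.AlgebraTensorModule.cancelBaseChange ℚ ℝ ℂ ℂ V (1 ⊗ₜ y)) =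
      (L.traceFormR x y : ℂ) := by
  induction x using TensorProduct.induction_on with
  | zero => simp
  | add x x' hx hx' =>
    rw [TensorProduct.tmul_add, map_add, map_add, map_add, LinearMap.add_apply, LinearMap.add_apply,
      hx, hx', Complex.ofReal_add]
  | tmul r x =>
    induction y using TensorProduct.induction_on with
    | zero => simp
    | add y y' hy hy' =>
      rw [TensorProduct.tmul_add, map_add, map_add, map_add, hy, hy', Complex.ofReal_add]
    | tmul s y =>
      rw [traceFormR_tmul, TensorProduct.AlgebraTensorModule.cancelBaseChange_tmul,
        TensorProduct.AlgebraTensorModule.cancelBaseChange_tmul, bil_apply, formC_tmul, formC_tmul,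
        ← L.form_conj x y]
      have h := Complex.add_conj (L.form x y : ℂ)
      simp only [Complex.real_smul, mul_one]
      push_cast
      push_cast at h
      linear_combination ((r : ℂ) * s) * h

/-- An orthogonal basis of `V_ℝ` exhibiting the signature. -/
theorem exists_signature_basis :
    ∃ c : Module.Basis ((Fin L.bPos × Fin 2) ⊕ (Fin L.bNeg × Fin 2)) ℝ (ℝ ⊗[ℚ] V),
      (∀ i j, i ≠ j → L.traceFormR (c i) (c j) = 0) ∧
      (∀ i, 0 < L.traceFormR (c (Sum.inl i)) (c (Sum.inl i))) ∧
      (∀ i, L.traceFormR (c (Sum.inr i)) (c (Sum.inr i)) < 0) := by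
  obtain ⟨b, hb, hpos, hneg⟩ := L.signature
  have hd0 : (0 : ℝ) < d := by exact_mod_cast hd.pos
  have hsK : ((sqrtK d : QuadField d) : ℂ) = sqrtNeg d := rfl
  -- Each vector b_i of the orthogonal 𝕂-basis contributes b_i and √-d·b_i. They are orthogonal for
  -- the trace form because ⟨b_i, √-d·b_i⟩ is purely imaginary, and both have the sign of |b_i|².
  -- This doubles the signature.
  set sc : Fin 2 → QuadField d := ![1, sqrtK d] with hsc
  set g : Fin L.bPos ⊕ Fin L.bNeg → Fin 2 → ℝ ⊗[ℚ] V := fun i k => 1 ⊗ₜ (sc k • b i) with hg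
  have him : ∀ x : V, (L.form x x : ℂ).im = 0 := fun x => by
    have := congrArg Complex.im (L.form_conj x x)
    rw [Complex.conj_im] at this
    linarith
  have hgg : ∀ i j k k', (i, k) ≠ (j, k') → L.traceFormR (g i k) (g j k') = 0 := by
    intro i j k k' hne
    simp only [hg]
    rw [traceFormR_tmul, L.form_smul_left]
    by_cases hij : i = j
    · subst hij
      have hk : k ≠ k' := fun h => hne (by rw [h])
      have h2 : ((sc k * L.form (b i) (sc k' • b i) : QuadField d) : ℂ).re = 0 := by
        push_cast
        rw [L.form_smul_right]
        have e : (L.form (b i) (b i) : ℂ) = ((L.form (b i) (b i) : ℂ).re : ℂ) :=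
          Complex.ext (by simp) (by simp [him])
        rw [e]
        fin_cases k <;> fin_cases k' <;>
          first
          | exact absurd rfl hk
          | simp [hsc, hsK, sqrtNeg]
      rw [h2]; ring
    · have h2 : L.form (b i) (sc k' • b j) = 0 := by
        apply Subtype.ext
        rw [L.form_smul_right, hb i j hij]; simp
      rw [h2]; simp
  have hnorm : ∀ i k, ∃ t : ℝ, 0 < t ∧ L.traceFormR (g i k) (g i k) = t * (L.form (b i) (b i) : ℂ).re := by
    intro i k
    have e : (L.form (b i) (b i) : ℂ) = ((L.form (b i) (b i) : ℂ).re : ℂ) :=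
      Complex.ext (by simp) (by simp [him])
    have h2 : ∀ c : QuadField d, ((c * L.form (b i) (c • b i) : QuadField d) : ℂ) =
        (Complex.normSq c : ℂ) * (L.form (b i) (b i) : ℂ) := by
      intro c
      push_cast
      rw [L.form_smul_right, ← mul_assoc, Complex.mul_conj]
    refine ⟨2 * Complex.normSq (sc k), ?_, ?_⟩
    · refine mul_pos two_pos (Complex.normSq_pos.mpr ?_)
      fin_cases k
      · simp [hsc]
      · exact sqrtNeg_ne_zero d
    · simp only [hg]
      rw [traceFormR_tmul, L.form_smul_left, h2, Complex.re_ofReal_mul]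
      ring
  set f : (Fin L.bPos × Fin 2) ⊕ (Fin L.bNeg × Fin 2) → ℝ ⊗[ℚ] V :=
    Sum.elim (fun p => g (Sum.inl p.1) p.2) (fun p => g (Sum.inr p.1) p.2) with hf
  have hforth : ∀ i j, i ≠ j → L.traceFormR (f i) (f j) = 0 := by
    rintro (⟨i, k⟩ | ⟨i, k⟩) (⟨j, k'⟩ | ⟨j, k'⟩) hij <;> refine hgg _ _ _ _ fun h => hij ?_ <;>
      simp_all
  have hfpos : ∀ i, 0 < L.traceFormR (f (Sum.inl i)) (f (Sum.inl i)) := by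
    rintro ⟨i, k⟩
    obtain ⟨t, ht, h⟩ := hnorm (Sum.inl i) k
    have : L.traceFormR (f (Sum.inl (i, k))) (f (Sum.inl (i, k))) = _ := h
    rw [this]
    exact mul_pos ht (hpos i)
  have hfneg : ∀ i, L.traceFormR (f (Sum.inr i)) (f (Sum.inr i)) < 0 := by
    rintro ⟨i, k⟩
    obtain ⟨t, ht, h⟩ := hnorm (Sum.inr i) k
    have : L.traceFormR (f (Sum.inr (i, k))) (f (Sum.inr (i, k))) = _ := h
    rw [this]
    exact mul_neg_of_pos_of_neg ht (hneg i)
  have hfne : ∀ i, L.traceFormR (f i) (f i) ≠ 0 := by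
    rintro (i | i)
    · exact (hfpos i).ne'
    · exact (hfneg i).ne
  have hli : LinearIndependent ℝ f := by
    rw [Fintype.linearIndependent_iff]
    intro a ha i
    have h1 : L.traceFormR (∑ j, a j • f j) (f i) = 0 := by rw [ha]; simp
    rw [map_sum, LinearMap.sum_apply, Finset.sum_eq_single i] at h1
    · rw [map_smul, LinearMap.smul_apply, smul_eq_mul] at h1
      exact (mul_eq_zero.mp h1).resolve_right (hfne i)
    · intro j _ hji
      rw [map_smul, LinearMap.smul_apply, hforth j i hji, smul_zero]
    · simp
  have hsp : ⊤ ≤ Submodule.span ℝ (Set.range f) := by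
    have hmem : ∀ i k, g i k ∈ Submodule.span ℝ (Set.range f) := by
      rintro (i | i) k
      · exact Submodule.subset_span ⟨Sum.inl (i, k), rfl⟩
      · exact Submodule.subset_span ⟨Sum.inr (i, k), rfl⟩
    intro x _
    induction x using TensorProduct.induction_on with
    | zero => exact Submodule.zero_mem _
    | add x y hx hy => exact Submodule.add_mem _ (hx trivial) (hy trivial)
    | tmul r x =>
      rw [← mul_one r, ← smul_eq_mul, ← TensorProduct.smul_tmul']
      refine Submodule.smul_mem _ _ ?_
      rw [← b.sum_repr x, TensorProduct.tmul_sum]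
      refine Submodule.sum_mem _ fun i _ => ?_
      obtain ⟨α, β, h⟩ := exists_rat_add_mul_sqrtNeg (b.repr x i)
      have e : b.repr x i = (α : QuadField d) + (β : QuadField d) * sqrtK d := by
        apply Subtype.ext
        rw [h]
        push_cast
        rw [hsK]
      have e2 : (1 : ℝ) ⊗ₜ[ℚ] (b.repr x i • b i) = (α : ℝ) • g i 0 + (β : ℝ) • g i 1 := by
        simp only [hg, hsc]
        rw [e, add_smul, mul_smul, Rat.cast_smul_eq_qsmul, Rat.cast_smul_eq_qsmul,
          TensorProduct.tmul_add, TensorProduct.tmul_smul, TensorProduct.tmul_smul,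
          Rat.cast_smul_eq_qsmul, Rat.cast_smul_eq_qsmul]
        simp
      rw [e2]
      exact Submodule.add_mem _ (Submodule.smul_mem _ _ (hmem _ _)) (Submodule.smul_mem _ _ (hmem _ _))
  refine ⟨Module.Basis.mk hli hsp, ?_, ?_, ?_⟩ <;> simpa only [Module.Basis.mk_apply]

end EvenLattice

-- Normalized orthogonal bases of v₊ and v₋ together form a basis of V_ℝ whose complexification
-- diagonalizes the trace form and both projections. Sylvester's law gives the dimensions 2b₊ and
-- 2b₋, whatever v is.
open EvenLattice in
theorem exists_thetaFrame (L : EvenLattice d V) (v : GrJ L) : Nonempty (ThetaFrame L v) := by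
  obtain ⟨c, hc, hc1, hc2⟩ := L.exists_signature_basis
  have : FiniteDimensional ℝ (ℝ ⊗[ℚ] V) := Module.Finite.of_basis c
  obtain ⟨hp, hn⟩ := finrank_eq_of_isCompl_definite L.traceFormR c hc hc1 hc2 v.isCompl v.pos_def
    v.neg_def
  obtain ⟨bp, hbp⟩ : ∃ b : Module.Basis (Fin (Module.finrank ℝ v.pos)) ℝ v.pos,
      ∀ i j, L.traceFormR (b i) (b j) = if i = j then 2 * 1 else 0 := exists_orthonormal_basis (L.traceFormR.domRestrict₁₂ v.pos v.pos)
    (fun x y => L.traceFormR_comm _ _) (ε := 1) (by norm_num)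
    (fun x hx => by
      rw [one_mul]
      exact v.pos_def x x.2 (fun h => hx (Subtype.ext h)))
  obtain ⟨bn, hbn⟩ : ∃ b : Module.Basis (Fin (Module.finrank ℝ v.neg)) ℝ v.neg,
      ∀ i j, L.traceFormR (b i) (b j) = if i = j then 2 * -1 else 0 := exists_orthonormal_basis (L.traceFormR.domRestrict₁₂ v.neg v.neg)
    (fun x y => L.traceFormR_comm _ _) (ε := -1) (by norm_num)
    (fun x hx => by
      have := v.neg_def x x.2 (fun h => hx (Subtype.ext h))
      change 0 < -1 * L.traceFormR x x
      linarith)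
  have hp' : Module.finrank ℝ v.pos = 2 * L.bPos := by rw [hp]; simp [mul_comm]
  have hn' : Module.finrank ℝ v.neg = 2 * L.bNeg := by rw [hn]; simp [mul_comm]
  set bp' := bp.reindex (finCongr hp')
  set bn' := bn.reindex (finCongr hn')
  have hbp' : ∀ i j, L.traceFormR (bp' i) (bp' j) = if i = j then 2 else 0 := by
    intro i j
    have := hbp ((finCongr hp').symm i) ((finCongr hp').symm j)
    simp only [bp', Module.Basis.reindex_apply]
    simpa using this
  have hbn' : ∀ i j, L.traceFormR (bn' i) (bn' j) = if i = j then -2 else 0 := by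
    intro i j
    have := hbn ((finCongr hn').symm i) ((finCongr hn').symm j)
    simp only [bn', Module.Basis.reindex_apply]
    simpa using this
  set u : Module.Basis (FrameIndex L) ℝ (ℝ ⊗[ℚ] V) :=
    (bp'.prod bn').map (Submodule.prodEquivOfIsCompl v.pos v.neg v.isCompl) with hu
  have hul : ∀ i, u (Sum.inl i) = bp' i := by intro i; simp [hu]
  have hur : ∀ i, u (Sum.inr i) = bn' i := by intro i; simp [hu]
  have huu : ∀ i j, L.traceFormR (u i) (u j) = if i = j then 2 * frameSign L i else 0 := by
    rintro (i | i) (j | j)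
    · rw [hul, hul, hbp']; simp [frameSign]
    · rw [hul, hur, v.orthogonal _ (bp' i).2 _ (bn' j).2]; simp
    · rw [hul, hur, traceFormR_comm, v.orthogonal _ (bp' j).2 _ (bn' i).2]; simp
    · rw [hur, hur, hbn']; simp [frameSign]
  set cb := TensorProduct.AlgebraTensorModule.cancelBaseChange ℚ ℝ ℂ ℂ V
  set uC : Module.Basis (FrameIndex L) ℂ (ℂ ⊗[ℚ] V) := (u.baseChange ℂ).map cb with huC
  have huCa : ∀ i, uC i = cb (1 ⊗ₜ u i) := by intro i; simp [huC]
  have hext : ∀ (f : ℝ ⊗[ℚ] V →ₗ[ℝ] ℝ ⊗[ℚ] V) (x : ℝ ⊗[ℚ] V),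
      extendC f (cb (1 ⊗ₜ x)) = cb (1 ⊗ₜ f x) := by
    intro f x
    simp only [extendC, LinearMap.comp_apply, LinearEquiv.coe_coe]
    rw [LinearEquiv.symm_apply_apply, LinearMap.baseChange_tmul]
  have hcoord : ∀ (f : ℂ ⊗[ℚ] V →ₗ[ℂ] ℂ ⊗[ℚ] V) (S : FrameIndex L → ℂ),
      (∀ i, f (uC i) = S i • uC i) → ∀ z i, uC.equivFun (f z) i = S i * uC.equivFun z i := by
    intro f S hS z i
    conv_lhs => rw [← uC.sum_equivFun z, map_sum]
    simp only [map_smul, hS, map_sum, Finset.sum_apply, Pi.smul_apply, smul_eq_mul]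
    rw [Finset.sum_eq_single i]
    · simp [mul_comm]
    · intro j _ hj; simp [hj]
    · simp
  have hP : ∀ z i, uC.equivFun (v.projPos z) i =
      (Sum.elim (fun _ => 1) (fun _ => 0) : FrameIndex L → ℂ) i * uC.equivFun z i := by
    refine hcoord _ _ ?_
    rintro (i | i)
    · rw [huCa, GrJ.projPos, hext, hul, Submodule.projection_apply_of_mem_left v.isCompl (bp' i).2]
      simp
    · rw [huCa, GrJ.projPos, hext, hur, Submodule.projection_apply_of_mem_right v.isCompl (bn' i).2]
      simp
  have hN : ∀ z i, uC.equivFun (v.projNeg z) i =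
      (Sum.elim (fun _ => 0) (fun _ => 1) : FrameIndex L → ℂ) i * uC.equivFun z i := by
    refine hcoord _ _ ?_
    rintro (i | i)
    · rw [huCa, GrJ.projNeg, hext, hul,
        Submodule.projection_apply_of_mem_right v.isCompl.symm (bp' i).2]
      simp
    · rw [huCa, GrJ.projNeg, hext, hur,
        Submodule.projection_apply_of_mem_left v.isCompl.symm (bn' i).2]
      simp
  refine ⟨⟨uC.equivFun, fun x i => u.repr (1 ⊗ₜ x) i, fun x i => ?_, fun z w => ?_, fun z i => ?_,
    fun z i => ?_, fun z i => ?_, fun z i => ?_⟩⟩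
  · have e : (1 : ℂ) ⊗ₜ[ℚ] x = cb (1 ⊗ₜ (1 ⊗ₜ x)) := by
      rw [TensorProduct.AlgebraTensorModule.cancelBaseChange_tmul]; simp
    rw [e, huC, Module.Basis.equivFun_apply, Module.Basis.map_repr]
    simp [Module.Basis.baseChange_repr_tmul]
  · conv_lhs => rw [← uC.sum_equivFun z, ← uC.sum_equivFun w]
    rw [LinearMap.map_sum₂, Finset.mul_sum]
    refine Finset.sum_congr rfl fun i _ => ?_
    rw [map_sum, Finset.sum_eq_single i]
    · simp only [map_smul, LinearMap.smul_apply, smul_eq_mul]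
      rw [huCa, bil_cancelBaseChange, huu, if_pos rfl]
      push_cast; ring
    · intro j _ hj
      simp only [map_smul, LinearMap.smul_apply, smul_eq_mul]
      rw [huCa, huCa, bil_cancelBaseChange, huu, if_neg hj.symm]
      simp
    · simp
  · rw [hP]; simp
  · rw [hP]; simp
  · rw [hN]; simp
  · rw [hN]; simp

/-! ### The action of 𝕂 on V ⊗ ℂ and the splitting into V_ℂ and V_ℂ̄ -/

section Linear

variable (d) in
/-- The action of `c ∈ 𝕂` on `ℂ ⊗ V`, extending `opJC`. -/
def actK (V : Type*) [AddCommGroup V] [Module (QuadField d) V] [Module ℚ V] (c : QuadField d) :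
    ℂ ⊗[ℚ] V →ₗ[ℂ] ℂ ⊗[ℚ] V :=
  LinearMap.baseChange ℂ
    { toFun := fun x : V => c • x
      map_add' := smul_add c
      map_smul' := fun q x => smul_comm c q x }

theorem actK_tmul (c : QuadField d) (z : ℂ) (x : V) : actK d V c (z ⊗ₜ x) = z ⊗ₜ (c • x) := rfl

theorem exists_actK_eq (c : QuadField d) : ∃ a b : ℚ, (c : ℂ) = a + b * sqrtNeg d ∧
    ∀ z : ℂ ⊗[ℚ] V, actK d V c z = (a : ℂ) • z + (b : ℂ) • opJC d V z := by
  obtain ⟨a, b, h⟩ := exists_rat_add_mul_sqrtNeg c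
  refine ⟨a, b, h, fun z => ?_⟩
  have e : c = (a : QuadField d) + (b : QuadField d) * sqrtK d := by
    apply Subtype.ext
    rw [h]
    push_cast
    rfl
  induction z using TensorProduct.induction_on with
  | zero => simp
  | add z w hz hw => rw [map_add, hz, hw, map_add, smul_add, smul_add]; abel
  | tmul t x =>
    rw [actK_tmul, e, add_smul, mul_smul, Rat.cast_smul_eq_qsmul, Rat.cast_smul_eq_qsmul,
      TensorProduct.tmul_add, TensorProduct.tmul_smul, TensorProduct.tmul_smul]
    have e1 : opJC d V (t ⊗ₜ x) = t ⊗ₜ (sqrtK d • x) := rfl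
    rw [e1, Rat.cast_smul_eq_qsmul, Rat.cast_smul_eq_qsmul]

namespace EvenLattice

variable (L : EvenLattice d V)

theorem formC_actK_left (c : QuadField d) (z w : ℂ ⊗[ℚ] V) :
    L.formC (actK d V c z) w = c * L.formC z w := by
  induction z using TensorProduct.induction_on with
  | zero => simp
  | add z z' hz hz' => rw [map_add, map_add, LinearMap.add_apply, hz, hz', map_add,
      LinearMap.add_apply, mul_add]
  | tmul t x =>
    induction w using TensorProduct.induction_on with
    | zero => simp
    | add w w' hw hw' => rw [map_add, hw, hw', map_add, mul_add]
    | tmul s y =>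
      rw [actK_tmul, formC_tmul, formC_tmul, L.form_smul_left]
      push_cast; ring

theorem formC_actK_right (c : QuadField d) (z w : ℂ ⊗[ℚ] V) :
    L.formC z (actK d V c w) = (starRingEnd ℂ) (c : ℂ) * L.formC z w := by
  induction z using TensorProduct.induction_on with
  | zero => simp
  | add z z' hz hz' => rw [map_add, LinearMap.add_apply, hz, hz',
      LinearMap.add_apply, mul_add]
  | tmul t x =>
    induction w using TensorProduct.induction_on with
    | zero => simp
    | add w w' hw hw' => rw [map_add, map_add, hw, hw', map_add, mul_add]
    | tmul s y =>
      rw [actK_tmul, formC_tmul, formC_tmul, L.form_smul_right]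
      ring

theorem actK_sqrtK (z : ℂ ⊗[ℚ] V) : actK d V (sqrtK d) z = opJC d V z := rfl

/-- In the second variable √-d ∈ 𝕂 passes through the pairing as its conjugate -√-d, but on V_ℂ it
is the scalar √-d; the two agree only if the pairing is zero. -/
theorem formC_VC_right (z : ℂ ⊗[ℚ] V) (ζ : VC d V) : L.formC z ζ = 0 := by
  have h1 := L.formC_actK_right (sqrtK d) z ζ
  have h2 : opJC d V (ζ : ℂ ⊗[ℚ] V) = sqrtNeg d • (ζ : ℂ ⊗[ℚ] V) :=
    Module.End.mem_eigenspace_iff.mp ζ.2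
  have hsK : ((sqrtK d : QuadField d) : ℂ) = sqrtNeg d := rfl
  rw [actK_sqrtK, h2, hsK, conj_sqrtNeg, map_smul, smul_eq_mul] at h1
  have h3 : (2 * sqrtNeg d) * L.formC z ζ = 0 := by linear_combination h1
  exact (mul_eq_zero.mp h3).resolve_left (mul_ne_zero two_ne_zero (sqrtNeg_ne_zero d))

theorem formC_VCbar_left (ω : VCbar d V) (z : ℂ ⊗[ℚ] V) : L.formC ω z = 0 := by
  have h1 := L.formC_actK_left (sqrtK d) ω z
  have h2 : opJC d V (ω : ℂ ⊗[ℚ] V) = -sqrtNeg d • (ω : ℂ ⊗[ℚ] V) :=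
    Module.End.mem_eigenspace_iff.mp ω.2
  have hsK : ((sqrtK d : QuadField d) : ℂ) = sqrtNeg d := rfl
  rw [actK_sqrtK, h2, hsK, map_smul, LinearMap.smul_apply, smul_eq_mul] at h1
  have h3 : (2 * sqrtNeg d) * L.formC ω z = 0 := by linear_combination -h1
  exact (mul_eq_zero.mp h3).resolve_left (mul_ne_zero two_ne_zero (sqrtNeg_ne_zero d))

/-- This merges the two elliptic variables: the exponent of the theta function depends on ζ and ω
only through the trace pairing with ζ + ω. -/
theorem bil_add_eq (ζ : VC d V) (ω : VCbar d V) (x : ℂ ⊗[ℚ] V) :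
    L.bil (ζ + ω) x = L.formC ζ x + L.formC x ω := by
  rw [bil_apply, map_add, map_add, LinearMap.add_apply, formC_VC_right, formC_VCbar_left]
  ring

theorem bil_add_self (ζ : VC d V) (ω : VCbar d V) :
    L.bil (ζ + ω) (ζ + ω) = 2 * L.formC ζ ω := by
  rw [bil_add_eq, map_add, map_add, LinearMap.add_apply, formC_VC_right, formC_VCbar_left]
  ring

end EvenLattice

theorem toVC_add_toVCbar (x : ℂ ⊗[ℚ] V) :
    (toVC (d := d) x : ℂ ⊗[ℚ] V) + (toVCbar (d := d) x : ℂ ⊗[ℚ] V) = x := by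
  simp only [toVC, toVCbar]
  rw [sub_add_add_cancel, ← add_smul]
  norm_num

theorem toVC_add (x y : ℂ ⊗[ℚ] V) : toVC (d := d) (x + y) = toVC x + toVC y := by
  apply Subtype.ext
  simp only [toVC, map_add, smul_add, Submodule.coe_add]
  abel

theorem toVCbar_add (x y : ℂ ⊗[ℚ] V) : toVCbar (d := d) (x + y) = toVCbar x + toVCbar y := by
  apply Subtype.ext
  simp only [toVCbar, map_add, smul_add, Submodule.coe_add]
  abel

theorem toVC_smul (c : ℂ) (x : ℂ ⊗[ℚ] V) : toVC (d := d) (c • x) = c • toVC x := by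
  apply Subtype.ext
  simp only [toVC, map_smul, Submodule.coe_smul, smul_sub, smul_comm c]

theorem toVCbar_smul (c : ℂ) (x : ℂ ⊗[ℚ] V) : toVCbar (d := d) (c • x) = c • toVCbar x := by
  apply Subtype.ext
  simp only [toVCbar, map_smul, Submodule.coe_smul, smul_add, smul_comm c]

theorem toVC_add_mem (ζ : VC d V) (ω : VCbar d V) :
    toVC (d := d) ((ζ : ℂ ⊗[ℚ] V) + (ω : ℂ ⊗[ℚ] V)) = ζ := by
  have h0 : (d : ℂ) ≠ 0 := by exact_mod_cast hd.pos.ne'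
  have h1 : opJC d V (ζ : ℂ ⊗[ℚ] V) = sqrtNeg d • (ζ : ℂ ⊗[ℚ] V) :=
    Module.End.mem_eigenspace_iff.mp ζ.2
  have h2 : opJC d V (ω : ℂ ⊗[ℚ] V) = -sqrtNeg d • (ω : ℂ ⊗[ℚ] V) :=
    Module.End.mem_eigenspace_iff.mp ω.2
  apply Subtype.ext
  simp only [toVC, map_add, h1, h2, smul_add, smul_smul]
  have e1 : sqrtNeg d / (2 * d) * sqrtNeg d = -(1 / 2 : ℂ) := by
    rw [div_mul_eq_mul_div, sqrtNeg_mul_self]; field_simp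
  have e2 : sqrtNeg d / (2 * d) * -sqrtNeg d = (1 / 2 : ℂ) := by
    rw [mul_neg, e1]; ring
  rw [e1, e2]
  module

theorem toVCbar_add_mem (ζ : VC d V) (ω : VCbar d V) :
    toVCbar (d := d) ((ζ : ℂ ⊗[ℚ] V) + (ω : ℂ ⊗[ℚ] V)) = ω := by
  apply Subtype.ext
  have h := toVC_add_toVCbar (d := d) ((ζ : ℂ ⊗[ℚ] V) + (ω : ℂ ⊗[ℚ] V))
  rw [toVC_add_mem] at h
  exact add_left_cancel h

end Linear

/-- The parameters `τ`, `-τ̄` of the theta series attached to the frame. -/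
def frameBeta (L : EvenLattice d V) (τ : UpperHalfPlane) : FrameIndex L → ℂ :=
  Sum.elim (fun _ => (τ : ℂ)) (fun _ => -(starRingEnd ℂ) (τ : ℂ))

theorem frameBeta_im_pos (L : EvenLattice d V) (τ : UpperHalfPlane) (i : FrameIndex L) :
    0 < (frameBeta L τ i).im := by
  rcases i with i | i
  · exact τ.im_pos
  · have := τ.im_pos
    simpa [frameBeta] using this

/-! ### The theta function in the single variable z = ζ + ω -/

namespace EvenLattice

variable (L : EvenLattice d V) (v : GrJ L)

/-- The theta term as a function of `z = ζ + ω`. -/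
def zTerm (τ : UpperHalfPlane) (z : ℂ ⊗[ℚ] V) (x : V) : ℂ :=
  expC (τ * v.normPos x + (starRingEnd ℂ) (τ : ℂ) * v.normNeg x + L.bil z (1 ⊗ₜ x))

theorem thetaTerm_eq_zTerm (τ : UpperHalfPlane) (ζ : VC d V) (ω : VCbar d V) (x : V) :
    L.thetaTerm v τ ζ ω x = L.zTerm v τ (ζ + ω) x := by
  rw [thetaTerm, zTerm, bil_add_eq]
  congr 1
  ring

/-- The class in the discriminant group. -/
def disc (x : L.dual) : L.Disc := (L.M.submoduleOf L.dual).mkQ x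

/-- The theta function as a function of `z = ζ + ω`. -/
def thetaZ (τ : UpperHalfPlane) (z : ℂ ⊗[ℚ] V) (γ : L.Disc) : ℂ :=
  ∑' x : {x : L.dual // L.disc x = γ}, L.zTerm v τ z (x : L.dual)

theorem theta_eq_thetaZ (τ : UpperHalfPlane) (ζ : VC d V) (ω : VCbar d V) :
    L.theta v τ ζ ω = L.thetaZ v τ (ζ + ω) := by
  funext γ
  rw [theta, thetaZ]
  exact tsum_congr fun x => L.thetaTerm_eq_zTerm v τ ζ ω _

theorem disc_surjective : Function.Surjective L.disc := Submodule.mkQ_surjective _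

theorem disc_eq_iff (x y : L.dual) : L.disc x = L.disc y ↔ (x : V) - y ∈ L.M := by
  rw [disc, disc, Submodule.mkQ_apply, Submodule.mkQ_apply, Submodule.Quotient.eq]
  rfl

end EvenLattice

namespace ThetaFrame

variable {L : EvenLattice d V} {v : GrJ L} (F : ThetaFrame L v)

theorem y_add (x x' : V) : F.y (x + x') = F.y x + F.y x' := by
  funext i
  have h : ((F.y (x + x') i : ℝ) : ℂ) = ((F.y x i + F.y x' i : ℝ) : ℂ) := by
    push_cast
    rw [← F.κ_tmul, ← F.κ_tmul, ← F.κ_tmul, TensorProduct.tmul_add, map_add]; rfl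
  exact_mod_cast h

theorem y_sum_zsmul {N : ℕ} (n : Fin N → ℤ) (b : Fin N → V) (i : FrameIndex L) :
    F.y (∑ j, n j • b j) i = ∑ j, (n j : ℝ) * F.y (b j) i := by
  have h : ((F.y (∑ j, n j • b j) i : ℝ) : ℂ) = ((∑ j, (n j : ℝ) * F.y (b j) i : ℝ) : ℂ) := by
    push_cast
    rw [← F.κ_tmul, TensorProduct.tmul_sum, map_sum, Finset.sum_apply]
    refine Finset.sum_congr rfl fun j _ => ?_
    rw [TensorProduct.tmul_smul, map_zsmul, Pi.smul_apply, F.κ_tmul, zsmul_eq_mul]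
  exact_mod_cast h

theorem bil_tmul (z : ℂ ⊗[ℚ] V) (x : V) :
    L.bil z (1 ⊗ₜ x) = ∑ i, 2 * (frameSign L i : ℂ) * F.κ z i * F.y x i := by
  rw [F.bil_eq, Finset.mul_sum]
  refine Finset.sum_congr rfl fun i _ => ?_
  rw [F.κ_tmul]; ring

theorem normPos_eq (x : V) : v.normPos x = ∑ i, (F.y x (Sum.inl i) : ℂ) ^ 2 := by
  have h : v.normPos x = (1 / 2) * L.bil (v.projPos (1 ⊗ₜ x)) (v.projPos (1 ⊗ₜ x)) := by
    rw [EvenLattice.bil_apply, GrJ.normPos]; ring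
  rw [h, F.bil_eq, Fintype.sum_sum_type]
  simp only [F.projPos_inl, F.projPos_inr, F.κ_tmul, frameSign, Sum.elim_inl]
  simp [sq]

theorem normNeg_eq (x : V) : v.normNeg x = -∑ i, (F.y x (Sum.inr i) : ℂ) ^ 2 := by
  have h : v.normNeg x = (1 / 2) * L.bil (v.projNeg (1 ⊗ₜ x)) (v.projNeg (1 ⊗ₜ x)) := by
    rw [EvenLattice.bil_apply, GrJ.normNeg]; ring
  rw [h, F.bil_eq, Fintype.sum_sum_type]
  simp only [F.projNeg_inl, F.projNeg_inr, F.κ_tmul, frameSign, Sum.elim_inr]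
  simp [sq]

theorem zTerm_eq (τ : UpperHalfPlane) (z : ℂ ⊗[ℚ] V) (x : V) :
    L.zTerm v τ z x = expC (∑ i, frameBeta L τ i * (F.y x i : ℂ) ^ 2 + L.bil z (1 ⊗ₜ x)) := by
  rw [EvenLattice.zTerm, F.normPos_eq, F.normNeg_eq, Fintype.sum_sum_type]
  simp only [frameBeta, Sum.elim_inl, Sum.elim_inr, Finset.mul_sum, neg_mul, Finset.sum_neg_distrib,
    mul_neg]

/-- The second argument of the theta series. -/
def w (z : ℂ ⊗[ℚ] V) : FrameIndex L → ℂ := fun i => 2 * (frameSign L i : ℂ) * F.κ z i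

theorem zTerm_eq_thetaExponent (τ : UpperHalfPlane) (z : ℂ ⊗[ℚ] V) (x : V) :
    L.zTerm v τ z x = expC (thetaExponent (F.y x) (frameBeta L τ, F.w z)) := by
  rw [F.zTerm_eq, F.bil_tmul, thetaExponent, Finset.sum_add_distrib]
  rfl

/-- The integral coordinates (b_j, x) of x ∈ M* are linear in the frame coordinates of x, hence
bounded by a multiple of ∑|y_i(x)|. -/
theorem sparse (G : LatticeFrame L) : Sparse fun x : L.dual => F.y x := by
  refine sparse_of_le (D := G.D) G.D.injective (C := 2 * ∑ j, ∑ i, |F.y (G.b j) i|) fun x j => ?_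
  have h := G.bil_b x j
  rw [F.bil_tmul] at h
  have h2 : (G.D x j : ℝ) = ∑ i, 2 * frameSign L i * F.y (G.b j) i * F.y x i := by
    have : ((G.D x j : ℝ) : ℂ) = ((∑ i, 2 * frameSign L i * F.y (G.b j) i * F.y x i : ℝ) : ℂ) := by
      push_cast
      rw [← h]
      simp only [F.κ_tmul]
    exact_mod_cast this
  rw [h2, Finset.mul_sum]
  refine (Finset.abs_sum_le_sum_abs _ _).trans (Finset.sum_le_sum fun i _ => ?_)
  rw [abs_mul]
  refine mul_le_mul_of_nonneg_right ?_ (abs_nonneg _)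
  have hs : |frameSign L i| = 1 := by rcases i with i | i <;> simp [frameSign]
  rw [abs_mul, abs_mul, hs, mul_one, abs_two]
  refine mul_le_mul_of_nonneg_left ?_ two_pos.le
  calc |F.y (G.b j) i| ≤ ∑ i, |F.y (G.b j) i| :=
        Finset.single_le_sum (f := fun i => |F.y (G.b j) i|) (fun _ _ => abs_nonneg _)
          (Finset.mem_univ i)
    _ ≤ _ := Finset.single_le_sum (f := fun j => ∑ i, |F.y (G.b j) i|)
          (fun _ _ => Finset.sum_nonneg fun _ _ => abs_nonneg _) (Finset.mem_univ j)

end ThetaFrame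

theorem Sparse.comp_injective {ι : Type} [Fintype ι] {X Y : Type*} {y : X → ι → ℝ} (hy : Sparse y)
    {f : Y → X} (hf : Function.Injective f) : Sparse fun a => y (f a) :=
  fun c hc => (hy c hc).comp_injective hf

namespace EvenLattice

variable (L : EvenLattice d V) (v : GrJ L)

theorem summable_zTerm (τ : UpperHalfPlane) (z : ℂ ⊗[ℚ] V) :
    Summable fun x : L.dual => L.zTerm v τ z x := by
  obtain ⟨F⟩ := exists_thetaFrame L v
  obtain ⟨G⟩ := exists_latticeFrame L
  have := (F.sparse G).summable (p := (frameBeta L τ, F.w z)) (frameBeta_im_pos L τ)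
  exact this.congr fun x => (F.zTerm_eq_thetaExponent τ z x).symm

/-- Absolute convergence allows the sum over M* to be grouped along the fibres of M* → D_M. Read
backwards, it turns an expansion with coefficients constant on cosets into a pairing with the theta
function. -/
theorem hasSum_mul_zTerm (τ : UpperHalfPlane) (z : ℂ ⊗[ℚ] V) (c : L.Disc → ℂ) :
    HasSum (fun x : L.dual => c (L.disc x) * L.zTerm v τ z x) (∑ γ, L.thetaZ v τ z γ * c γ) := by
  have hs : Summable fun x : L.dual => c (L.disc x) * L.zTerm v τ z x := by
    refine Summable.of_norm_bounded (g := fun x => (∑ γ, ‖c γ‖) * ‖L.zTerm v τ z x‖)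
      ((L.summable_zTerm v τ z).norm.mul_left _) fun x => ?_
    rw [norm_mul]
    exact mul_le_mul_of_nonneg_right (Finset.single_le_sum (f := fun γ => ‖c γ‖)
      (fun _ _ => norm_nonneg _) (Finset.mem_univ _)) (norm_nonneg _)
  have h := hs.hasSum
  have e : ∑' x : L.dual, c (L.disc x) * L.zTerm v τ z x = ∑ γ, L.thetaZ v τ z γ * c γ := by
    rw [← (Equiv.sigmaFiberEquiv L.disc).tsum_eq]
    have hs2 := (Equiv.sigmaFiberEquiv L.disc).summable_iff.mpr hs
    refine (Summable.tsum_sigma hs2).trans ?_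
    rw [tsum_fintype]
    refine Finset.sum_congr rfl fun γ _ => ?_
    rw [thetaZ, ← tsum_mul_right]
    refine tsum_congr fun x => ?_
    have : L.disc (x : L.dual) = γ := x.2
    simp only [Function.comp_apply, Equiv.sigmaFiberEquiv_apply, this]
    rw [mul_comm]
  rwa [e] at h

end EvenLattice

namespace LatticeFrame

variable {L : EvenLattice d V} (G : LatticeFrame L)

/-- Linear coordinates on `V ⊗ ℂ` with respect to the basis of `M`. -/
def coord : (Fin G.N → ℂ) ≃ₗ[ℂ] ℂ ⊗[ℚ] V := (G.b.baseChange ℂ).equivFun.symm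

theorem coord_apply (t : Fin G.N → ℂ) : G.coord t = ∑ j, t j • (1 ⊗ₜ[ℚ] G.b j : ℂ ⊗[ℚ] V) := by
  rw [coord, Module.Basis.equivFun_symm_apply]
  simp

theorem bil_coord (t : Fin G.N → ℂ) (x : L.dual) :
    L.bil (G.coord t) (1 ⊗ₜ (x : V)) = ∑ j, (G.D x j : ℂ) * t j := by
  rw [coord_apply, LinearMap.map_sum₂]
  refine Finset.sum_congr rfl fun j _ => ?_
  rw [LinearMap.map_smul₂, G.bil_b, smul_eq_mul, mul_comm]

theorem coord_intVec (n : Fin G.N → ℤ) :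
    G.coord (cvec (intVec n)) = 1 ⊗ₜ[ℚ] (∑ j, n j • G.b j) := by
  rw [coord_apply, TensorProduct.tmul_sum]
  refine Finset.sum_congr rfl fun j _ => ?_
  rw [TensorProduct.tmul_smul, ← Int.cast_smul_eq_zsmul ℂ]
  rfl

theorem sum_mem_M (n : Fin G.N → ℤ) : ∑ j, n j • G.b j ∈ L.M := (G.mem_M _).mpr ⟨n, rfl⟩

end LatticeFrame

/-! ### Fourier expansions, independence and translation law of theta -/

namespace EvenLattice

variable (L : EvenLattice d V) (v : GrJ L)

/-- Uniqueness of the theta-type Fourier expansion. -/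
theorem expansion_unique {τ : UpperHalfPlane} {φ : ℂ ⊗[ℚ] V → ℂ} {f g : L.dual → ℂ}
    (hf : ∀ z, HasSum (fun x : L.dual => f x * L.zTerm v τ z x) (φ z))
    (hg : ∀ z, HasSum (fun x : L.dual => g x * L.zTerm v τ z x) (φ z)) : f = g := by
  obtain ⟨F⟩ := exists_thetaFrame L v
  obtain ⟨G⟩ := exists_latticeFrame L
  -- On the real span of M each term is its value at z = 0 times a character of the coordinates. The
  -- expansion is thus an ordinary Fourier series, and the value at z = 0 is an exponential that can
  -- be divided out.
  have key : ∀ f : L.dual → ℂ, (∀ z, HasSum (fun x : L.dual => f x * L.zTerm v τ z x) (φ z)) →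
      ∀ x, boxCoeff (fun t => φ (G.coord (cvec t))) (G.D x) = f x * L.zTerm v τ 0 x := by
    intro f hf x
    have h0 : ∀ (t : Fin G.N → ℝ) (x : L.dual), L.zTerm v τ (G.coord (cvec t)) x =
        L.zTerm v τ 0 x * expC (∑ j, (G.D x j : ℂ) * t j) := by
      intro t x
      rw [zTerm, zTerm, G.bil_coord, map_zero, LinearMap.zero_apply, add_zero, expC_add]
      rfl
    have h1 : ∀ t : Fin G.N → ℝ, HasSum (fun n => f (G.D.symm n) * L.zTerm v τ 0 (G.D.symm n) *
        expC (∑ j, (n j : ℂ) * t j)) (φ (G.coord (cvec t))) := by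
      intro t
      rw [← G.D.toEquiv.hasSum_iff]
      refine (hf (G.coord (cvec t))).congr_fun fun x => ?_
      simp only [Function.comp_apply, AddEquiv.toEquiv_eq_coe, EquivLike.coe_coe,
        AddEquiv.symm_apply_apply]
      rw [h0, mul_assoc]
    have h2 : Summable fun n => f (G.D.symm n) * L.zTerm v τ 0 (G.D.symm n) := by
      have := (h1 0).summable
      simpa [expC_zero] using this
    have := eq_boxCoeff_of_hasSum h2 h1 (G.D x)
    simpa using this
  funext x
  have h := (key f hf x).symm.trans (key g hg x)
  exact mul_right_cancel₀ (expC_ne_zero _) h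

/-- Existence of the theta-type Fourier expansion of an entire periodic function. -/
theorem exists_expansion (G : LatticeFrame L) (τ : UpperHalfPlane) {φ : ℂ ⊗[ℚ] V → ℂ}
    (hφ : Differentiable ℂ fun t => φ (G.coord t)) (hper : ∀ z, ∀ ν ∈ L.M, φ (z + 1 ⊗ₜ ν) = φ z) :
    ∃ f : L.dual → ℂ, ∀ z, HasSum (fun x : L.dual => f x * L.zTerm v τ z x) (φ z) := by
  obtain ⟨a, ha⟩ := exists_hasSum_of_entire_periodic hφ (fun t n => by
    rw [map_add, G.coord_intVec, hper _ _ (G.sum_mem_M n)])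
  -- The theta-type coefficient is the ordinary one divided by the term at z = 0.
  refine ⟨fun x => a (G.D x) * (L.zTerm v τ 0 x)⁻¹, fun z => ?_⟩
  obtain ⟨t, rfl⟩ := G.coord.surjective z
  have h := G.D.toEquiv.hasSum_iff.mpr (ha t)
  refine h.congr_fun fun x => ?_
  have h0 : L.zTerm v τ (G.coord t) x = L.zTerm v τ 0 x * expC (∑ j, (G.D x j : ℂ) * t j) := by
    rw [zTerm, zTerm, G.bil_coord, map_zero, LinearMap.zero_apply, add_zero, expC_add]
  simp only [Function.comp_apply, AddEquiv.toEquiv_eq_coe, EquivLike.coe_coe]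
  have hz : L.zTerm v τ 0 x ≠ 0 := expC_ne_zero _
  rw [h0, mul_assoc, inv_mul_cancel_left₀ hz]

/-- Linear independence of the components of the theta function. -/
theorem thetaZ_independent {τ : UpperHalfPlane} {a b : L.Disc → ℂ}
    (h : ∀ z, ∑ γ, L.thetaZ v τ z γ * a γ = ∑ γ, L.thetaZ v τ z γ * b γ) : a = b := by
  have h1 := L.expansion_unique v (τ := τ) (φ := fun z => ∑ γ, L.thetaZ v τ z γ * a γ)
    (f := fun x => a (L.disc x)) (g := fun x => b (L.disc x))
    (fun z => L.hasSum_mul_zTerm v τ z a) (fun z => by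
      rw [h]
      exact L.hasSum_mul_zTerm v τ z b)
  funext γ
  obtain ⟨x, rfl⟩ := L.disc_surjective γ
  exact congrFun h1 x

/-- The automorphy factor of the lattice translations. -/
theorem zTerm_shift (τ : UpperHalfPlane) (z : ℂ ⊗[ℚ] V) (σ x : V) :
    L.zTerm v τ (z + ((τ : ℂ) • v.projPos (1 ⊗ₜ σ) + (starRingEnd ℂ) (τ : ℂ) • v.projNeg (1 ⊗ₜ σ))) x =
      expC (-(τ * v.normPos σ) - (starRingEnd ℂ) (τ : ℂ) * v.normNeg σ - L.bil z (1 ⊗ₜ σ)) *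
        L.zTerm v τ z (x + σ) := by
  obtain ⟨F⟩ := exists_thetaFrame L v
  have h1 : L.bil ((τ : ℂ) • v.projPos (1 ⊗ₜ σ) + (starRingEnd ℂ) (τ : ℂ) • v.projNeg (1 ⊗ₜ σ))
      (1 ⊗ₜ x) = ∑ i, 2 * frameBeta L τ i * F.y σ i * F.y x i := by
    rw [F.bil_tmul, Fintype.sum_sum_type, Fintype.sum_sum_type]
    simp only [map_add, map_smul, Pi.add_apply, Pi.smul_apply, F.projPos_inl, F.projPos_inr,
      F.projNeg_inl, F.projNeg_inr, F.κ_tmul, frameSign, frameBeta, Sum.elim_inl, Sum.elim_inr,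
      smul_eq_mul]
    push_cast
    congr 1 <;> refine Finset.sum_congr rfl fun i _ => ?_ <;> ring
  have h2 : (τ : ℂ) * v.normPos σ + (starRingEnd ℂ) (τ : ℂ) * v.normNeg σ =
      ∑ i, frameBeta L τ i * (F.y σ i : ℂ) ^ 2 := by
    rw [F.normPos_eq, F.normNeg_eq, Fintype.sum_sum_type]
    simp only [frameBeta, Sum.elim_inl, Sum.elim_inr, Finset.mul_sum, neg_mul,
      Finset.sum_neg_distrib, mul_neg]
  have h3 : -((τ : ℂ) * v.normPos σ) - (starRingEnd ℂ) (τ : ℂ) * v.normNeg σ - L.bil z (1 ⊗ₜ σ) =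
      -(∑ i, frameBeta L τ i * (F.y σ i : ℂ) ^ 2) - L.bil z (1 ⊗ₜ σ) := by rw [← h2]; ring
  rw [h3, F.zTerm_eq, F.zTerm_eq, ← expC_add, map_add, LinearMap.add_apply, h1, F.y_add,
    TensorProduct.tmul_add, map_add]
  congr 1
  simp only [Pi.add_apply]
  -- Completing the square: the cross term of (y(x) + y(σ))² is what the translation of z
  -- contributes.
  have h4 : ∑ i, frameBeta L τ i * ((F.y x i + F.y σ i : ℝ) : ℂ) ^ 2 =
      ∑ i, frameBeta L τ i * (F.y x i : ℂ) ^ 2 + ∑ i, 2 * frameBeta L τ i * F.y σ i * F.y x i +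
        ∑ i, frameBeta L τ i * (F.y σ i : ℂ) ^ 2 := by
    rw [← Finset.sum_add_distrib, ← Finset.sum_add_distrib]
    refine Finset.sum_congr rfl fun i _ => ?_
    push_cast; ring
  rw [h4]
  ring

theorem zTerm_add_lattice (τ : UpperHalfPlane) (z : ℂ ⊗[ℚ] V) {ν : V} (hν : ν ∈ L.M) (x : L.dual) :
    L.zTerm v τ (z + 1 ⊗ₜ ν) x = L.zTerm v τ z x := by
  rw [zTerm, zTerm, map_add, LinearMap.add_apply, ← add_assoc, expC_add (_ + _), bil_tmul,
    add_comm (L.form ν x : ℂ), L.expC_trace x.2 hν, mul_one]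

end EvenLattice

/-! ### Isometries, translations and elementary symmetries of theta -/

theorem actK_mul (a b : QuadField d) (z : ℂ ⊗[ℚ] V) :
    actK d V (a * b) z = actK d V a (actK d V b z) := by
  induction z using TensorProduct.induction_on with
  | zero => simp
  | add z w hz hw => simp only [map_add, hz, hw]
  | tmul t x => rw [actK_tmul, actK_tmul, actK_tmul, mul_smul]

theorem actK_one (z : ℂ ⊗[ℚ] V) : actK d V 1 z = z := by
  induction z using TensorProduct.induction_on with
  | zero => simp
  | add z w hz hw => simp only [map_add, hz, hw]
  | tmul t x => rw [actK_tmul, one_smul]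

theorem actK_VC (c : QuadField d) (ζ : VC d V) :
    actK d V c (ζ : ℂ ⊗[ℚ] V) = (c : ℂ) • (ζ : ℂ ⊗[ℚ] V) := by
  obtain ⟨a, b, h, h'⟩ := exists_actK_eq (V := V) c
  have h2 : opJC d V (ζ : ℂ ⊗[ℚ] V) = sqrtNeg d • (ζ : ℂ ⊗[ℚ] V) :=
    Module.End.mem_eigenspace_iff.mp ζ.2
  rw [h', h2, h, add_smul, mul_smul]

theorem actK_VCbar (c : QuadField d) (ω : VCbar d V) :
    actK d V c (ω : ℂ ⊗[ℚ] V) = (starRingEnd ℂ) (c : ℂ) • (ω : ℂ ⊗[ℚ] V) := by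
  obtain ⟨a, b, h, h'⟩ := exists_actK_eq (V := V) c
  have h2 : opJC d V (ω : ℂ ⊗[ℚ] V) = -sqrtNeg d • (ω : ℂ ⊗[ℚ] V) :=
    Module.End.mem_eigenspace_iff.mp ω.2
  rw [h', h2, h, map_add, map_mul, conj_sqrtNeg, add_smul, mul_smul]
  simp

namespace GrJ

variable {L : EvenLattice d V} (v : GrJ L)

theorem projPos_actK (c : QuadField d) (z : ℂ ⊗[ℚ] V) :
    v.projPos (actK d V c z) = actK d V c (v.projPos z) := by
  obtain ⟨a, b, -, h⟩ := exists_actK_eq (V := V) c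
  rw [h, h, map_add, map_smul, map_smul, projPos_opJC]

theorem projNeg_actK (c : QuadField d) (z : ℂ ⊗[ℚ] V) :
    v.projNeg (actK d V c z) = actK d V c (v.projNeg z) := by
  obtain ⟨a, b, -, h⟩ := exists_actK_eq (V := V) c
  rw [h, h, map_add, map_smul, map_smul, projNeg_opJC]

theorem projPos_add_projNeg (z : ℂ ⊗[ℚ] V) : v.projPos z + v.projNeg z = z := by
  obtain ⟨F⟩ := exists_thetaFrame L v
  apply F.κ.injective
  funext i
  rw [map_add, Pi.add_apply]
  rcases i with i | i
  · rw [F.projPos_inl, F.projNeg_inl, add_zero]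
  · rw [F.projPos_inr, F.projNeg_inr, zero_add]

theorem projPos_projPos (z : ℂ ⊗[ℚ] V) : v.projPos (v.projPos z) = v.projPos z := by
  obtain ⟨F⟩ := exists_thetaFrame L v
  apply F.κ.injective
  funext i
  rcases i with i | i
  · rw [F.projPos_inl]
  · rw [F.projPos_inr, F.projPos_inr]

theorem projNeg_projNeg (z : ℂ ⊗[ℚ] V) : v.projNeg (v.projNeg z) = v.projNeg z := by
  obtain ⟨F⟩ := exists_thetaFrame L v
  apply F.κ.injective
  funext i
  rcases i with i | i
  · rw [F.projNeg_inl, F.projNeg_inl]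
  · rw [F.projNeg_inr]

theorem projPos_projNeg (z : ℂ ⊗[ℚ] V) : v.projPos (v.projNeg z) = 0 := by
  obtain ⟨F⟩ := exists_thetaFrame L v
  apply F.κ.injective
  funext i
  rw [map_zero, Pi.zero_apply]
  rcases i with i | i
  · rw [F.projPos_inl, F.projNeg_inl]
  · rw [F.projPos_inr]

theorem projNeg_projPos (z : ℂ ⊗[ℚ] V) : v.projNeg (v.projPos z) = 0 := by
  obtain ⟨F⟩ := exists_thetaFrame L v
  apply F.κ.injective
  funext i
  rw [map_zero, Pi.zero_apply]
  rcases i with i | i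
  · rw [F.projNeg_inl]
  · rw [F.projNeg_inr, F.projPos_inr]

theorem normPos_add_normNeg (x : V) : v.normPos x + v.normNeg x = L.form x x := by
  obtain ⟨F⟩ := exists_thetaFrame L v
  have h := F.bil_eq (1 ⊗ₜ x) (1 ⊗ₜ x)
  rw [EvenLattice.bil_tmul, Fintype.sum_sum_type] at h
  simp only [F.κ_tmul, frameSign, Sum.elim_inl, Sum.elim_inr, Complex.ofReal_one,
    Complex.ofReal_neg, one_mul, neg_mul, Finset.sum_neg_distrib] at h
  rw [F.normPos_eq, F.normNeg_eq]
  simp only [sq]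
  linear_combination -(1 / 2 : ℂ) * h

theorem normPos_actK (c : QuadField d) (x : V) :
    v.normPos (c • x) = c * (starRingEnd ℂ) (c : ℂ) * v.normPos x := by
  rw [normPos, normPos, ← actK_tmul, projPos_actK, L.formC_actK_left, L.formC_actK_right, mul_assoc]

theorem normNeg_actK (c : QuadField d) (x : V) :
    v.normNeg (c • x) = c * (starRingEnd ℂ) (c : ℂ) * v.normNeg x := by
  rw [normNeg, normNeg, ← actK_tmul, projNeg_actK, L.formC_actK_left, L.formC_actK_right, mul_assoc]

theorem normPos_neg (x : V) : v.normPos (-x) = v.normPos x := by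
  simp [normPos, TensorProduct.tmul_neg]

theorem normNeg_neg (x : V) : v.normNeg (-x) = v.normNeg x := by
  simp [normNeg, TensorProduct.tmul_neg]

end GrJ

namespace EvenLattice

variable (L : EvenLattice d V) (v : GrJ L)

theorem bil_actK (c : QuadField d) (hc : (c : ℂ) * (starRingEnd ℂ) (c : ℂ) = 1) (z w : ℂ ⊗[ℚ] V) :
    L.bil (actK d V c z) (actK d V c w) = L.bil z w := by
  rw [bil_apply, bil_apply, formC_actK_left, formC_actK_right, formC_actK_left, formC_actK_right,
    ← mul_assoc, ← mul_assoc, hc, one_mul, one_mul]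

theorem zTerm_actK (c : QuadField d) (hc : (c : ℂ) * (starRingEnd ℂ) (c : ℂ) = 1)
    (τ : UpperHalfPlane) (z : ℂ ⊗[ℚ] V) (x : V) :
    L.zTerm v τ (actK d V c z) (c • x) = L.zTerm v τ z x := by
  rw [zTerm, zTerm, v.normPos_actK, v.normNeg_actK, ← actK_tmul, L.bil_actK c hc, hc, one_mul,
    one_mul]

theorem zTerm_neg (τ : UpperHalfPlane) (z : ℂ ⊗[ℚ] V) (x : V) :
    L.zTerm v τ (-z) x = L.zTerm v τ z (-x) := by
  rw [zTerm, zTerm, v.normPos_neg, v.normNeg_neg, TensorProduct.tmul_neg, map_neg, map_neg,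
    LinearMap.neg_apply]

/-- Two sums over cosets of `M` agree when their terms match along a bijection. -/
theorem thetaZ_eq_of_equiv {τ τ' : UpperHalfPlane} {z z' : ℂ ⊗[ℚ] V} {γ γ' : L.Disc} {c : ℂ}
    (e : L.dual ≃ L.dual) (he : ∀ x, L.disc x = γ ↔ L.disc (e x) = γ')
    (h : ∀ x : L.dual, L.disc x = γ → L.zTerm v τ z x = c * L.zTerm v τ' z' (e x : L.dual)) :
    L.thetaZ v τ z γ = c * L.thetaZ v τ' z' γ' := by
  rw [thetaZ, thetaZ, ← tsum_mul_left]
  obtain ⟨e', he'⟩ : ∃ e' : {x : L.dual // L.disc x = γ} ≃ {x : L.dual // L.disc x = γ'},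
      ∀ x, (e' x : L.dual) = e x :=
    ⟨Equiv.subtypeEquiv (p := fun x => L.disc x = γ) (q := fun x => L.disc x = γ') e he,
      fun x => rfl⟩
  rw [← e'.tsum_eq (fun y : {x : L.dual // L.disc x = γ'} => c * L.zTerm v τ' z' (y : L.dual))]
  exact tsum_congr fun x => by rw [h x.1 x.2, he']

theorem thetaZ_neg (τ : UpperHalfPlane) (z : ℂ ⊗[ℚ] V) (γ : L.Disc) :
    L.thetaZ v τ (-z) γ = L.thetaZ v τ z (-γ) := by
  rw [L.thetaZ_eq_of_equiv v (c := 1) (Equiv.neg L.dual) (γ' := -γ) (z' := z) (τ' := τ), one_mul]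
  · intro x
    rw [Equiv.neg_apply, disc, disc, map_neg, neg_inj]
  · intro x _
    rw [one_mul, zTerm_neg]
    rfl

theorem discQuad_disc (x : L.dual) : L.discQuad (L.disc x) = expC (L.form (x : V) x) := rfl

theorem discPair_disc (x y : L.dual) :
    L.discPair (L.disc x) (L.disc y) = expC (L.form (x : V) y + L.form (y : V) x) := rfl

/-- Since |λ_{v₊}|² + |λ_{v₋}|² = |λ|², each term gains 𝐞(|λ|²), which is constant on a coset of M.
-/
theorem thetaZ_translate {τ τ' : UpperHalfPlane} (h : (τ' : ℂ) = τ + 1) (z : ℂ ⊗[ℚ] V)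
    (γ : L.Disc) : L.thetaZ v τ' z γ = L.discQuad γ * L.thetaZ v τ z γ := by
  refine L.thetaZ_eq_of_equiv v (Equiv.refl _) (fun x => Iff.rfl) fun x hx => ?_
  rw [← hx, discQuad_disc, zTerm, zTerm, ← expC_add, ← v.normPos_add_normNeg, h, map_add, map_one]
  congr 1
  simp only [Equiv.refl_apply]
  ring

/-- A unit of norm one acts as an isometry commuting with the projections, so it only permutes the
terms, carrying M + γ to M + ξγ. -/
theorem thetaZ_unit (ξ : (quadOrder d)ˣ) (hξ : embO d ξ * (starRingEnd ℂ) (embO d ξ) = 1)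
    (τ : UpperHalfPlane) (z : ℂ ⊗[ℚ] V) (γ : L.Disc) :
    L.thetaZ v τ (actK d V ((ξ⁻¹ : (quadOrder d)ˣ) : quadOrder d) z) γ = L.thetaZ v τ z (ξ • γ) := by
  have h1 : (((ξ : quadOrder d) : QuadField d) * ((ξ⁻¹ : (quadOrder d)ˣ) : quadOrder d)) = 1 := by
    exact_mod_cast congrArg Subtype.val ξ.mul_inv
  rw [L.thetaZ_eq_of_equiv v (c := 1) (MulAction.toPerm ξ) (γ' := ξ • γ) (z' := z) (τ' := τ), one_mul]
  · intro x
    rw [MulAction.toPerm_apply, disc, disc, Units.smul_def, Units.smul_def, map_smul]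
    exact (smul_left_cancel_iff ξ).symm
  · intro x _
    rw [one_mul, ← L.zTerm_actK v (ξ : quadOrder d) hξ, ← actK_mul, h1, actK_one]
    rfl

theorem thetaZ_add_lattice (τ : UpperHalfPlane) (z : ℂ ⊗[ℚ] V) {ν : V} (hν : ν ∈ L.M)
    (γ : L.Disc) : L.thetaZ v τ (z + 1 ⊗ₜ ν) γ = L.thetaZ v τ z γ :=
  tsum_congr fun x => L.zTerm_add_lattice v τ z hν x

theorem thetaZ_shift (τ : UpperHalfPlane) (z : ℂ ⊗[ℚ] V) {σ : V} (hσ : σ ∈ L.M) (γ : L.Disc) :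
    L.thetaZ v τ (z + ((τ : ℂ) • v.projPos (1 ⊗ₜ σ)
        + (starRingEnd ℂ) (τ : ℂ) • v.projNeg (1 ⊗ₜ σ))) γ =
      expC (-(τ * v.normPos σ) - (starRingEnd ℂ) (τ : ℂ) * v.normNeg σ - L.bil z (1 ⊗ₜ σ)) *
        L.thetaZ v τ z γ := by
  refine L.thetaZ_eq_of_equiv v (Equiv.addRight ⟨σ, L.M_le_dual hσ⟩) (fun x => ?_) fun x _ => ?_
  · rw [← (L.disc_eq_iff (Equiv.addRight ⟨σ, L.M_le_dual hσ⟩ x) x).mpr]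
    simpa using hσ
  · exact L.zTerm_shift v τ z σ x

end EvenLattice

/-! ### The inversion formula for the theta function -/

namespace ThetaFrame

variable {L : EvenLattice d V} {v : GrJ L} (F : ThetaFrame L v) (G : LatticeFrame L)

/-- The real coordinates of the basis of the lattice. -/
def latticeMap : (Fin G.N → ℝ) →ₗ[ℝ] (FrameIndex L → ℝ) where
  toFun x i := ∑ j, x j * F.y (G.b j) i
  map_add' x y := by
    funext i
    simp only [Pi.add_apply, add_mul, Finset.sum_add_distrib]
  map_smul' c x := by
    funext i
    simp only [Pi.smul_apply, smul_eq_mul, mul_assoc, Finset.mul_sum, RingHom.id_apply]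

theorem latticeMap_ofReal (x : Fin G.N → ℝ) (i : FrameIndex L) :
    (F.latticeMap G x i : ℂ) = F.κ (G.coord (cvec x)) i := by
  rw [G.coord_apply, map_sum, Finset.sum_apply]
  change ((∑ j, x j * F.y (G.b j) i : ℝ) : ℂ) = _
  push_cast
  refine Finset.sum_congr rfl fun j _ => ?_
  rw [map_smul, Pi.smul_apply, F.κ_tmul, smul_eq_mul]
  rfl

theorem latticeMap_injective : Function.Injective (F.latticeMap G) := by
  rw [← LinearMap.ker_eq_bot, LinearMap.ker_eq_bot']
  intro x hx
  have h : F.κ (G.coord (cvec x)) = 0 := by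
    funext i
    rw [← F.latticeMap_ofReal, hx]
    simp
  rw [LinearEquiv.map_eq_zero_iff, LinearEquiv.map_eq_zero_iff] at h
  funext j
  have := congrFun h j
  exact Complex.ofReal_eq_zero.mp this

/-- The coordinates of the frame as a real linear equivalence. -/
def latticeEquiv : (Fin G.N → ℝ) ≃ₗ[ℝ] (FrameIndex L → ℝ) :=
  LinearEquiv.ofInjectiveOfFinrankEq (F.latticeMap G) (F.latticeMap_injective G) (by
    have h := (G.coord.trans F.κ).finrank_eq
    simp only [Module.finrank_fintype_fun_eq_card] at h ⊢
    exact h)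

theorem latticeEquiv_intVec (n : Fin G.N → ℤ) (i : FrameIndex L) :
    F.latticeEquiv G (intVec n) i = F.y (∑ j, n j • G.b j) i := by
  rw [F.y_sum_zsmul]
  rfl

end ThetaFrame

namespace EvenLattice

variable (L : EvenLattice d V) (v : GrJ L)

/-- The elements of a coset of `M` in terms of a basis of `M`. -/
def cosetEquiv (G : LatticeFrame L) (x₀ : L.dual) :
    (Fin G.N → ℤ) ≃ {x : L.dual // L.disc x = L.disc x₀} :=
  Equiv.ofBijective
    (fun n => ⟨x₀ + ⟨∑ j, n j • G.b j, L.M_le_dual (G.sum_mem_M n)⟩, by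
      rw [disc_eq_iff]
      simpa using G.sum_mem_M n⟩) (by
    constructor
    · intro n m h
      have h1 : ∑ j, n j • G.b j = ∑ j, m j • G.b j := by
        have := congrArg (fun x : {x : L.dual // L.disc x = L.disc x₀} => ((x : L.dual) : V)) h
        exact add_left_cancel this
      simp only [← Int.cast_smul_eq_zsmul ℚ] at h1
      have h2 := (Fintype.linearIndependent_iff.mp G.b.linearIndependent)
        (fun j => (n j : ℚ) - m j) (by simp only [sub_smul, Finset.sum_sub_distrib, h1, sub_self])
      funext j
      have := h2 j
      exact_mod_cast sub_eq_zero.mp this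
    · rintro ⟨x, hx⟩
      obtain ⟨n, hn⟩ := (G.mem_M _).mp ((L.disc_eq_iff x x₀).mp hx)
      refine ⟨n, Subtype.ext (Subtype.ext ?_)⟩
      change (x₀ : V) + ∑ j, n j • G.b j = x
      rw [← hn]
      abel)

theorem cosetEquiv_coe (G : LatticeFrame L) (x₀ : L.dual) (n : Fin G.N → ℤ) :
    ((L.cosetEquiv G x₀ n : L.dual) : V) = x₀ + ∑ j, n j • G.b j := rfl

theorem frameBeta_inv {τ τ' : UpperHalfPlane} (h : (τ' : ℂ) = -(τ : ℂ)⁻¹) (i : FrameIndex L) :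
    frameBeta L τ' i = -(frameBeta L τ i)⁻¹ := by
  rcases i with i | i
  · exact h
  · simp only [frameBeta, Sum.elim_inr]
    rw [h, map_neg, map_inv₀, inv_neg]

/-- The values τ and -τ̄ occur 2b₊ and 2b₋ times. The square roots from the Gaussian integrals
therefore combine into integral powers, and no branch has to be tracked. -/
theorem prod_frameBeta_cpow (τ : UpperHalfPlane) :
    ∏ i, (frameBeta L τ i / (2 * Complex.I)) ^ (1 / 2 : ℂ) =
      (1 / 2) ^ (L.bPos + L.bNeg) * Complex.I ^ ((L.bNeg : ℤ) - L.bPos) *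
        ((τ : ℂ) ^ L.bPos * (starRingEnd ℂ) (τ : ℂ) ^ L.bNeg) := by
  have hsq : ∀ (z : ℂ) (n : ℕ), (z ^ (1 / 2 : ℂ)) ^ (2 * n) = z ^ n := by
    intro z n
    rw [pow_mul, ← Complex.cpow_nat_mul]
    norm_num
  rw [Fintype.prod_sum_type]
  simp only [frameBeta, Sum.elim_inl, Sum.elim_inr, Finset.prod_const, Finset.card_univ,
    Fintype.card_fin]
  rw [hsq, hsq, zpow_sub₀ Complex.I_ne_zero, zpow_natCast, zpow_natCast]
  have e1 : (τ : ℂ) / (2 * Complex.I) = (1 / 2) * Complex.I⁻¹ * τ := by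
    field_simp
  have e2 : -(starRingEnd ℂ) (τ : ℂ) / (2 * Complex.I) =
      (1 / 2) * Complex.I * (starRingEnd ℂ) (τ : ℂ) := by
    have hI : Complex.I⁻¹ = -Complex.I := Complex.inv_I
    rw [div_eq_mul_inv, mul_inv, hI]
    ring
  rw [e1, e2]
  simp only [mul_pow, inv_pow, pow_add, div_eq_mul_inv]
  ring

/-- The exponent of the automorphy factor of the inversion. -/
theorem bil_projPos_projNeg (F : ThetaFrame L v) (τ : UpperHalfPlane) (z : ℂ ⊗[ℚ] V) :
    1 / 2 * (L.bil (v.projPos z) (v.projPos z) / τ +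
      L.bil (v.projNeg z) (v.projNeg z) / (starRingEnd ℂ) (τ : ℂ)) =
      ∑ i, F.κ z i ^ 2 / frameBeta L τ i := by
  rw [F.bil_eq, F.bil_eq, Fintype.sum_sum_type, Fintype.sum_sum_type, Fintype.sum_sum_type]
  simp only [F.projPos_inl, F.projPos_inr, F.projNeg_inl, F.projNeg_inr, frameSign, frameBeta,
    Sum.elim_inl, Sum.elim_inr, mul_zero, Finset.sum_const_zero, add_zero, zero_add,
    Complex.ofReal_one, Complex.ofReal_neg, one_mul, neg_mul, Finset.sum_neg_distrib, div_neg,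
    ← Finset.sum_div, sq]
  ring

/-- The inversion formula for the theta function, up to a positive constant. -/
theorem exists_thetaZ_inversion : ∃ C : ℝ, 0 < C ∧ ∀ (τ τ' : UpperHalfPlane),
    (τ' : ℂ) = -(τ : ℂ)⁻¹ → ∀ (z : ℂ ⊗[ℚ] V) (γ : L.Disc),
    L.thetaZ v τ' ((τ : ℂ)⁻¹ • v.projPos z + ((starRingEnd ℂ) (τ : ℂ))⁻¹ • v.projNeg z) γ =
      (C * Complex.I ^ ((L.bNeg : ℤ) - L.bPos)) *
        ((τ : ℂ) ^ L.bPos * (starRingEnd ℂ) (τ : ℂ) ^ L.bNeg) *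
        expC (1 / 2 * (L.bil (v.projPos z) (v.projPos z) / τ +
          L.bil (v.projNeg z) (v.projNeg z) / (starRingEnd ℂ) (τ : ℂ))) *
        ∑ δ, (L.discPair γ δ)⁻¹ * L.thetaZ v τ z δ := by
  obtain ⟨F⟩ := exists_thetaFrame L v
  obtain ⟨G⟩ := exists_latticeFrame L
  -- As the trace form is 2∑ ε_i y_i y_i', the Euclidean dual of the lattice of coordinates of M
  -- consists of the vectors (2ε_i y_i(x)) for x ∈ M*.
  have hl : ∀ (m : Fin G.N → ℤ) (x : Fin G.N → ℝ),
      ∑ i, (2 * frameSign L i * F.y (G.D.symm m : L.dual) i) * F.latticeEquiv G x i =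
        ∑ j, (m j : ℝ) * x j := by
    intro m x
    have h1 : ∀ j, (m j : ℝ) =
        ∑ i, 2 * frameSign L i * F.y (G.b j) i * F.y (G.D.symm m : L.dual) i := by
      intro j
      have h := G.bil_b (G.D.symm m) j
      rw [F.bil_tmul, AddEquiv.apply_symm_apply] at h
      have h2 : ((m j : ℝ) : ℂ) =
          ((∑ i, 2 * frameSign L i * F.y (G.b j) i * F.y (G.D.symm m : L.dual) i : ℝ) : ℂ) := by
        push_cast
        rw [← h]
        simp only [F.κ_tmul]
      exact_mod_cast h2
    change ∑ i, (2 * frameSign L i * F.y (G.D.symm m : L.dual) i) * ∑ j, x j * F.y (G.b j) i = _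
    simp only [h1, Finset.mul_sum, Finset.sum_mul]
    rw [Finset.sum_comm]
    refine Finset.sum_congr rfl fun j _ => Finset.sum_congr rfl fun i _ => ?_
    ring
  obtain ⟨C, hC, hinv⟩ := exists_theta_inversion (F.latticeEquiv G) _ hl
  refine ⟨C * (1 / 2) ^ (L.bPos + L.bNeg), by positivity, fun τ τ' hτ z γ => ?_⟩
  obtain ⟨x₀, rfl⟩ := L.disc_surjective γ
  have hβ0 : ∀ i, frameBeta L τ i ≠ 0 := fun i h => by
    have := frameBeta_im_pos L τ i; rw [h] at this; simp at this
  set z' := (τ : ℂ)⁻¹ • v.projPos z + ((starRingEnd ℂ) (τ : ℂ))⁻¹ • v.projNeg z with hz'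
  have hκ : ∀ i, F.κ z' i = (frameSign L i : ℂ) * F.κ z i / frameBeta L τ i := by
    intro i
    rw [hz', map_add, map_smul, map_smul, Pi.add_apply, Pi.smul_apply, Pi.smul_apply]
    rcases i with i | i
    · rw [F.projPos_inl, F.projNeg_inl]
      simp only [frameSign, frameBeta, Sum.elim_inl, smul_eq_mul, Complex.ofReal_one]
      ring
    · rw [F.projPos_inr, F.projNeg_inr]
      simp only [frameSign, frameBeta, Sum.elim_inr, smul_eq_mul, Complex.ofReal_neg,
        Complex.ofReal_one]
      rw [mul_zero, zero_add, neg_one_mul, neg_div_neg_eq, inv_mul_eq_div]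
  have hsg : ∀ i, (frameSign L i : ℂ) * frameSign L i = 1 := by
    intro i
    rcases i with i | i <;> simp [frameSign]
  -- The shift of the Gaussian: z enters by completing the square, and x₀ because the sum runs over
  -- the coset x₀ + M.
  set s : FrameIndex L → ℂ := fun i => F.κ z i - F.y x₀ i with hs
  have hterm : ∀ n : Fin G.N → ℤ, L.zTerm v τ' z' (L.cosetEquiv G x₀ n : L.dual) =
      expC (∑ i, F.κ z i ^ 2 / frameBeta L τ i) *
        expC (-∑ i, ((F.latticeEquiv G (intVec n) i : ℂ) - s i) ^ 2 / frameBeta L τ i) := by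
    intro n
    rw [F.zTerm_eq, F.bil_tmul, ← expC_add, cosetEquiv_coe, ← Finset.sum_add_distrib,
      ← sub_eq_add_neg, ← Finset.sum_sub_distrib]
    congr 1
    refine Finset.sum_congr rfl fun i _ => ?_
    rw [F.latticeEquiv_intVec, F.y_add, hκ, L.frameBeta_inv hτ, hs, Pi.add_apply]
    have := hβ0 i
    push_cast
    field_simp
    linear_combination (2 * F.κ z i * (F.y (∑ j, n j • G.b j) i + F.y x₀ i)) * hsg i
  -- The dual vector of x produces the theta term of -x, because z enters the shift with a minus
  -- sign on the dual side. The sign disappears on reindexing M*.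
  have hdual : ∀ m : Fin G.N → ℤ,
      expC (∑ i, (frameBeta L τ i *
          ((2 * frameSign L i * F.y (G.D.symm m : L.dual) i : ℝ) : ℂ) ^ 2 / 4 -
        s i * (2 * frameSign L i * F.y (G.D.symm m : L.dual) i : ℝ))) =
      (L.discPair (L.disc x₀) (L.disc (-G.D.symm m)))⁻¹ *
        L.zTerm v τ z ((-G.D.symm m : L.dual) : V) := by
    intro m
    set x := G.D.symm m
    have e1 : (((-x : L.dual) : L.dual) : V) = -(x : V) := rfl
    have e2 : L.discPair (L.disc x₀) (L.disc (-x)) = expC (-L.bil (1 ⊗ₜ (x₀ : V)) (1 ⊗ₜ (x : V))) := by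
      rw [discPair_disc, ← bil_tmul, e1, TensorProduct.tmul_neg, map_neg]
    rw [e2, expC_neg, inv_inv, e1, ← L.zTerm_neg, F.zTerm_eq, map_neg, LinearMap.neg_apply, F.bil_tmul,
      F.bil_tmul, ← expC_add, ← Finset.sum_neg_distrib, ← Finset.sum_add_distrib,
      ← Finset.sum_add_distrib]
    congr 1
    refine Finset.sum_congr rfl fun i _ => ?_
    rw [F.κ_tmul, hs]
    push_cast
    linear_combination (frameBeta L τ i * (F.y x i : ℂ) ^ 2) * hsg i
  have hsum := hinv (frameBeta L τ) s (frameBeta_im_pos L τ)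
  have hL : L.thetaZ v τ' z' (L.disc x₀) = expC (∑ i, F.κ z i ^ 2 / frameBeta L τ i) *
      ∑' n, expC (-∑ i, ((F.latticeEquiv G (intVec n) i : ℂ) - s i) ^ 2 / frameBeta L τ i) := by
    rw [thetaZ, ← tsum_mul_left, ← (L.cosetEquiv G x₀).tsum_eq]
    exact tsum_congr hterm
  have hR : HasSum (fun m : Fin G.N → ℤ =>
      (L.discPair (L.disc x₀) (L.disc (-G.D.symm m)))⁻¹ *
        L.zTerm v τ z ((-G.D.symm m : L.dual) : V))
      (∑ δ, L.thetaZ v τ z δ * (L.discPair (L.disc x₀) δ)⁻¹) :=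
    (((Equiv.neg L.dual).hasSum_iff.mpr
      (L.hasSum_mul_zTerm v τ z fun δ => (L.discPair (L.disc x₀) δ)⁻¹)) |>
        G.D.symm.toEquiv.hasSum_iff.mpr)
  simp only [hdual] at hsum
  have hfin := hsum.unique (hR.mul_left _)
  rw [hL, hfin, L.bil_projPos_projNeg v F, L.prod_frameBeta_cpow]
  simp only [mul_comm (L.thetaZ v τ z _)]
  push_cast
  ring

theorem discPair_add_left (γ γ' δ : L.Disc) :
    L.discPair (γ + γ') δ = L.discPair γ δ * L.discPair γ' δ := by
  obtain ⟨x, rfl⟩ := L.disc_surjective γ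
  obtain ⟨x', rfl⟩ := L.disc_surjective γ'
  obtain ⟨y, rfl⟩ := L.disc_surjective δ
  have h : L.disc x + L.disc x' = L.disc (x + x') := (map_add _ x x').symm
  rw [h, discPair_disc, discPair_disc, discPair_disc, ← expC_add]
  congr 1
  simp only [Submodule.coe_add, L.form_add_left, L.form_add_right]
  push_cast
  ring

theorem discPair_comm (γ δ : L.Disc) : L.discPair γ δ = L.discPair δ γ := by
  obtain ⟨x, rfl⟩ := L.disc_surjective γ
  obtain ⟨y, rfl⟩ := L.disc_surjective δ
  rw [discPair_disc, discPair_disc, add_comm]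

theorem conj_discPair (γ δ : L.Disc) :
    (starRingEnd ℂ) (L.discPair γ δ) = (L.discPair γ δ)⁻¹ := by
  obtain ⟨x, rfl⟩ := L.disc_surjective γ
  obtain ⟨y, rfl⟩ := L.disc_surjective δ
  rw [discPair_disc, conj_expC, map_add, L.form_conj, L.form_conj, ← expC_neg, add_comm]

theorem discPair_ne_zero (γ δ : L.Disc) : L.discPair γ δ ≠ 0 := by
  obtain ⟨x, rfl⟩ := L.disc_surjective γ
  obtain ⟨y, rfl⟩ := L.disc_surjective δ
  exact expC_ne_zero _

theorem discPair_neg_left (γ δ : L.Disc) : L.discPair (-γ) δ = (L.discPair γ δ)⁻¹ := by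
  obtain ⟨x, rfl⟩ := L.disc_surjective γ
  obtain ⟨y, rfl⟩ := L.disc_surjective δ
  have h : -L.disc x = L.disc (-x) := (map_neg _ x).symm
  rw [h, discPair_disc, discPair_disc, ← bil_tmul, ← bil_tmul, ← expC_neg]
  change expC (L.bil (1 ⊗ₜ (-(x : V))) _) = _
  rw [TensorProduct.tmul_neg, map_neg, LinearMap.neg_apply]

theorem conj_discQuad (γ : L.Disc) :
    (starRingEnd ℂ) (L.discQuad γ) = (L.discQuad γ)⁻¹ := by
  obtain ⟨x, rfl⟩ := L.disc_surjective γ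
  rw [discQuad_disc, conj_expC, L.form_conj, ← expC_neg]

theorem discQuad_ne_zero (γ : L.Disc) : L.discQuad γ ≠ 0 := by
  obtain ⟨x, rfl⟩ := L.disc_surjective γ
  exact expC_ne_zero _

/-- Inversion is applied twice at the fixed point τ = i. On the elliptic variable the square is z ↦
-z, so the γ-component becomes the (-γ)-component, while the right-hand side becomes C² times a
double sum over D_M. Comparing coefficients of the independent theta components gives the relation.
-/
theorem sum_discPair_of_inversion {C : ℝ}
    (hC : ∀ (τ τ' : UpperHalfPlane), (τ' : ℂ) = -(τ : ℂ)⁻¹ → ∀ (z : ℂ ⊗[ℚ] V) (γ : L.Disc),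
    L.thetaZ v τ' ((τ : ℂ)⁻¹ • v.projPos z + ((starRingEnd ℂ) (τ : ℂ))⁻¹ • v.projNeg z) γ =
      (C * Complex.I ^ ((L.bNeg : ℤ) - L.bPos)) *
        ((τ : ℂ) ^ L.bPos * (starRingEnd ℂ) (τ : ℂ) ^ L.bNeg) *
        expC (1 / 2 * (L.bil (v.projPos z) (v.projPos z) / τ +
          L.bil (v.projNeg z) (v.projNeg z) / (starRingEnd ℂ) (τ : ℂ))) *
        ∑ δ, (L.discPair γ δ)⁻¹ * L.thetaZ v τ z δ) (γ ε : L.Disc) :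
    (C : ℂ) ^ 2 * ∑ δ, (L.discPair (γ + ε) δ)⁻¹ = if ε = -γ then 1 else 0 := by
  set τ : UpperHalfPlane := UpperHalfPlane.I with hτ
  have hτI : (τ : ℂ) = Complex.I := rfl
  have hI' : (τ : ℂ) = -(τ : ℂ)⁻¹ := by rw [hτI, Complex.inv_I, neg_neg]
  have hz2 : ∀ z, (τ : ℂ)⁻¹ • v.projPos ((τ : ℂ)⁻¹ • v.projPos z +
        ((starRingEnd ℂ) (τ : ℂ))⁻¹ • v.projNeg z) + ((starRingEnd ℂ) (τ : ℂ))⁻¹ •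
        v.projNeg ((τ : ℂ)⁻¹ • v.projPos z + ((starRingEnd ℂ) (τ : ℂ))⁻¹ • v.projNeg z) = -z := by
    intro z
    simp only [map_add, map_smul, v.projPos_projPos, v.projNeg_projNeg, v.projPos_projNeg,
      v.projNeg_projPos, smul_zero, add_zero, zero_add, smul_smul]
    have e1 : (τ : ℂ)⁻¹ * (τ : ℂ)⁻¹ = -1 := by rw [hτI, Complex.inv_I]; simp
    have e2 : ((starRingEnd ℂ) (τ : ℂ))⁻¹ * ((starRingEnd ℂ) (τ : ℂ))⁻¹ = -1 := by
      rw [hτI, Complex.conj_I, inv_neg, Complex.inv_I]; simp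
    rw [e1, e2, neg_one_smul, neg_one_smul, ← neg_add, v.projPos_add_projNeg]
  have key : ∀ z, L.thetaZ v τ z (-γ) =
      ∑ ε, L.thetaZ v τ z ε * ((C : ℂ) ^ 2 * ∑ δ, (L.discPair (γ + ε) δ)⁻¹) := by
    intro z
    have h := hC τ τ hI' ((τ : ℂ)⁻¹ • v.projPos z + ((starRingEnd ℂ) (τ : ℂ))⁻¹ • v.projNeg z) γ
    rw [hz2, L.thetaZ_neg] at h
    rw [h]
    simp only [fun δ => hC τ τ hI' z δ]
    simp only [map_add, map_smul, v.projPos_projPos, v.projNeg_projNeg, v.projPos_projNeg,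
      v.projNeg_projPos, smul_zero, add_zero, zero_add, LinearMap.smul_apply, smul_eq_mul]
    set E := L.bil (v.projPos z) (v.projPos z)
    set E' := L.bil (v.projNeg z) (v.projNeg z)
    -- At τ = i this is (-1)^(b₋ - b₊) · (-1)^(b₊ + b₋) = 1; the two exponential factors cancel as
    -- well.
    have hpre : (Complex.I ^ ((L.bNeg : ℤ) - L.bPos)) ^ 2 *
        ((τ : ℂ) ^ L.bPos * (starRingEnd ℂ) (τ : ℂ) ^ L.bNeg) ^ 2 = 1 := by
      have h2 : Complex.I ^ (L.bPos * 2) ≠ 0 := pow_ne_zero _ Complex.I_ne_zero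
      rw [hτI, Complex.conj_I, mul_pow, zpow_sub₀ Complex.I_ne_zero, zpow_natCast, zpow_natCast,
        div_pow, ← pow_mul, ← pow_mul, ← pow_mul, mul_comm L.bNeg 2, pow_mul (-Complex.I),
        neg_sq, ← pow_mul, ← mul_assoc, div_mul_cancel₀ _ h2, pow_mul, ← mul_pow]
      simp
    have hexp : expC (1 / 2 * (E / τ + E' / (starRingEnd ℂ) (τ : ℂ))) *
        expC (1 / 2 * ((τ : ℂ)⁻¹ * ((τ : ℂ)⁻¹ * E) / τ + ((starRingEnd ℂ) (τ : ℂ))⁻¹ *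
          (((starRingEnd ℂ) (τ : ℂ))⁻¹ * E') / (starRingEnd ℂ) (τ : ℂ))) = 1 := by
      rw [← expC_add]
      refine (congrArg expC ?_).trans expC_zero
      rw [hτI, Complex.conj_I]
      simp only [div_eq_mul_inv, inv_neg, Complex.inv_I]
      linear_combination (1 / 2) * Complex.I * (E' - E) * Complex.I_sq
    generalize expC (1 / 2 * (E / τ + E' / (starRingEnd ℂ) (τ : ℂ))) = e₁ at hexp ⊢
    generalize expC (1 / 2 * ((τ : ℂ)⁻¹ * ((τ : ℂ)⁻¹ * E) / τ + ((starRingEnd ℂ) (τ : ℂ))⁻¹ *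
          (((starRingEnd ℂ) (τ : ℂ))⁻¹ * E') / (starRingEnd ℂ) (τ : ℂ))) = e₂ at hexp ⊢
    generalize Complex.I ^ ((L.bNeg : ℤ) - L.bPos) = a at hpre ⊢
    generalize (τ : ℂ) ^ L.bPos * (starRingEnd ℂ) (τ : ℂ) ^ L.bNeg = t at hpre ⊢
    simp only [Finset.mul_sum]
    rw [Finset.sum_comm]
    refine Finset.sum_congr rfl fun ε _ => Finset.sum_congr rfl fun δ _ => ?_
    rw [L.discPair_add_left, mul_inv, L.discPair_comm ε δ]
    generalize L.discPair γ δ = b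
    generalize L.discPair δ ε = b'
    linear_combination (C ^ 2 * b⁻¹ * b'⁻¹ * L.thetaZ v τ z ε) * (e₁ * e₂ * hpre + hexp)
  have h1 := L.thetaZ_independent v (τ := τ) (a := fun ε => if ε = -γ then 1 else 0)
    (b := fun ε => (C : ℂ) ^ 2 * ∑ δ, (L.discPair (γ + ε) δ)⁻¹) (fun z => by
      rw [← key]
      simp)
  exact (congrFun h1 ε).symm

/-- The matrix of the inversion `S` in the Weil representation. -/
def weilS : Matrix L.Disc L.Disc ℂ :=
  Matrix.of fun δ γ => Complex.I ^ ((L.bNeg : ℤ) - L.bPos) / (Real.sqrt (Nat.card L.Disc) : ℂ) *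
    (L.discPair γ δ)⁻¹

/-- The inversion formula for the theta function. -/
theorem thetaZ_inversion : (∀ (τ τ' : UpperHalfPlane),
    (τ' : ℂ) = -(τ : ℂ)⁻¹ → ∀ (z : ℂ ⊗[ℚ] V),
    L.thetaZ v τ' ((τ : ℂ)⁻¹ • v.projPos z + ((starRingEnd ℂ) (τ : ℂ))⁻¹ • v.projNeg z) =
      ((τ : ℂ) ^ L.bPos * (starRingEnd ℂ) (τ : ℂ) ^ L.bNeg *
        expC (1 / 2 * (L.bil (v.projPos z) (v.projPos z) / τ +
          L.bil (v.projNeg z) (v.projNeg z) / (starRingEnd ℂ) (τ : ℂ)))) •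
        L.weilS.mulVec (L.thetaZ v τ z)) ∧ L.weilS * L.weilS.conjTranspose = 1 := by
  obtain ⟨C, hC, h⟩ := L.exists_thetaZ_inversion v
  have horth := L.sum_discPair_of_inversion v h
  have h0 : ∀ δ, L.discPair 0 δ = 1 := fun δ => by
    have := L.discPair_add_left 0 0 δ
    rw [add_zero] at this
    exact (left_eq_mul₀ (L.discPair_ne_zero 0 δ)).mp this
  -- The relation at γ = ε = 0. Together with C > 0 it determines C.
  have hcard : C ^ 2 * Nat.card L.Disc = 1 := by
    have h1 := horth 0 0
    rw [add_zero, neg_zero, if_pos rfl] at h1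
    simp only [h0, inv_one, Finset.sum_const, Finset.card_univ, nsmul_eq_mul, mul_one] at h1
    rw [← Nat.card_eq_fintype_card] at h1
    exact_mod_cast h1
  have hCs : C = 1 / Real.sqrt (Nat.card L.Disc) := by
    have h2 : (C * Real.sqrt (Nat.card L.Disc)) ^ 2 = 1 := by
      rw [mul_pow, Real.sq_sqrt (Nat.cast_nonneg _), hcard]
    have h3 : 0 ≤ C * Real.sqrt (Nat.card L.Disc) := by positivity
    have h4 : C * Real.sqrt (Nat.card L.Disc) = 1 := by nlinarith
    exact eq_one_div_of_mul_eq_one_left h4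
  have hS : L.weilS = Matrix.of fun δ γ => (C : ℂ) * Complex.I ^ ((L.bNeg : ℤ) - L.bPos) *
      (L.discPair γ δ)⁻¹ := by
    ext δ γ
    rw [weilS, Matrix.of_apply, Matrix.of_apply, hCs]
    push_cast
    ring
  refine ⟨fun τ τ' hτ z => ?_, ?_⟩
  · funext γ
    rw [h τ τ' hτ z γ, hS, Pi.smul_apply, smul_eq_mul, Matrix.mulVec, dotProduct]
    simp only [Matrix.of_apply, Finset.mul_sum]
    refine Finset.sum_congr rfl fun δ _ => ?_
    rw [L.discPair_comm δ γ]
    ring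
  · ext γ ε
    -- The same relation for (γ, -ε) is the orthogonality of two rows of the matrix of S.
    have h1 : (C : ℂ) ^ 2 * ∑ δ, (L.discPair (γ + -ε) δ)⁻¹ = if γ = ε then 1 else 0 :=
      (horth γ (-ε)).trans (if_congr (neg_inj.trans eq_comm) rfl rfl)
    rw [Matrix.mul_apply, Matrix.one_apply, ← h1, Finset.mul_sum]
    refine Finset.sum_congr rfl fun δ _ => ?_
    have hI : (starRingEnd ℂ) (Complex.I ^ ((L.bNeg : ℤ) - L.bPos)) *
        Complex.I ^ ((L.bNeg : ℤ) - L.bPos) = 1 := by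
      rw [map_zpow₀, Complex.conj_I, ← mul_zpow]
      simp
    rw [hS, Matrix.conjTranspose_apply, Matrix.of_apply, Matrix.of_apply, Complex.star_def, map_mul,
      map_mul, map_inv₀, L.conj_discPair, Complex.conj_ofReal, inv_inv, L.discPair_add_left,
      L.discPair_neg_left, L.discPair_comm δ γ, L.discPair_comm δ ε, mul_inv, inv_inv]
    linear_combination (C ^ 2 * (L.discPair γ δ)⁻¹ * L.discPair ε δ) * hI

end EvenLattice

/-! ### Arithmetic of the order, and U(1,1)(ℤ) as roots of unity times SL₂(ℤ) -/

section Order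

variable (d) in
theorem exists_normForm : ∃ n : ℤ, (d : ℤ) * d + d = 4 * n := by
  have h4 : (d * (d + 1)) % 4 = 0 := by
    rcases hd.mod_four with h | h <;> simp [Nat.mul_mod, Nat.add_mod, h]
  obtain ⟨k, hk⟩ := Nat.dvd_of_mod_eq_zero h4
  refine ⟨k, ?_⟩
  have : ((d * (d + 1) : ℕ) : ℤ) = ((4 * k : ℕ) : ℤ) := congrArg _ hk
  push_cast at this
  linarith

theorem normSq_add_mul (a b : ℤ) : ((a : ℂ) + b * ((d + sqrtNeg d) / 2)) *
    (starRingEnd ℂ) ((a : ℂ) + b * ((d + sqrtNeg d) / 2)) =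
      a ^ 2 + a * b * d + b ^ 2 * (((d : ℂ) * d + d) / 4) := by
  simp only [map_add, map_mul, map_div₀, map_intCast, map_natCast, conj_sqrtNeg, map_ofNat]
  linear_combination (-(b : ℂ) ^ 2 / 4) * sqrtNeg_mul_self d

/-- Elements of the order with real quotients are integer multiples of a common element. -/
theorem exists_common_factor {κ : Type*} (x : κ → quadOrder d) (k : κ) (hk : x k ≠ 0)
    (h : ∀ i j, embO d (x i) * (starRingEnd ℂ) (embO d (x j)) =
      (starRingEnd ℂ) (embO d (x i)) * embO d (x j)) :
    ∃ (x₀ : quadOrder d) (t : κ → ℤ), ∀ i, x i = t i * x₀ := by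
  choose a b hab using fun i => (x i).2
  have hs := sqrtNeg_ne_zero d
  have hab' : ∀ i, embO d (x i) = a i + b i * ((d + sqrtNeg d) / 2) := hab
  -- Real quotients mean proportional coordinate vectors (a_i, b_i).
  have hprop : ∀ i j, a i * b j = a j * b i := by
    intro i j
    have h1 := h i j
    rw [hab', hab'] at h1
    simp only [map_add, map_mul, map_div₀, map_intCast, map_natCast, conj_sqrtNeg, map_ofNat] at h1
    have h2 : sqrtNeg d * ((a i : ℂ) * b j - a j * b i) = 0 := by linear_combination -h1
    have h3 := (mul_eq_zero.mp h2).resolve_left hs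
    exact_mod_cast sub_eq_zero.mp h3
  have hne : ¬(a k = 0 ∧ b k = 0) := by
    rintro ⟨h1, h2⟩
    apply hk
    apply Subtype.ext
    apply Subtype.ext
    rw [hab, h1, h2]
    simp
  have hgcd : 0 < Int.gcd (a k) (b k) := by
    rw [Nat.pos_iff_ne_zero, Ne, Int.gcd_eq_zero_iff]
    exact hne
  -- (p, q) is the primitive integral vector on the common line. The Bézout relation for it recovers
  -- each multiple as t_i = r·a_i + s·b_i.
  obtain ⟨p, q, hpq, hp, hq⟩ := Int.exists_gcd_one hgcd
  obtain ⟨r, s, hrs⟩ := Int.isCoprime_iff_gcd_eq_one.mpr hpq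
  have hg : (Int.gcd (a k) (b k) : ℤ) ≠ 0 := by exact_mod_cast hgcd.ne'
  have hpq' : ∀ i, a i * q = p * b i := by
    intro i
    apply mul_right_cancel₀ hg
    have h1 := hprop i k
    linear_combination h1 - a i * hq + b i * hp
  refine ⟨⟨⟨(p : ℂ) + q * ((d + sqrtNeg d) / 2), ?_⟩, p, q, rfl⟩, fun i => r * a i + s * b i, ?_⟩
  · have hsq := (sqrtK d).2
    refine add_mem (intCast_mem _ p) (mul_mem (intCast_mem _ q) (div_mem (add_mem (natCast_mem _ d) hsq)
      (ofNat_mem _ 2)))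
  · intro i
    apply Subtype.ext
    apply Subtype.ext
    rw [hab]
    push_cast
    have e1 : (p : ℂ) * (r * a i + s * b i) = a i := by
      have : p * (r * a i + s * b i) = a i := by
        linear_combination (-s) * hpq' i + a i * hrs
      exact_mod_cast this
    have e2 : (q : ℂ) * (r * a i + s * b i) = b i := by
      have : q * (r * a i + s * b i) = b i := by
        linear_combination r * hpq' i + b i * hrs
      exact_mod_cast this
    linear_combination -e1 - ((d + sqrtNeg d) / 2) * e2

/-- The conjugate of an element of the order. -/
theorem exists_conj_mem (x : quadOrder d) :
    ∃ y : quadOrder d, embO d y = (starRingEnd ℂ) (embO d x) := by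
  obtain ⟨a, b, h⟩ := x.2
  have h' : embO d x = a + b * ((d + sqrtNeg d) / 2) := h
  have e : (starRingEnd ℂ) (embO d x) = ((2 * a + b * d : ℤ) : ℂ) - embO d x := by
    rw [h']
    simp only [map_add, map_mul, map_div₀, map_intCast, map_natCast, conj_sqrtNeg, map_ofNat]
    push_cast
    ring
  exact ⟨((2 * a + b * d : ℤ) : quadOrder d) - x, by rw [map_sub, map_intCast, e]⟩

theorem embO_injective : Function.Injective (embO d) :=
  fun _ _ h => Subtype.ext (Subtype.ext h)

/-- The norm of an element of the order is an integer. -/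
theorem exists_norm_eq_int (x : quadOrder d) :
    ∃ n : ℤ, embO d x * (starRingEnd ℂ) (embO d x) = n := by
  obtain ⟨a, b, h⟩ := x.2
  obtain ⟨n, hn⟩ := exists_normForm d
  have hn' : (d : ℂ) * d + d = 4 * n := by exact_mod_cast hn
  refine ⟨a ^ 2 + a * b * d + b ^ 2 * n, ?_⟩
  have h' : embO d x = a + b * ((d + sqrtNeg d) / 2) := h
  rw [h', normSq_add_mul, hn']
  push_cast
  ring

/-- In coordinates, norm one reads (2a + bd)² + d·b² = 4, which bounds a and b. -/
theorem finite_norm_one :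
    {x : quadOrder d | embO d x * (starRingEnd ℂ) (embO d x) = 1}.Finite := by
  let f : ℤ × ℤ → ℂ := fun p => (p.1 : ℂ) + p.2 * ((d + sqrtNeg d) / 2)
  have hfin : ((f '' (Set.Icc (-(2 * d + 2) : ℤ) (2 * d + 2) ×ˢ Set.Icc (-2 : ℤ) 2))).Finite :=
    ((Set.finite_Icc _ _).prod (Set.finite_Icc _ _)).image f
  refine Set.Finite.of_finite_image (f := embO d) (hfin.subset ?_) embO_injective.injOn
  rintro _ ⟨x, hx, rfl⟩
  obtain ⟨a, b, h⟩ := x.2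
  have h' : embO d x = a + b * ((d + sqrtNeg d) / 2) := h
  refine ⟨(a, b), ?_, h'.symm⟩
  rw [Set.mem_ofPred_eq, h', normSq_add_mul] at hx
  have h1 : 4 * a ^ 2 + 4 * (a * b * d) + b ^ 2 * ((d : ℤ) * d + d) = 4 := by
    have : (4 : ℂ) * a ^ 2 + 4 * (a * b * d) + b ^ 2 * ((d : ℂ) * d + d) = 4 := by
      linear_combination 4 * hx
    exact_mod_cast this
  have hd1 : (1 : ℤ) ≤ d := by exact_mod_cast hd.pos
  have h2 : (2 * a + b * d) ^ 2 + b ^ 2 * d = 4 := by linear_combination h1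
  have hb : b ^ 2 ≤ 4 := by nlinarith [sq_nonneg (2 * a + b * d), sq_nonneg b]
  have hb1 : -2 ≤ b := by nlinarith
  have hb2 : b ≤ 2 := by nlinarith
  have hc : (2 * a + b * d) ^ 2 ≤ 4 := by nlinarith [mul_nonneg (sq_nonneg b) (by linarith : (0:ℤ) ≤ d)]
  have hc1 : -2 ≤ 2 * a + b * d := by nlinarith
  have hc2 : 2 * a + b * d ≤ 2 := by nlinarith
  have hbd1 : -(2 * d) ≤ b * d := by nlinarith
  have hbd2 : b * d ≤ 2 * d := by nlinarith
  exact ⟨⟨by linarith, by linarith⟩, hb1, hb2⟩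

/-- All powers of ξ have norm one, and there are only finitely many such elements. -/
theorem isOfFinOrder_of_norm_one (ξ : (quadOrder d)ˣ)
    (h : embO d ξ * (starRingEnd ℂ) (embO d ξ) = 1) : IsOfFinOrder ξ := by
  by_contra hn
  have hinj := injective_pow_iff_not_isOfFinOrder.mpr hn
  have hinj2 : Function.Injective fun n : ℕ => ((ξ ^ n : (quadOrder d)ˣ) : quadOrder d) :=
    Units.val_injective.comp hinj
  refine Set.infinite_range_of_injective hinj2 (finite_norm_one.subset ?_)
  rintro _ ⟨n, rfl⟩
  rw [Set.mem_ofPred_eq]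
  simp only [Units.val_pow_eq_pow_val, map_pow]
  rw [← mul_pow, h, one_pow]

theorem norm_one_of_isOfFinOrder {ξ : (quadOrder d)ˣ} (h : IsOfFinOrder ξ) :
    embO d ξ * (starRingEnd ℂ) (embO d ξ) = 1 := by
  obtain ⟨n, hn, h1⟩ := isOfFinOrder_iff_pow_eq_one.mp h
  have h2 : embO d ξ ^ n = 1 := by
    rw [← map_pow, ← Units.val_pow_eq_pow_val, h1, Units.val_one, map_one]
  have h3 : ‖embO d ξ‖ = 1 := Complex.norm_eq_one_of_pow_eq_one h2 hn.ne'
  rw [Complex.mul_conj, Complex.normSq_eq_norm_sq, h3]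
  simp

theorem mapGL_apply (B : SL(2, ℤ)) (i j : Fin 2) :
    ((Matrix.SpecialLinearGroup.mapGL (quadOrder d) B : GL (Fin 2) (quadOrder d)) :
      Matrix (Fin 2) (Fin 2) (quadOrder d)) i j = (B i j : ℤ) := by
  simp [Matrix.SpecialLinearGroup.mapGL_coe_matrix]

theorem scalar_mul_apply (ξ : (quadOrder d)ˣ) (M : Matrix (Fin 2) (Fin 2) (quadOrder d))
    (i j : Fin 2) :
    ((Matrix.GeneralLinearGroup.scalar (Fin 2) ξ : GL (Fin 2) (quadOrder d)) * M :
      Matrix (Fin 2) (Fin 2) (quadOrder d)) i j = ξ * M i j := by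
  simp [Matrix.GeneralLinearGroup.scalar]

/-- Every element of `U(1,1)(ℤ)` is the product of a root of unity and an element of `SL₂(ℤ)`. -/
theorem exists_eq_scalar_mul (A : unitaryZ d) : ∃ (ξ : (quadOrder d)ˣ) (B : SL(2, ℤ)),
    IsOfFinOrder ξ ∧ (A : GL (Fin 2) (quadOrder d)) =
      Matrix.GeneralLinearGroup.scalar (Fin 2) ξ *
        Matrix.SpecialLinearGroup.mapGL (quadOrder d) B := by
  set σ := starRingEnd ℂ with hσ
  have hA : (Matrix.of fun i j => entry A i j) * matJ *
      (Matrix.of fun i j => entry A i j).conjTranspose = matJ := A.2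
  have h00 := congrFun (congrFun hA 0) 0
  have h01 := congrFun (congrFun hA 0) 1
  have h10 := congrFun (congrFun hA 1) 0
  have h11 := congrFun (congrFun hA 1) 1
  simp [matJ, Matrix.mul_apply, Fin.sum_univ_two] at h00 h01 h10 h11
  rw [← hσ] at h00 h01 h10 h11
  set u := entry A 0 0 * entry A 1 1 - entry A 0 1 * entry A 1 0 with hu
  -- Comparing A J A* = J with A J Aᵗ = det(A) J gives A = det(A)·Ā. Hence all entries of A have the
  -- same argument up to sign, and they are integral multiples of one element x₀ of the order.
  have hconj : ∀ p : Fin 2 × Fin 2, entry A p.1 p.2 = u * σ (entry A p.1 p.2) := by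
    rintro ⟨i, j⟩
    fin_cases i <;> fin_cases j <;> simp only [Fin.zero_eta, Fin.mk_one, hu]
    · linear_combination entry A 1 0 * h00 - entry A 0 0 * h10
    · linear_combination entry A 1 1 * h00 - entry A 0 1 * h10
    · linear_combination entry A 1 0 * h01 - entry A 0 0 * h11
    · linear_combination entry A 1 1 * h01 - entry A 0 1 * h11
  have hk : ∃ k : Fin 2 × Fin 2, (A : GL (Fin 2) (quadOrder d)) k.1 k.2 ≠ 0 := by
    by_contra hcon
    push Not at hcon
    have e : ∀ i j, entry A i j = 0 := fun i j => by
      rw [entry, hcon (i, j), map_zero]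
    simp [e] at h01
  obtain ⟨k, hk⟩ := hk
  obtain ⟨x₀, t, ht⟩ := exists_common_factor
    (fun p : Fin 2 × Fin 2 => (A : GL (Fin 2) (quadOrder d)) p.1 p.2) k hk (fun p q => by
      have h1 := hconj p
      have h2 := hconj q
      change entry A p.1 p.2 * σ (entry A q.1 q.2) = σ (entry A p.1 p.2) * entry A q.1 q.2
      rw [h2, map_mul]
      nth_rewrite 1 [h1]
      have h3 := congrArg σ h2
      rw [map_mul, hσ, Complex.conj_conj, ← hσ] at h3
      rw [hσ, Complex.conj_conj, ← hσ]
      linear_combination (-(u * σ (entry A p.1 p.2))) * h3)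
  obtain ⟨n, hn⟩ := exists_norm_eq_int x₀
  have hent : ∀ i j, entry A i j = t (i, j) * embO d x₀ := fun i j => by
    have := congrArg (embO d) (ht (i, j))
    rw [map_mul, map_intCast] at this
    exact this
  -- Unitarity now says that the norm n of x₀ times an integral determinant is 1. As n ≥ 0, both are
  -- 1, so x₀ is a root of unity and the cofactor lies in SL₂(ℤ).
  have hdet : n * (t (0, 0) * t (1, 1) - t (0, 1) * t (1, 0)) = 1 := by
    have : (n : ℂ) * (t (0, 0) * t (1, 1) - t (0, 1) * t (1, 0)) = 1 := by
      rw [← hn, ← hσ]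
      simp only [hent, map_mul, map_intCast] at h01
      simp only [hσ] at h01 ⊢
      linear_combination -h01
    exact_mod_cast this
  have hn0 : 0 ≤ n := by
    have : (n : ℂ) = ((Complex.normSq (embO d x₀) : ℝ) : ℂ) := by rw [← hn, Complex.mul_conj]
    have h2 : (n : ℝ) = Complex.normSq (embO d x₀) := by exact_mod_cast this
    have h3 := Complex.normSq_nonneg (embO d x₀)
    rw [← h2] at h3
    exact_mod_cast h3
  have hn1 : n = 1 := by
    rcases Int.isUnit_iff.mp (IsUnit.of_mul_eq_one _ hdet) with h | h
    · exact h
    · omega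
  rw [hn1, one_mul] at hdet
  rw [hn1, Int.cast_one] at hn
  obtain ⟨y₀, hy₀⟩ := exists_conj_mem x₀
  have hxy : x₀ * y₀ = 1 := embO_injective (by rw [map_mul, hy₀, hn, map_one])
  let ξ : (quadOrder d)ˣ := ⟨x₀, y₀, hxy, by rw [mul_comm, hxy]⟩
  obtain ⟨B, hB⟩ : ∃ B : SL(2, ℤ), ∀ i j, B i j = t (i, j) :=
    ⟨⟨!![t (0, 0), t (0, 1); t (1, 0), t (1, 1)], by rw [Matrix.det_fin_two_of, hdet]⟩, fun i j => by
      fin_cases i <;> fin_cases j <;> rfl⟩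
  refine ⟨ξ, B, isOfFinOrder_of_norm_one ξ hn, ?_⟩
  apply Units.ext
  ext i j
  have e := ht (i, j)
  simp only at e
  rw [e, Units.val_mul]
  rw [scalar_mul_apply, mapGL_apply, hB, mul_comm]

/-- The group `SL₂(ℤ)` is generated by `S` and `T` as a monoid. -/
theorem submonoid_closure_S_T :
    Submonoid.closure ({ModularGroup.S, ModularGroup.T} : Set SL(2, ℤ)) = ⊤ := by
  set H := Submonoid.closure ({ModularGroup.S, ModularGroup.T} : Set SL(2, ℤ)) with hH
  have hS : ModularGroup.S ∈ H := Submonoid.subset_closure (by simp)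
  have hT : ModularGroup.T ∈ H := Submonoid.subset_closure (by simp)
  have hS' : ModularGroup.S⁻¹ ∈ H := by
    have : ModularGroup.S⁻¹ = ModularGroup.S ^ 3 := by
      rw [inv_eq_iff_mul_eq_one]
      ext i j
      fin_cases i <;> fin_cases j <;> decide
    rw [this]
    exact pow_mem hS 3
  have hT' : ModularGroup.T⁻¹ ∈ H := by
    -- This is the relation (ST)⁶ = 1.
    have : ModularGroup.T⁻¹ = (ModularGroup.S * ModularGroup.T) ^ 5 * ModularGroup.S := by
      rw [inv_eq_iff_mul_eq_one]
      ext i j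
      fin_cases i <;> fin_cases j <;> decide
    rw [this]
    exact mul_mem (pow_mem (mul_mem hS hT) 5) hS
  have h1 := Subgroup.closure_toSubmonoid ({ModularGroup.S, ModularGroup.T} : Set SL(2, ℤ))
  rw [SpecialLinearGroup.SL2Z_generators, Subgroup.top_toSubmonoid] at h1
  rw [eq_top_iff, h1, Submonoid.closure_le]
  rintro x (hx | hx)
  · exact Submonoid.subset_closure hx
  · rcases hx with hx | hx
    · rw [inv_eq_iff_eq_inv] at hx
      rw [hx]; exact hS'
    · have hx' : x⁻¹ = ModularGroup.T := hx
      rw [inv_eq_iff_eq_inv] at hx'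
      rw [hx']; exact hT'

end Order

/-- The automorphy factor `cτ + e` of an element of `SL₂(ℤ)`. -/
def slj (B : SL(2, ℤ)) (τ : UpperHalfPlane) : ℂ := (B 1 0 : ℤ) * τ + (B 1 1 : ℤ)

theorem slj_ne_zero (B : SL(2, ℤ)) (τ : UpperHalfPlane) : slj B τ ≠ 0 := by
  intro h
  have him : ((B 1 0 : ℤ) : ℝ) * (τ : ℂ).im = 0 := by
    have := congrArg Complex.im h
    simpa [slj] using this
  have h10 : B 1 0 = 0 := by
    have := (mul_eq_zero.mp him).resolve_right τ.im_pos.ne'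
    exact_mod_cast this
  have h11 : B 1 1 = 0 := by
    rw [slj, h10] at h
    simpa using h
  have hdet := B.det_coe
  rw [Matrix.det_fin_two, h10, h11] at hdet
  simp at hdet

theorem coe_sl_smul (B : SL(2, ℤ)) (τ : UpperHalfPlane) :
    ((B • τ : UpperHalfPlane) : ℂ) = ((B 0 0 : ℤ) * τ + (B 0 1 : ℤ)) / slj B τ := by
  rw [UpperHalfPlane.coe_specialLinearGroup_apply]
  simp [slj]

theorem slj_mul (B₁ B₂ : SL(2, ℤ)) (τ : UpperHalfPlane) :
    slj (B₁ * B₂) τ = slj B₁ (B₂ • τ) * slj B₂ τ := by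
  have h := slj_ne_zero B₂ τ
  rw [slj, slj, coe_sl_smul, add_mul, ← mul_div_assoc, div_mul_cancel₀ _ h, slj]
  simp only [Matrix.SpecialLinearGroup.coe_mul, Matrix.mul_apply, Fin.sum_univ_two]
  push_cast
  ring

/-- Divided by j₁j₂², this is c₁/(j₁j₂²) + c₂/j₂ = c₁₂/(j₁j₂), the additivity of the exponent in the
automorphy factor. -/
theorem slj_cocycle (B₁ B₂ : SL(2, ℤ)) (τ : UpperHalfPlane) :
    ((B₁ 1 0 : ℤ) : ℂ) + (B₂ 1 0 : ℤ) * (slj B₁ (B₂ • τ) * slj B₂ τ) =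
      ((B₁ * B₂) 1 0 : ℤ) * slj B₂ τ := by
  rw [← slj_mul, slj, slj]
  have hdet : ((B₂ 0 0 : ℤ) : ℂ) * (B₂ 1 1 : ℤ) - (B₂ 0 1 : ℤ) * (B₂ 1 0 : ℤ) = 1 := by
    have := B₂.det_coe
    rw [Matrix.det_fin_two] at this
    exact_mod_cast this
  simp only [Matrix.SpecialLinearGroup.coe_mul, Matrix.mul_apply, Fin.sum_univ_two]
  push_cast
  linear_combination -((B₁ 1 0 : ℤ) : ℂ) * hdet

/-! ### The theta transformation law under U(1,1)(ℤ) -/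

namespace EvenLattice

variable (L : EvenLattice d V) (v : GrJ L)

/-- The action of `SL₂(ℤ)` on the elliptic variable. -/
def slZ {L : EvenLattice d V} (v : GrJ L) (B : SL(2, ℤ)) (τ : UpperHalfPlane) (z : ℂ ⊗[ℚ] V) :
    ℂ ⊗[ℚ] V :=
  (slj B τ)⁻¹ • v.projPos z + ((starRingEnd ℂ) (slj B τ))⁻¹ • v.projNeg z

/-- The automorphy factor of the theta function under `SL₂(ℤ)`. -/
def slFactor (B : SL(2, ℤ)) (τ : UpperHalfPlane) (z : ℂ ⊗[ℚ] V) : ℂ :=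
  slj B τ ^ L.bPos * (starRingEnd ℂ) (slj B τ) ^ L.bNeg *
    expC (1 / 2 * ((B 1 0 : ℤ) * L.bil (v.projPos z) (v.projPos z) / slj B τ +
      (B 1 0 : ℤ) * L.bil (v.projNeg z) (v.projNeg z) / (starRingEnd ℂ) (slj B τ)))

/-- The theta function transforms under `ξB` by the matrix `R`. -/
def TransformsBy (ξ : (quadOrder d)ˣ) (B : SL(2, ℤ)) (R : Matrix L.Disc L.Disc ℂ) : Prop :=
  ∀ (τ : UpperHalfPlane) (z : ℂ ⊗[ℚ] V),
    L.thetaZ v (B • τ) (actK d V ((ξ⁻¹ : (quadOrder d)ˣ) : quadOrder d) (slZ v B τ z)) =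
      (embO d ξ ^ ((L.bPos : ℤ) - L.bNeg) * L.slFactor v B τ z) • R.mulVec (L.thetaZ v τ z)

theorem projPos_slZ (B : SL(2, ℤ)) (τ : UpperHalfPlane) (z : ℂ ⊗[ℚ] V) :
    v.projPos (slZ v B τ z) = (slj B τ)⁻¹ • v.projPos z := by
  rw [slZ, map_add, map_smul, map_smul, v.projPos_projPos, v.projPos_projNeg, smul_zero, add_zero]

theorem projNeg_slZ (B : SL(2, ℤ)) (τ : UpperHalfPlane) (z : ℂ ⊗[ℚ] V) :
    v.projNeg (slZ v B τ z) = ((starRingEnd ℂ) (slj B τ))⁻¹ • v.projNeg z := by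
  rw [slZ, map_add, map_smul, map_smul, v.projNeg_projPos, v.projNeg_projNeg, smul_zero, zero_add]

/-- The cocycle property of the automorphy factor. The scalar c of norm one has no effect, since it
is an isometry commuting with the projections. -/
theorem slFactor_mul (c : QuadField d) (hc : (c : ℂ) * (starRingEnd ℂ) (c : ℂ) = 1)
    (B₁ B₂ : SL(2, ℤ)) (τ : UpperHalfPlane) (z : ℂ ⊗[ℚ] V) :
    L.slFactor v (B₁ * B₂) τ z =
      L.slFactor v B₁ (B₂ • τ) (actK d V c (slZ v B₂ τ z)) * L.slFactor v B₂ τ z := by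
  have h1 := slj_ne_zero B₁ (B₂ • τ)
  have h2 := slj_ne_zero B₂ τ
  have h1' : (starRingEnd ℂ) (slj B₁ (B₂ • τ)) ≠ 0 := (map_ne_zero _).mpr h1
  have h2' : (starRingEnd ℂ) (slj B₂ τ) ≠ 0 := (map_ne_zero _).mpr h2
  have h3 := slj_cocycle B₁ B₂ τ
  have h3' := congrArg (starRingEnd ℂ) h3
  simp only [map_add, map_mul, map_intCast] at h3'
  rw [slFactor, slFactor, slFactor, v.projPos_actK, v.projNeg_actK, L.bil_actK c hc,
    L.bil_actK c hc, projPos_slZ, projNeg_slZ, slj_mul, map_mul]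
  generalize slj B₁ (B₂ • τ) = j₁ at *
  generalize slj B₂ τ = j₂ at *
  generalize (starRingEnd ℂ) j₁ = j₁' at *
  generalize (starRingEnd ℂ) j₂ = j₂' at *
  generalize ((B₁ 1 0 : ℤ) : ℂ) = c₁ at *
  generalize ((B₂ 1 0 : ℤ) : ℂ) = c₂ at *
  generalize (((B₁ * B₂) 1 0 : ℤ) : ℂ) = c₁₂ at *
  simp only [map_smul, LinearMap.smul_apply, smul_eq_mul]
  generalize L.bil (v.projPos z) (v.projPos z) = p
  generalize L.bil (v.projNeg z) (v.projNeg z) = n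
  have e : 1 / 2 * (c₁₂ * p / (j₁ * j₂) + c₁₂ * n / (j₁' * j₂')) =
      1 / 2 * (c₁ * (j₂⁻¹ * (j₂⁻¹ * p)) / j₁ + c₁ * (j₂'⁻¹ * (j₂'⁻¹ * n)) / j₁') +
        1 / 2 * (c₂ * p / j₂ + c₂ * n / j₂') := by
    have e1 : c₁₂ * p / (j₁ * j₂) = c₁ * (j₂⁻¹ * (j₂⁻¹ * p)) / j₁ + c₂ * p / j₂ := by
      field_simp
      linear_combination -p * h3
    have e2 : c₁₂ * n / (j₁' * j₂') = c₁ * (j₂'⁻¹ * (j₂'⁻¹ * n)) / j₁' + c₂ * n / j₂' := by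
      field_simp
      linear_combination -n * h3'
    rw [e1, e2]
    ring
  rw [e, expC_add, mul_pow, mul_pow]
  ring

/-- The action on z is a group action and the factor is a cocycle, so the laws of two elements
compose. This reduces the law to the generators. -/
theorem TransformsBy.mul {L : EvenLattice d V} {v : GrJ L} {ξ₁ ξ₂ : (quadOrder d)ˣ}
    {B₁ B₂ : SL(2, ℤ)} {R₁ R₂ : Matrix L.Disc L.Disc ℂ}
    (hξ₂ : embO d ξ₂ * (starRingEnd ℂ) (embO d ξ₂) = 1)
    (h₁ : L.TransformsBy v ξ₁ B₁ R₁) (h₂ : L.TransformsBy v ξ₂ B₂ R₂) :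
    L.TransformsBy v (ξ₁ * ξ₂) (B₁ * B₂) (R₁ * R₂) := by
  intro τ z
  set c : QuadField d := (((ξ₂⁻¹ : (quadOrder d)ˣ) : quadOrder d) : QuadField d) with hcdef
  have hc : (c : ℂ) * (starRingEnd ℂ) (c : ℂ) = 1 := by
    have e1 : embO d ξ₂ * (c : ℂ) = 1 := by
      change embO d ξ₂ * embO d ((ξ₂⁻¹ : (quadOrder d)ˣ) : quadOrder d) = 1
      rw [← map_mul, Units.mul_inv, map_one]
    have e2 := congrArg (starRingEnd ℂ) e1
    rw [map_mul, map_one] at e2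
    linear_combination (-((c : ℂ) * (starRingEnd ℂ) (c : ℂ))) * hξ₂ +
      ((starRingEnd ℂ) (embO d ξ₂) * (starRingEnd ℂ) (c : ℂ)) * e1 + e2
  have hz : actK d V (((ξ₁ * ξ₂)⁻¹ : (quadOrder d)ˣ) : quadOrder d) (slZ v (B₁ * B₂) τ z) =
      actK d V ((ξ₁⁻¹ : (quadOrder d)ˣ) : quadOrder d)
        (slZ v B₁ (B₂ • τ) (actK d V c (slZ v B₂ τ z))) := by
    have e : ((((ξ₁ * ξ₂)⁻¹ : (quadOrder d)ˣ) : quadOrder d) : QuadField d) =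
        ((ξ₁⁻¹ : (quadOrder d)ˣ) : quadOrder d) * c := by
      rw [mul_inv, Units.val_mul]
      rfl
    rw [e, actK_mul]
    congr 1
    conv_rhs => rw [slZ, v.projPos_actK, v.projNeg_actK, projPos_slZ, projNeg_slZ]
    rw [slZ, slj_mul, map_mul, mul_inv, mul_inv, mul_smul, mul_smul]
    simp only [map_add, map_smul]
  rw [hz, mul_smul, h₁, h₂, L.slFactor_mul v c hc, Matrix.mulVec_smul, Matrix.mulVec_mulVec,
    smul_smul, Units.val_mul, map_mul, mul_zpow]
  congr 1
  ring

theorem TransformsBy.one (L : EvenLattice d V) (v : GrJ L) : L.TransformsBy v 1 1 1 := by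
  intro τ z
  have h : ((((1 : (quadOrder d)ˣ)⁻¹ : (quadOrder d)ˣ) : quadOrder d) : QuadField d) = 1 := by
    rw [inv_one]; rfl
  rw [h, actK_one, one_smul, Matrix.one_mulVec, slZ, slFactor]
  simp [slj, v.projPos_add_projNeg, expC_zero]

theorem TransformsBy.translation (L : EvenLattice d V) (v : GrJ L) :
    L.TransformsBy v 1 ModularGroup.T (Matrix.diagonal L.discQuad) := by
  intro τ z
  have h : ((((1 : (quadOrder d)ˣ)⁻¹ : (quadOrder d)ˣ) : quadOrder d) : QuadField d) = 1 := by
    rw [inv_one]; rfl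
  have hτ : ((ModularGroup.T • τ : UpperHalfPlane) : ℂ) = τ + 1 := by
    rw [coe_sl_smul]
    simp [slj, ModularGroup.T]
  funext γ
  have hj : slj ModularGroup.T τ = 1 := by simp [slj, ModularGroup.T]
  have hc : ((ModularGroup.T 1 0 : ℤ) : ℂ) = 0 := by simp [ModularGroup.T]
  rw [h, actK_one, slZ, slFactor, Pi.smul_apply, Matrix.mulVec_diagonal, L.thetaZ_translate v hτ, hj,
    hc]
  simp [v.projPos_add_projNeg, expC_zero]

theorem TransformsBy.inversion (L : EvenLattice d V) (v : GrJ L) :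
    L.TransformsBy v 1 ModularGroup.S L.weilS := by
  intro τ z
  have h : ((((1 : (quadOrder d)ˣ)⁻¹ : (quadOrder d)ˣ) : quadOrder d) : QuadField d) = 1 := by
    rw [inv_one]; rfl
  have hτ : ((ModularGroup.S • τ : UpperHalfPlane) : ℂ) = -(τ : ℂ)⁻¹ := by
    rw [coe_sl_smul]
    simp [slj, ModularGroup.S, neg_div]
  have h1 := (L.thetaZ_inversion v).1 τ _ hτ z
  have hj : slj ModularGroup.S τ = τ := by simp [slj, ModularGroup.S]
  have hc : ((ModularGroup.S 1 0 : ℤ) : ℂ) = 1 := by simp [ModularGroup.S]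
  rw [h, actK_one, slZ, slFactor, hj, hc, h1]
  simp

/-- The factor ξ^(b₊ - b₋) of the law cancels the entry ξ^(b₋ - b₊) of the matrix, leaving the
permutation γ ↦ ξγ of the components. -/
theorem TransformsBy.scalar (L : EvenLattice d V) (v : GrJ L) {ξ : (quadOrder d)ˣ}
    (hξ : embO d ξ * (starRingEnd ℂ) (embO d ξ) = 1) :
    L.TransformsBy v ξ 1 (Matrix.of fun δ γ =>
      if δ = (ξ⁻¹ : (quadOrder d)ˣ) • γ then (embO d ξ) ^ ((L.bNeg : ℤ) - L.bPos) else 0) := by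
  intro τ z
  have h0 : embO d ξ ≠ 0 := fun h => by rw [h, zero_mul] at hξ; exact zero_ne_one hξ
  have hz : slZ v 1 τ z = z := by simp [slZ, slj, v.projPos_add_projNeg]
  have hf : L.slFactor v 1 τ z = 1 := by simp [slFactor, slj, expC_zero]
  funext γ
  rw [hz, hf, one_smul, L.thetaZ_unit v ξ hξ, Pi.smul_apply, Matrix.mulVec, dotProduct]
  simp only [Matrix.of_apply, ite_mul, zero_mul, eq_inv_smul_iff (a := γ)]
  rw [Finset.sum_ite_eq, if_pos (Finset.mem_univ _), mul_one, smul_eq_mul, ← mul_assoc,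
    ← zpow_add₀ h0]
  simp

/-- The property of the pairs in the graph of the dual Weil representation on which the modularity of
the theta function rests. -/
def IsThetaMultiplier (A : GL (Fin 2) (quadOrder d)) (R : Matrix L.Disc L.Disc ℂ) : Prop :=
  R * R.conjTranspose = 1 ∧ ∃ (ξ : (quadOrder d)ˣ) (B : SL(2, ℤ)), IsOfFinOrder ξ ∧
    A = Matrix.GeneralLinearGroup.scalar (Fin 2) ξ *
      Matrix.SpecialLinearGroup.mapGL (quadOrder d) B ∧ L.TransformsBy v ξ B R

theorem IsThetaMultiplier.mul {L : EvenLattice d V} {v : GrJ L} {A₁ A₂ : GL (Fin 2) (quadOrder d)}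
    {R₁ R₂ : Matrix L.Disc L.Disc ℂ} (h₁ : L.IsThetaMultiplier v A₁ R₁)
    (h₂ : L.IsThetaMultiplier v A₂ R₂) : L.IsThetaMultiplier v (A₁ * A₂) (R₁ * R₂) := by
  obtain ⟨hR₁, ξ₁, B₁, hξ₁, rfl, ht₁⟩ := h₁
  obtain ⟨hR₂, ξ₂, B₂, hξ₂, rfl, ht₂⟩ := h₂
  refine ⟨?_, ξ₁ * ξ₂, B₁ * B₂, hξ₁.mul hξ₂, ?_, ht₁.mul (norm_one_of_isOfFinOrder hξ₂) ht₂⟩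
  · rw [Matrix.conjTranspose_mul, Matrix.mul_assoc, ← Matrix.mul_assoc R₂, hR₂, Matrix.one_mul, hR₁]
  · have hcomm : ∀ M : GL (Fin 2) (quadOrder d),
        M * Matrix.GeneralLinearGroup.scalar (Fin 2) ξ₂ =
          Matrix.GeneralLinearGroup.scalar (Fin 2) ξ₂ * M := by
      intro M
      apply Units.ext
      exact ((Matrix.scalar_commute (ξ₂ : quadOrder d) (fun r => Commute.all _ _) _).eq).symm
    rw [map_mul, map_mul, mul_assoc, ← mul_assoc _ (Matrix.GeneralLinearGroup.scalar (Fin 2) ξ₂),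
      hcomm]
    simp only [mul_assoc]

/-- Negating the pairing inverts the roots of unity and exchanges b₊ and b₋, which is complex
conjugation. So the generators of the dual Weil representation are the conjugates of those by which
theta transforms. -/
theorem weilS_map_conj : (Matrix.of fun δ γ =>
    Complex.I ^ ((L.bPos : ℤ) - L.bNeg) / (Real.sqrt (Nat.card L.Disc) : ℂ) *
      ((L.discPair γ δ)⁻¹)⁻¹ : Matrix L.Disc L.Disc ℂ).map (starRingEnd ℂ) = L.weilS := by
  ext δ γ
  rw [Matrix.map_apply, Matrix.of_apply, weilS, Matrix.of_apply, inv_inv, map_mul, map_div₀,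
    L.conj_discPair, Complex.conj_ofReal, map_zpow₀, Complex.conj_I, ← Complex.inv_I, inv_zpow',
    neg_sub]

theorem diagonal_map_conj : (Matrix.diagonal fun γ => (L.discQuad γ)⁻¹).map (starRingEnd ℂ) =
    Matrix.diagonal L.discQuad := by
  rw [Matrix.diagonal_map (map_zero _)]
  congr 1
  funext γ
  rw [map_inv₀, L.conj_discQuad, inv_inv]

theorem scalar_map_conj {ξ : (quadOrder d)ˣ}
    (hξ : embO d ξ * (starRingEnd ℂ) (embO d ξ) = 1) :
    (Matrix.of fun δ γ => if δ = (ξ⁻¹ : (quadOrder d)ˣ) • γ then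
      (embO d ξ) ^ ((L.bPos : ℤ) - L.bNeg) else 0 : Matrix L.Disc L.Disc ℂ).map (starRingEnd ℂ) =
      Matrix.of fun δ γ => if δ = (ξ⁻¹ : (quadOrder d)ˣ) • γ then
        (embO d ξ) ^ ((L.bNeg : ℤ) - L.bPos) else 0 := by
  ext δ γ
  rw [Matrix.map_apply, Matrix.of_apply, Matrix.of_apply, apply_ite (starRingEnd ℂ), map_zero,
    map_zpow₀, eq_inv_of_mul_eq_one_right hξ, inv_zpow', neg_sub]

/-- The conjugates of the matrices in the graph of the dual Weil representation describe the
transformation behaviour of the theta function. -/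
theorem isThetaMultiplier_of_mem_graph {A : GL (Fin 2) (quadOrder d)} {R : Matrix L.Disc L.Disc ℂ}
    (h : (A, R) ∈ L.weilGraph (fun γ => (L.discQuad γ)⁻¹) (fun γ δ => (L.discPair γ δ)⁻¹)
      (L.bPos - L.bNeg)) : L.IsThetaMultiplier v A (R.map (starRingEnd ℂ)) := by
  have key : ∀ P ∈ L.weilGraph (fun γ => (L.discQuad γ)⁻¹) (fun γ δ => (L.discPair γ δ)⁻¹)
      (L.bPos - L.bNeg), L.IsThetaMultiplier v P.1 (P.2.map (starRingEnd ℂ)) := by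
    intro P hP
    induction hP using Submonoid.closure_induction with
    | mem P hP =>
      rcases hP with (rfl | rfl) | ⟨ξ, hξ, rfl⟩
      · simp only [L.diagonal_map_conj]
        refine ⟨?_, 1, _, IsOfFinOrder.one, by rw [map_one, one_mul],
          TransformsBy.translation L v⟩
        rw [Matrix.diagonal_conjTranspose, Matrix.diagonal_mul_diagonal, ← Matrix.diagonal_one]
        congr 1
        funext γ
        rw [Pi.star_apply, Complex.star_def, L.conj_discQuad, mul_inv_cancel₀ (L.discQuad_ne_zero γ)]
      · simp only [L.weilS_map_conj]
        exact ⟨(L.thetaZ_inversion v).2, 1, _, IsOfFinOrder.one, by rw [map_one, one_mul],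
          TransformsBy.inversion L v⟩
      · have hξ1 := norm_one_of_isOfFinOrder hξ
        simp only [L.scalar_map_conj hξ1]
        refine ⟨?_, ξ, 1, hξ, by rw [map_one, mul_one], TransformsBy.scalar L v hξ1⟩
        have hz : embO d ξ ^ ((L.bNeg : ℤ) - L.bPos) *
            (starRingEnd ℂ) (embO d ξ ^ ((L.bNeg : ℤ) - L.bPos)) = 1 := by
          rw [map_zpow₀, ← mul_zpow, hξ1, one_zpow]
        ext δ ε
        rw [Matrix.mul_apply, Matrix.one_apply]
        simp only [Matrix.conjTranspose_apply, Matrix.of_apply, eq_inv_smul_iff (a := δ),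
          eq_inv_smul_iff (a := ε), ite_mul, zero_mul]
        rw [Finset.sum_ite_eq, if_pos (Finset.mem_univ _), apply_ite star, star_zero,
          Complex.star_def, mul_ite, hz, mul_zero]
        simp only [smul_left_cancel_iff, eq_comm]
    | one =>
      have e : ((1 : GL (Fin 2) (quadOrder d) × Matrix L.Disc L.Disc ℂ).2).map (starRingEnd ℂ) = 1 :=
        Matrix.map_one _ (map_zero _) (map_one _)
      rw [e]
      exact ⟨by simp, 1, 1, IsOfFinOrder.one, by simp, TransformsBy.one L v⟩
    | mul P Q _ _ hP hQ =>
      have e : ((P * Q).2).map (starRingEnd ℂ) = P.2.map (starRingEnd ℂ) * Q.2.map (starRingEnd ℂ) :=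
        Matrix.map_mul
      rw [e]
      exact hP.mul hQ
  exact key _ h

/-- The Weil representation is defined on all of `U(1,1)(ℤ)`. -/
theorem exists_mem_weilGraph (q : L.Disc → ℂ) (b : L.Disc → L.Disc → ℂ) (s : ℤ) (A : unitaryZ d) :
    ∃ R, ((A : GL (Fin 2) (quadOrder d)), R) ∈ L.weilGraph q b s := by
  obtain ⟨ξ, B, hξ, hA⟩ := exists_eq_scalar_mul A
  have hB : B ∈ Submonoid.closure ({ModularGroup.S, ModularGroup.T} : Set SL(2, ℤ)) := by
    rw [submonoid_closure_S_T]; trivial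
  have h : ∃ R, (Matrix.SpecialLinearGroup.mapGL (quadOrder d) B, R) ∈ L.weilGraph q b s := by
    clear hA
    induction hB using Submonoid.closure_induction with
    | mem B hB =>
      rcases hB with rfl | rfl
      · exact ⟨_, Submonoid.subset_closure (Or.inl (Or.inr rfl))⟩
      · exact ⟨_, Submonoid.subset_closure (Or.inl (Or.inl rfl))⟩
    | one => exact ⟨1, by rw [map_one]; exact one_mem _⟩
    | mul B B' _ _ h h' =>
      obtain ⟨R, hR⟩ := h
      obtain ⟨R', hR'⟩ := h'
      have h3 := mul_mem hR hR'
      rw [Prod.mk_mul_mk, ← map_mul] at h3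
      exact ⟨_, h3⟩
  obtain ⟨R, hR⟩ := h
  have hs : (Matrix.GeneralLinearGroup.scalar (Fin 2) ξ, (Matrix.of fun δ γ =>
      if δ = (ξ⁻¹ : (quadOrder d)ˣ) • γ then (embO d ξ) ^ s else 0 : Matrix L.Disc L.Disc ℂ)) ∈
      L.weilGraph q b s := Submonoid.subset_closure (Or.inr ⟨ξ, hξ, rfl⟩)
  have h := mul_mem hs hR
  rw [Prod.mk_mul_mk, ← hA] at h
  exact ⟨_, h⟩

/-- The chosen matrix lies in the graph because some matrix over A does, and every pair in the graph
has the property. Single-valuedness of the graph is not required. -/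
theorem isThetaMultiplier_weilRepBar (A : unitaryZ d) :
    L.IsThetaMultiplier v (A : GL (Fin 2) (quadOrder d)) ((L.weilRepBar A).map (starRingEnd ℂ)) :=
  L.isThetaMultiplier_of_mem_graph v (Classical.epsilon_spec (L.exists_mem_weilGraph _ _ _ A))

/-- The theta transformation formula for `U(1,1)(ℤ)`. -/
theorem theta_act (A : unitaryZ d) (τ : UpperHalfPlane) (ζ : VC d V) (ω : VCbar d V) :
    L.theta v (act A τ)
      ((fj A τ)⁻¹ • v.posC ζ + ((starRingEnd ℂ) (fjc A τ))⁻¹ • v.negC ζ)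
      ((fjc A τ)⁻¹ • v.posCbar ω + ((starRingEnd ℂ) (fj A τ))⁻¹ • v.negCbar ω) =
    (fj A τ ^ L.bPos * (starRingEnd ℂ) (fj A τ) ^ L.bNeg *
      expC (entry A 1 0 * L.formC (v.posC ζ) (v.posCbar ω) / fj A τ
        + (starRingEnd ℂ) (entry A 1 0) * L.formC (v.negC ζ) (v.negCbar ω) /
          (starRingEnd ℂ) (fj A τ))) •
      ((L.weilRepBar A).map (starRingEnd ℂ)).mulVec (L.theta v τ ζ ω) := by
  obtain ⟨-, ξ, B, hξ, hA, ht⟩ := L.isThetaMultiplier_weilRepBar v A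
  have hξ1 := norm_one_of_isOfFinOrder hξ
  have h0 : embO d ξ ≠ 0 := fun h => by rw [h, zero_mul] at hξ1; exact zero_ne_one hξ1
  have hinv : (starRingEnd ℂ) (embO d ξ) = (embO d ξ)⁻¹ := eq_inv_of_mul_eq_one_right hξ1
  have hent : ∀ i j, entry A i j = embO d ξ * (B i j : ℤ) := by
    intro i j
    rw [entry, hA, Units.val_mul, scalar_mul_apply, mapGL_apply, map_mul, map_intCast]
  have hj0 := slj_ne_zero B τ
  have hj : fj A τ = embO d ξ * slj B τ := by
    rw [fj, hent, hent, slj]; ring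
  have hjc : fjc A τ = (embO d ξ)⁻¹ * slj B τ := by
    rw [fjc, hent, hent, slj, map_mul, map_mul, hinv, map_intCast, map_intCast]; ring
  have hact : act A τ = B • τ := by
    apply UpperHalfPlane.ext
    rw [coe_sl_smul]
    change (entry A 0 0 * τ + entry A 0 1) / fj A τ = _
    rw [hj, hent, hent, mul_assoc, ← mul_add, mul_div_mul_left _ _ h0]
  have hcinv : (((ξ⁻¹ : (quadOrder d)ˣ) : quadOrder d) : ℂ) = (embO d ξ)⁻¹ := by
    refine eq_inv_of_mul_eq_one_left ?_
    change embO d ((ξ⁻¹ : (quadOrder d)ˣ) : quadOrder d) * embO d ξ = 1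
    rw [← map_mul, Units.inv_mul, map_one]
  rw [theta_eq_thetaZ, theta_eq_thetaZ, hact]
  -- As ξ̄ = ξ⁻¹, the factors are j = ξ·j_B and j^c = ξ⁻¹·j_B. The extra scalars, ξ⁻¹ on ζ and ξ on
  -- ω, are the action of ξ⁻¹ ∈ 𝕂 on V_ℂ and V_ℂ̄.
  have hz : ((((fj A τ)⁻¹ • v.posC ζ + ((starRingEnd ℂ) (fjc A τ))⁻¹ • v.negC ζ : VC d V) :
      ℂ ⊗[ℚ] V) + (((fjc A τ)⁻¹ • v.posCbar ω + ((starRingEnd ℂ) (fj A τ))⁻¹ • v.negCbar ω :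
      VCbar d V) : ℂ ⊗[ℚ] V)) = actK d V ((ξ⁻¹ : (quadOrder d)ˣ) : quadOrder d)
        (slZ v B τ ((ζ : ℂ ⊗[ℚ] V) + (ω : ℂ ⊗[ℚ] V))) := by
    have e1 : actK d V ((ξ⁻¹ : (quadOrder d)ˣ) : quadOrder d) (v.projPos (ζ : ℂ ⊗[ℚ] V)) =
        (embO d ξ)⁻¹ • v.projPos (ζ : ℂ ⊗[ℚ] V) := by
      rw [← hcinv]; exact actK_VC _ (v.posC ζ)
    have e2 : actK d V ((ξ⁻¹ : (quadOrder d)ˣ) : quadOrder d) (v.projNeg (ζ : ℂ ⊗[ℚ] V)) =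
        (embO d ξ)⁻¹ • v.projNeg (ζ : ℂ ⊗[ℚ] V) := by
      rw [← hcinv]; exact actK_VC _ (v.negC ζ)
    have e3 : actK d V ((ξ⁻¹ : (quadOrder d)ˣ) : quadOrder d) (v.projPos (ω : ℂ ⊗[ℚ] V)) =
        (embO d ξ) • v.projPos (ω : ℂ ⊗[ℚ] V) := by
      refine (actK_VCbar _ (v.posCbar ω)).trans ?_
      rw [hcinv, map_inv₀, hinv, inv_inv]; rfl
    have e4 : actK d V ((ξ⁻¹ : (quadOrder d)ˣ) : quadOrder d) (v.projNeg (ω : ℂ ⊗[ℚ] V)) =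
        (embO d ξ) • v.projNeg (ω : ℂ ⊗[ℚ] V) := by
      refine (actK_VCbar _ (v.negCbar ω)).trans ?_
      rw [hcinv, map_inv₀, hinv, inv_inv]; rfl
    change (fj A τ)⁻¹ • v.projPos (ζ : ℂ ⊗[ℚ] V) + ((starRingEnd ℂ) (fjc A τ))⁻¹ •
      v.projNeg (ζ : ℂ ⊗[ℚ] V) + ((fjc A τ)⁻¹ • v.projPos (ω : ℂ ⊗[ℚ] V) +
        ((starRingEnd ℂ) (fj A τ))⁻¹ • v.projNeg (ω : ℂ ⊗[ℚ] V)) = _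
    rw [slZ, map_add, map_smul, map_smul]
    simp only [map_add, smul_add, e1, e2, e3, e4, hj, hjc, map_mul, map_inv₀, hinv, inv_inv, mul_inv,
      smul_smul]
    rw [mul_comm (slj B τ)⁻¹, mul_comm (slj B τ)⁻¹, mul_comm ((starRingEnd ℂ) (slj B τ))⁻¹,
      mul_comm ((starRingEnd ℂ) (slj B τ))⁻¹]
    abel
  rw [hz, ht τ]
  congr 1
  have hP : L.bil (v.projPos ((ζ : ℂ ⊗[ℚ] V) + (ω : ℂ ⊗[ℚ] V)))
      (v.projPos ((ζ : ℂ ⊗[ℚ] V) + (ω : ℂ ⊗[ℚ] V))) = 2 * L.formC (v.posC ζ) (v.posCbar ω) := by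
    rw [map_add]; exact L.bil_add_self (v.posC ζ) (v.posCbar ω)
  have hN : L.bil (v.projNeg ((ζ : ℂ ⊗[ℚ] V) + (ω : ℂ ⊗[ℚ] V)))
      (v.projNeg ((ζ : ℂ ⊗[ℚ] V) + (ω : ℂ ⊗[ℚ] V))) = 2 * L.formC (v.negC ζ) (v.negCbar ω) := by
    rw [map_add]; exact L.bil_add_self (v.negC ζ) (v.negCbar ω)
  -- The factor ξ^(b₊ - b₋) completes the powers of j_B and its conjugate to those of j(A, τ) and
  -- its conjugate.
  rw [slFactor, hP, hN, hj, hent, map_mul, map_mul, hinv, map_intCast, zpow_sub₀ h0, zpow_natCast,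
    zpow_natCast]
  have hj0' : (starRingEnd ℂ) (slj B τ) ≠ 0 := (map_ne_zero _).mpr hj0
  have e1 : embO d ξ * (B 1 0 : ℤ) * L.formC (v.posC ζ) (v.posCbar ω) / (embO d ξ * slj B τ) =
      (B 1 0 : ℤ) * L.formC (v.posC ζ) (v.posCbar ω) / slj B τ := by
    rw [mul_assoc, mul_div_mul_left _ _ h0]
  have e2 : (embO d ξ)⁻¹ * (B 1 0 : ℤ) * L.formC (v.negC ζ) (v.negCbar ω) /
      ((embO d ξ)⁻¹ * (starRingEnd ℂ) (slj B τ)) =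
      (B 1 0 : ℤ) * L.formC (v.negC ζ) (v.negCbar ω) / (starRingEnd ℂ) (slj B τ) := by
    rw [mul_assoc, mul_div_mul_left _ _ (inv_ne_zero h0)]
  rw [e1, e2, mul_pow, mul_pow, inv_pow]
  have e3 : 1 / 2 * ((B 1 0 : ℤ) * (2 * L.formC (v.posC ζ) (v.posCbar ω)) / slj B τ +
      (B 1 0 : ℤ) * (2 * L.formC (v.negC ζ) (v.negCbar ω)) / (starRingEnd ℂ) (slj B τ)) =
      (B 1 0 : ℤ) * L.formC (v.posC ζ) (v.posCbar ω) / slj B τ +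
        (B 1 0 : ℤ) * L.formC (v.negC ζ) (v.negCbar ω) / (starRingEnd ℂ) (slj B τ) := by
    ring
  rw [e3]
  ring

/-- Unitarity, in the form needed to pair theta, which transforms by the conjugate matrix, with F,
which transforms by the matrix itself. -/
theorem weilRepBar_unitary (v : GrJ L) (A : unitaryZ d) :
    (L.weilRepBar A).transpose * (L.weilRepBar A).map (starRingEnd ℂ) = 1 := by
  have h := (L.isThetaMultiplier_weilRepBar v A).1
  have h2 := mul_eq_one_comm.mp h
  rw [← h2]
  congr 1
  ext i j
  simp [Matrix.conjTranspose_apply]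

end EvenLattice

/-! ### Regularity of theta and of the coefficients of a decomposition -/

variable (d V) in
/-- The projection `x ↦ x_ℂ` as a linear map. -/
def toVCL : ℂ ⊗[ℚ] V →ₗ[ℂ] VC d V where
  toFun := toVC
  map_add' := toVC_add
  map_smul' := toVC_smul

variable (d V) in
/-- The projection `x ↦ x_ℂ̄` as a linear map. -/
def toVCbarL : ℂ ⊗[ℚ] V →ₗ[ℂ] VCbar d V where
  toFun := toVCbar
  map_add' := toVCbar_add
  map_smul' := toVCbar_smul

namespace EvenLattice

variable (L : EvenLattice d V) (v : GrJ L)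

theorem finiteDimensional_complexification (L : EvenLattice d V) (v : GrJ L) :
    FiniteDimensional ℂ (ℂ ⊗[ℚ] V) := by
  obtain ⟨F⟩ := exists_thetaFrame L v
  exact F.κ.symm.finiteDimensional

theorem thetaZ_eq_thetaSeries (F : ThetaFrame L v) (τ : UpperHalfPlane) (z : ℂ ⊗[ℚ] V)
    (γ : L.Disc) : L.thetaZ v τ z γ =
      thetaSeries (fun x : {x : L.dual // L.disc x = γ} => F.y (x : L.dual))
        (frameBeta L τ, F.w z) :=
  tsum_congr fun _ => F.zTerm_eq_thetaExponent τ z _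

theorem sparse_coset (F : ThetaFrame L v) (γ : L.Disc) :
    Sparse fun x : {x : L.dual // L.disc x = γ} => F.y (x : L.dual) := by
  obtain ⟨G⟩ := exists_latticeFrame L
  exact (F.sparse G).comp_injective Subtype.val_injective

/-- The theta function is smooth. -/
theorem contDiffOn_thetaZ (F : ThetaFrame L v) {E : Type*} [NormedAddCommGroup E] [NormedSpace ℝ E]
    {g : E → ℂ} {h : E → ℂ ⊗[ℚ] V} (hg : ContDiff ℝ (⊤ : ℕ∞) g)
    (hh : ContDiff ℝ (⊤ : ℕ∞) fun p => F.κ (h p)) (γ : L.Disc) :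
    ContDiffOn ℝ (⊤ : ℕ∞) (fun p => L.thetaZ v (UpperHalfPlane.ofComplex (g p)) (h p) γ)
      {p | 0 < (g p).im} := by
  have h1 := ((L.sparse_coset v F γ).contDiffOn).restrict_scalars ℝ
  -- The series is holomorphic in its parameters, but the parameter -τ̄ is not holomorphic in τ;
  -- only real smoothness survives.
  let β : E → FrameIndex L → ℂ := fun p => Sum.elim (fun _ => g p) (fun _ => -(starRingEnd ℂ) (g p))
  have hβ : ContDiff ℝ (⊤ : ℕ∞) β := by
    rw [contDiff_pi]
    rintro (i | i)
    · exact hg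
    · exact (Complex.conjCLE.contDiff.comp hg).neg
  have hw : ContDiff ℝ (⊤ : ℕ∞) fun p => F.w (h p) := by
    rw [contDiff_pi] at hh ⊢
    exact fun i => contDiff_const.mul (hh i)
  have hmaps : Set.MapsTo (fun p => (β p, F.w (h p))) {p | 0 < (g p).im} (thetaDomain _) := by
    intro p hp
    have hp' : 0 < (g p).im := hp
    rintro (i | i)
    · exact hp
    · simpa [β] using hp'
  refine (h1.comp (hβ.prodMk hw).contDiffOn hmaps).congr fun p hp => ?_
  have hp' : 0 < (g p).im := hp
  rw [L.thetaZ_eq_thetaSeries v F, Function.comp_apply]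
  congr 2
  funext i
  rcases i with i | i <;>
    simp [frameBeta, β, UpperHalfPlane.ofComplex_apply_of_im_pos hp']

/-- The theta function is entire in the elliptic variable. -/
theorem differentiable_thetaZ (F : ThetaFrame L v) {E : Type*} [NormedAddCommGroup E]
    [NormedSpace ℂ E] {h : E → ℂ ⊗[ℚ] V} (hh : Differentiable ℂ fun p => F.κ (h p))
    (τ : UpperHalfPlane) (γ : L.Disc) :
    Differentiable ℂ fun p => L.thetaZ v τ (h p) γ := by
  have h1 := (L.sparse_coset v F γ).contDiffOn
  have hw : Differentiable ℂ fun p => F.w (h p) := by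
    rw [differentiable_pi] at hh ⊢
    exact fun i => (differentiable_const _).mul (hh i)
  intro p
  have hp : (frameBeta L τ, F.w (h p)) ∈ thetaDomain (FrameIndex L) := frameBeta_im_pos L τ
  have h2 : DifferentiableAt ℂ _ (frameBeta L τ, F.w (h p)) :=
    (h1.contDiffAt ((isOpen_thetaDomain).mem_nhds hp)).differentiableAt (by simp)
  have h3 := h2.comp p ((differentiableAt_const (frameBeta L τ)).prodMk (hw p))
  refine h3.congr_of_eventuallyEq (Filter.Eventually.of_forall fun q => ?_)
  exact L.thetaZ_eq_thetaSeries v F τ (h q) γ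

theorem smoothProd_theta (γ : L.Disc) : SmoothProd fun τ ζ ω => L.theta v τ ζ ω γ := by
  obtain ⟨F⟩ := exists_thetaFrame L v
  intro m n a b
  have h1 : ContDiff ℝ (⊤ : ℕ∞) fun p : ℂ × (Fin m → ℂ) × (Fin n → ℂ) =>
      F.κ ((a p.2.1 : ℂ ⊗[ℚ] V) + (b p.2.2 : ℂ ⊗[ℚ] V)) := by
    let A := (F.κ.toLinearMap ∘ₗ (VC d V).subtype ∘ₗ a.toLinearMap).toContinuousLinearMap
    let B := (F.κ.toLinearMap ∘ₗ (VCbar d V).subtype ∘ₗ b.toLinearMap).toContinuousLinearMap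
    have e : (fun p : ℂ × (Fin m → ℂ) × (Fin n → ℂ) =>
        F.κ ((a p.2.1 : ℂ ⊗[ℚ] V) + (b p.2.2 : ℂ ⊗[ℚ] V))) = fun p => A p.2.1 + B p.2.2 := by
      funext p
      rw [map_add]
      rfl
    rw [e]
    have hA : ContDiff ℝ (⊤ : ℕ∞) A := A.contDiff.restrict_scalars ℝ
    have hB : ContDiff ℝ (⊤ : ℕ∞) B := B.contDiff.restrict_scalars ℝ
    exact (hA.comp (contDiff_fst.comp contDiff_snd)).add (hB.comp (contDiff_snd.comp contDiff_snd))
  have h2 := L.contDiffOn_thetaZ v F (E := ℂ × (Fin m → ℂ) × (Fin n → ℂ)) (g := fun p => p.1)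
    contDiff_fst h1 γ
  exact h2.congr fun p _ => congrFun (L.theta_eq_thetaZ v _ _ _) γ

theorem holoProd_theta (τ : UpperHalfPlane) (γ : L.Disc) :
    HoloProd fun ζ ω => L.theta v τ ζ ω γ := by
  obtain ⟨F⟩ := exists_thetaFrame L v
  intro m n a b
  have h1 : Differentiable ℂ fun p : (Fin m → ℂ) × (Fin n → ℂ) =>
      F.κ ((a p.1 : ℂ ⊗[ℚ] V) + (b p.2 : ℂ ⊗[ℚ] V)) := by
    let A := (F.κ.toLinearMap ∘ₗ (VC d V).subtype ∘ₗ a.toLinearMap).toContinuousLinearMap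
    let B := (F.κ.toLinearMap ∘ₗ (VCbar d V).subtype ∘ₗ b.toLinearMap).toContinuousLinearMap
    have e : (fun p : (Fin m → ℂ) × (Fin n → ℂ) =>
        F.κ ((a p.1 : ℂ ⊗[ℚ] V) + (b p.2 : ℂ ⊗[ℚ] V))) = fun p => A p.1 + B p.2 := by
      funext p
      rw [map_add]
      rfl
    rw [e]
    exact (A.differentiable.comp differentiable_fst).add (B.differentiable.comp differentiable_snd)
  have h2 := L.differentiable_thetaZ v F h1 τ γ
  simp only [L.theta_eq_thetaZ]
  exact h2

/-- The values of the theta function span `ℂ[D_M]`. -/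
theorem span_range_thetaZ (τ : UpperHalfPlane) :
    Submodule.span ℂ (Set.range (L.thetaZ v τ)) = ⊤ := by
  by_contra hne
  -- A functional vanishing on all values would be a linear relation between the theta components.
  obtain ⟨f, hf0, hf⟩ := Submodule.exists_le_ker_of_lt_top _ (lt_top_iff_ne_top.mpr hne)
  apply hf0
  have hexp : ∀ X : L.Disc → ℂ, f X = ∑ γ, X γ * f (Pi.single γ 1) := by
    intro X
    conv_lhs => rw [pi_eq_sum_univ' X]
    rw [map_sum]
    refine Finset.sum_congr rfl fun γ _ => ?_
    rw [map_smul, smul_eq_mul]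
  have h0 : (fun γ => f (Pi.single γ 1)) = 0 := by
    refine L.thetaZ_independent v (τ := τ) fun z => ?_
    rw [← hexp]
    have : L.thetaZ v τ z ∈ LinearMap.ker f := hf (Submodule.subset_span ⟨z, rfl⟩)
    rw [LinearMap.mem_ker.mp this]
    simp
  apply LinearMap.ext
  intro X
  rw [hexp]
  simp [fun γ => congrFun h0 γ]

/-- The values of theta span ℂ[D_M], so some |D_M| of them form a basis. They give an invertible
system for the coefficients of a decomposition. -/
theorem exists_det_ne_zero (τ : UpperHalfPlane) : ∃ z : L.Disc → ℂ ⊗[ℚ] V,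
    (Matrix.of fun i γ => L.thetaZ v τ (z i) γ).det ≠ 0 := by
  obtain ⟨b, hb, hspan, hli⟩ := exists_linearIndependent ℂ (Set.range (L.thetaZ v τ))
  rw [L.span_range_thetaZ] at hspan
  let B : Module.Basis b ℂ (L.Disc → ℂ) := Module.Basis.mk hli (by
    rw [Subtype.range_coe]; exact hspan.ge)
  let e : L.Disc ≃ b := (Pi.basisFun ℂ L.Disc).indexEquiv B
  choose z hz using fun i : L.Disc => hb (e i).2
  refine ⟨z, ?_⟩
  have h2 : LinearIndependent ℂ (Matrix.of fun i γ => L.thetaZ v τ (z i) γ).row := by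
    have h3 : (Matrix.of fun i γ => L.thetaZ v τ (z i) γ).row = Subtype.val ∘ e := by
      funext i
      exact hz i
    rw [h3]
    exact hli.comp e e.injective
  exact ((Matrix.isUnit_iff_isUnit_det _).mp
    (Matrix.linearIndependent_rows_iff_isUnit.mp h2)).ne_zero

end EvenLattice

theorem contDiffAt_det {n : Type*} [Fintype n] [DecidableEq n] {M : ℂ → Matrix n n ℂ} {x : ℂ}
    (h : ∀ i j, ContDiffAt ℝ (⊤ : ℕ∞) (fun z => M z i j) x) :
    ContDiffAt ℝ (⊤ : ℕ∞) (fun z => (M z).det) x := by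
  simp only [Matrix.det_apply]
  refine ContDiffAt.sum fun σ _ => ContDiffAt.const_smul _ ?_
  exact contDiffAt_prod fun i _ => h _ _

/-- Solutions of linear systems with smooth coefficients and non-zero determinant are smooth. -/
theorem contDiffAt_of_mulVec {n : Type*} [Fintype n] [DecidableEq n] {M : ℂ → Matrix n n ℂ}
    {f φ : ℂ → n → ℂ} {x : ℂ} (hM : ∀ i j, ContDiffAt ℝ (⊤ : ℕ∞) (fun z => M z i j) x)
    (hφ : ∀ i, ContDiffAt ℝ (⊤ : ℕ∞) (fun z => φ z i) x) (hf : ∀ z, (M z).mulVec (f z) = φ z)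
    (h0 : (M x).det ≠ 0) (i : n) : ContDiffAt ℝ (⊤ : ℕ∞) (fun z => f z i) x := by
  have hdet := contDiffAt_det hM
  have h1 : ContDiffAt ℝ (⊤ : ℕ∞) (fun z => ((M z).updateCol i (φ z)).det) x := by
    refine contDiffAt_det fun j k => ?_
    simp only [Matrix.updateCol_apply]
    by_cases hk : k = i
    · simpa only [hk, if_true] using hφ j
    · simpa only [hk, if_false] using hM j k
  refine (h1.mul (hdet.inv h0)).congr_of_eventuallyEq ?_
  filter_upwards [hdet.continuousAt.eventually_ne h0] with z hz
  -- Cramer's rule: replacing column i by φ multiplies the determinant by the i-th unknown.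
  have h2 := congrFun (Matrix.cramer_eq_adjugate_mulVec (M z) (φ z)) i
  rw [Matrix.cramer_apply, ← hf, Matrix.mulVec_mulVec, Matrix.adjugate_mul, Matrix.smul_mulVec,
    Matrix.one_mulVec, Pi.smul_apply, smul_eq_mul, hf] at h2
  rw [h2, Pi.inv_apply]
  field_simp

/-! ### The theta decomposition -/

namespace EvenLattice

variable (L : EvenLattice d V) (v : GrJ L)

theorem discPairing_theta (τ : UpperHalfPlane) (ζ : VC d V) (ω : VCbar d V) (c : L.Disc → ℂ) :
    L.discPairing (L.theta v τ ζ ω) c = ∑ γ, L.thetaZ v τ (ζ + ω) γ * c γ := by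
  rw [discPairing, theta_eq_thetaZ]

theorem hasSum_mul_thetaTerm (τ : UpperHalfPlane) (ζ : VC d V) (ω : VCbar d V) (c : L.Disc → ℂ) :
    HasSum (fun x : L.dual => c (L.disc x) * L.thetaTerm v τ ζ ω x)
      (L.discPairing (L.theta v τ ζ ω) c) := by
  simp only [thetaTerm_eq_zTerm, discPairing_theta]
  exact L.hasSum_mul_zTerm v τ _ c

theorem discPairing_theta_injective {τ : UpperHalfPlane} {a b : L.Disc → ℂ}
    (h : ∀ ζ ω, L.discPairing (L.theta v τ ζ ω) a = L.discPairing (L.theta v τ ζ ω) b) : a = b := by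
  refine L.thetaZ_independent v (τ := τ) fun z => ?_
  have h1 := h (toVC z) (toVCbar z)
  rwa [discPairing_theta, discPairing_theta, toVC_add_toVCbar] at h1

theorem discPairing_mulVec (R W : Matrix L.Disc L.Disc ℂ) (X c : L.Disc → ℂ) :
    L.discPairing (R.mulVec X) (W.mulVec c) = L.discPairing X ((R.transpose * W).mulVec c) := by
  change R.mulVec X ⬝ᵥ W.mulVec c = X ⬝ᵥ (R.transpose * W).mulVec c
  rw [← Matrix.mulVec_mulVec, ← Matrix.vecMul_transpose, ← Matrix.dotProduct_mulVec]

theorem discPairing_smul_left (a : ℂ) (X c : L.Disc → ℂ) :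
    L.discPairing (a • X) c = a * L.discPairing X c := smul_dotProduct a X c

theorem discPairing_smul_right (a : ℂ) (X c : L.Disc → ℂ) :
    L.discPairing X (a • c) = a * L.discPairing X c := dotProduct_smul a X c

theorem conj_weilRepBar_transpose_mul (v : GrJ L) (A : unitaryZ d) :
    ((L.weilRepBar A).map (starRingEnd ℂ)).transpose * L.weilRepBar A = 1 := by
  have h := congrArg Matrix.transpose (L.weilRepBar_unitary v A)
  rwa [Matrix.transpose_mul, Matrix.transpose_transpose, Matrix.transpose_one] at h

/-- The theta function in the translated elliptic variables. -/
theorem theta_shift (τ : UpperHalfPlane) (ζ : VC d V) (ω : VCbar d V) {σ ν : V} (hσ : σ ∈ L.M)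
    (hν : ν ∈ L.M) :
    L.theta v τ
      (ζ + (τ : ℂ) • toVC (v.projPos (1 ⊗ₜ σ)) + (starRingEnd ℂ) (τ : ℂ) • toVC (v.projNeg (1 ⊗ₜ σ))
        + toVC (1 ⊗ₜ ν))
      (ω + (τ : ℂ) • toVCbar (v.projPos (1 ⊗ₜ σ))
        + (starRingEnd ℂ) (τ : ℂ) • toVCbar (v.projNeg (1 ⊗ₜ σ)) + toVCbar (1 ⊗ₜ ν)) =
    expC (-(τ * v.normPos σ) - (starRingEnd ℂ) (τ : ℂ) * v.normNeg σ
      - L.formC ζ (1 ⊗ₜ σ) - L.formC (1 ⊗ₜ σ) ω) • L.theta v τ ζ ω := by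
  have e : ((ζ + (τ : ℂ) • toVC (v.projPos (1 ⊗ₜ σ)) +
      (starRingEnd ℂ) (τ : ℂ) • toVC (v.projNeg (1 ⊗ₜ σ)) + toVC (1 ⊗ₜ ν) : VC d V) : ℂ ⊗[ℚ] V) +
      ((ω + (τ : ℂ) • toVCbar (v.projPos (1 ⊗ₜ σ)) +
        (starRingEnd ℂ) (τ : ℂ) • toVCbar (v.projNeg (1 ⊗ₜ σ)) + toVCbar (1 ⊗ₜ ν) : VCbar d V) :
          ℂ ⊗[ℚ] V) =
      ((ζ : ℂ ⊗[ℚ] V) + (ω : ℂ ⊗[ℚ] V)) + ((τ : ℂ) • v.projPos (1 ⊗ₜ σ) +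
        (starRingEnd ℂ) (τ : ℂ) • v.projNeg (1 ⊗ₜ σ)) + 1 ⊗ₜ ν := by
    conv_rhs => rw [← toVC_add_toVCbar (d := d) (v.projPos (1 ⊗ₜ σ)),
      ← toVC_add_toVCbar (d := d) (v.projNeg (1 ⊗ₜ σ)),
      ← toVC_add_toVCbar (d := d) ((1 : ℂ) ⊗ₜ[ℚ] ν)]
    simp only [Submodule.coe_add, Submodule.coe_smul, smul_add]
    abel
  funext γ
  rw [theta_eq_thetaZ, theta_eq_thetaZ, e, L.thetaZ_add_lattice v τ _ hν, L.thetaZ_shift v τ _ hσ,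
    bil_add_eq, Pi.smul_apply, smul_eq_mul, sub_add_eq_sub_sub]

/-- The theta-type expansion of a smooth quasi-periodic function. -/
theorem exists_theta_decomposition {Φ : UpperHalfPlane → VC d V → VCbar d V → ℂ}
    (hol : ∀ τ, HoloProd (Φ τ))
    (per : ∀ σ ∈ L.M, ∀ ν ∈ L.M, ∀ (τ : UpperHalfPlane) (ζ : VC d V) (ω : VCbar d V),
    Φ τ
      (ζ + (τ : ℂ) • toVC (v.projPos (1 ⊗ₜ σ)) + (starRingEnd ℂ) (τ : ℂ) • toVC (v.projNeg (1 ⊗ₜ σ))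
        + toVC (1 ⊗ₜ ν))
      (ω + (τ : ℂ) • toVCbar (v.projPos (1 ⊗ₜ σ))
        + (starRingEnd ℂ) (τ : ℂ) • toVCbar (v.projNeg (1 ⊗ₜ σ)) + toVCbar (1 ⊗ₜ ν)) =
    expC (-(τ * v.normPos σ) - (starRingEnd ℂ) (τ : ℂ) * v.normNeg σ
      - L.formC ζ (1 ⊗ₜ σ) - L.formC (1 ⊗ₜ σ) ω) * Φ τ ζ ω) (τ : UpperHalfPlane) :
    ∃ c : L.Disc → ℂ, ∀ ζ ω, Φ τ ζ ω = L.discPairing (L.theta v τ ζ ω) c := by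
  obtain ⟨G⟩ := exists_latticeFrame L
  have hfd := L.finiteDimensional_complexification v
  let φ : ℂ ⊗[ℚ] V → ℂ := fun z => Φ τ (toVC z) (toVCbar z)
  have hdiff : Differentiable ℂ fun t => φ (G.coord t) := by
    let a := (Module.finBasis ℂ (VC d V)).equivFun.symm
    let b := (Module.finBasis ℂ (VCbar d V)).equivFun.symm
    let A := (a.symm.toLinearMap ∘ₗ toVCL d V ∘ₗ G.coord.toLinearMap).toContinuousLinearMap
    let B := (b.symm.toLinearMap ∘ₗ toVCbarL d V ∘ₗ G.coord.toLinearMap).toContinuousLinearMap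
    have h1 := (hol τ _ _ a b).comp (A.differentiable.prodMk B.differentiable)
    refine fun t => (h1 t).congr_of_eventuallyEq (Filter.Eventually.of_forall fun s => ?_)
    change Φ τ (toVC (G.coord s)) (toVCbar (G.coord s)) =
      Φ τ (a (a.symm (toVC (G.coord s)))) (b (b.symm (toVCbar (G.coord s))))
    rw [LinearEquiv.apply_symm_apply, LinearEquiv.apply_symm_apply]
  have hquasi : ∀ σ ∈ L.M, ∀ ν ∈ L.M, ∀ z, φ (z + ((τ : ℂ) • v.projPos (1 ⊗ₜ σ) +
      (starRingEnd ℂ) (τ : ℂ) • v.projNeg (1 ⊗ₜ σ)) + 1 ⊗ₜ ν) =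
      expC (-(τ * v.normPos σ) - (starRingEnd ℂ) (τ : ℂ) * v.normNeg σ - L.bil z (1 ⊗ₜ σ)) *
        φ z := by
    intro σ hσ ν hν z
    have h := per σ hσ ν hν τ (toVC z) (toVCbar z)
    have e : L.bil z (1 ⊗ₜ σ) = L.formC (toVC (d := d) z : ℂ ⊗[ℚ] V) (1 ⊗ₜ σ) +
        L.formC (1 ⊗ₜ σ) (toVCbar (d := d) z : ℂ ⊗[ℚ] V) := by
      rw [← bil_add_eq, toVC_add_toVCbar]
    rw [e, sub_add_eq_sub_sub, ← h]
    simp only [φ, toVC_add, toVCbar_add, toVC_smul, toVCbar_smul, add_assoc]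
  have hper : ∀ z, ∀ ν ∈ L.M, φ (z + 1 ⊗ₜ ν) = φ z := by
    intro z ν hν
    have h := hquasi 0 L.M.zero_mem ν hν z
    simpa [GrJ.normPos, GrJ.normNeg, expC_zero] using h
  obtain ⟨f, hf⟩ := L.exists_expansion v G τ hdiff hper
  -- Expanding both sides of the translation law and cancelling the common automorphy factor gives a
  -- second expansion of the same function, with coefficients shifted by σ. Uniqueness identifies
  -- the two.
  have hshift : ∀ (σ : L.dual), (σ : V) ∈ L.M → ∀ x, f (x - σ) = f x := by
    intro σ hσ
    refine fun x => congrFun (L.expansion_unique v (τ := τ) (φ := φ) (f := fun x => f (x - σ))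
      (fun z => ?_) hf) x
    have h1 := hf (z + ((τ : ℂ) • v.projPos (1 ⊗ₜ (σ : V)) +
      (starRingEnd ℂ) (τ : ℂ) • v.projNeg (1 ⊗ₜ (σ : V))))
    have h2 := hquasi σ hσ 0 L.M.zero_mem z
    rw [TensorProduct.tmul_zero, add_zero] at h2
    rw [h2] at h1
    simp only [L.zTerm_shift v τ z (σ : V), mul_left_comm (f _)] at h1
    rw [hasSum_mul_left_iff (expC_ne_zero _)] at h1
    rw [← (Equiv.addRight σ).hasSum_iff]
    refine h1.congr_fun fun x => ?_
    simp
  -- Constant on cosets, the coefficients descend to D_M through any choice of representatives.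
  obtain ⟨s, hs⟩ := L.disc_surjective.hasRightInverse
  refine ⟨fun γ => f (s γ), fun ζ ω => ?_⟩
  have hfs : ∀ x, f (s (L.disc x)) = f x := by
    intro x
    have hm : ((x - s (L.disc x) : L.dual) : V) ∈ L.M := by
      have := (L.disc_eq_iff x (s (L.disc x))).mp (hs _).symm
      exact this
    have := hshift _ hm x
    rwa [sub_sub_cancel] at this
  have h1 := L.hasSum_mul_zTerm v τ ((ζ : ℂ ⊗[ℚ] V) + (ω : ℂ ⊗[ℚ] V)) fun γ => f (s γ)
  simp only [hfs] at h1
  have h2 := (hf ((ζ : ℂ ⊗[ℚ] V) + (ω : ℂ ⊗[ℚ] V))).unique h1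
  rw [discPairing_theta, ← h2]
  simp only [φ, toVC_add_mem, toVCbar_add_mem]

/-- The coefficients of a smooth function with respect to the theta function are smooth. -/
theorem smoothH_of_discPairing {Φ : UpperHalfPlane → VC d V → VCbar d V → ℂ} (hΦ : SmoothProd Φ)
    {F : UpperHalfPlane → L.Disc → ℂ}
    (h : ∀ τ ζ ω, Φ τ ζ ω = L.discPairing (L.theta v τ ζ ω) (F τ)) (γ : L.Disc) :
    SmoothH fun τ => F τ γ := by
  have hfd := L.finiteDimensional_complexification v
  have hopen : IsOpen {z : ℂ | 0 < z.im} := isOpen_lt continuous_const Complex.continuous_im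
  let a := (Module.finBasis ℂ (VC d V)).equivFun.symm
  let b := (Module.finBasis ℂ (VCbar d V)).equivFun.symm
  have hslice : ∀ {Ψ : UpperHalfPlane → VC d V → VCbar d V → ℂ}, SmoothProd Ψ → ∀ ζ ω (x : ℂ),
      0 < x.im → ContDiffAt ℝ (⊤ : ℕ∞) (fun z => Ψ (UpperHalfPlane.ofComplex z) ζ ω) x := by
    intro Ψ hΨ ζ ω x hx
    have h1 := hΨ _ _ a b
    have h2 : ContDiff ℝ (⊤ : ℕ∞) fun z : ℂ => (z, a.symm ζ, b.symm ω) :=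
      contDiff_id.prodMk contDiff_const
    have h3 := (h1.comp (s := {z : ℂ | 0 < z.im}) h2.contDiffOn (fun z hz => hz)).contDiffAt
      (hopen.mem_nhds hx)
    refine h3.congr_of_eventuallyEq (Filter.Eventually.of_forall fun z => ?_)
    simp
  intro x hx
  -- The sample points are chosen at x and kept fixed; by continuity the determinant stays non-zero
  -- near x.
  obtain ⟨z, hz⟩ := L.exists_det_ne_zero v (UpperHalfPlane.ofComplex x)
  refine ContDiffAt.contDiffWithinAt ?_
  refine contDiffAt_of_mulVec
    (M := fun t => Matrix.of fun i γ => L.thetaZ v (UpperHalfPlane.ofComplex t) (z i) γ)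
    (f := fun t => F (UpperHalfPlane.ofComplex t))
    (φ := fun t i => Φ (UpperHalfPlane.ofComplex t) (toVC (z i)) (toVCbar (z i)))
    (fun i γ => ?_) (fun i => hslice hΦ _ _ x hx) (fun t => ?_) hz γ
  · have h1 := hslice (L.smoothProd_theta v γ) (toVC (z i)) (toVCbar (z i)) x hx
    simpa only [theta_eq_thetaZ, toVC_add_toVCbar, Matrix.of_apply] using h1
  · funext i
    rw [h, discPairing_theta, toVC_add_toVCbar]
    rfl

theorem smoothProd_discPairing {F : UpperHalfPlane → L.Disc → ℂ} (hF : ∀ γ, SmoothH fun τ => F τ γ) :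
    SmoothProd fun τ ζ ω => L.discPairing (L.theta v τ ζ ω) (F τ) := by
  intro m n a b
  refine ContDiffOn.sum fun γ _ => (L.smoothProd_theta v γ m n a b).mul ?_
  exact (hF γ).comp contDiff_fst.contDiffOn fun p hp => hp

theorem holoProd_discPairing (τ : UpperHalfPlane) (c : L.Disc → ℂ) :
    HoloProd fun ζ ω => L.discPairing (L.theta v τ ζ ω) c := by
  intro m n a b
  exact Differentiable.fun_sum fun γ _ => (L.holoProd_theta v τ γ m n a b).mul_const _

theorem fj_ne_zero (A : unitaryZ d) (τ : UpperHalfPlane) : fj A τ ≠ 0 := by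
  intro h
  have := im_mobius A τ
  rw [h, div_zero] at this
  simp at this

end EvenLattice

/-! ### Jacobi forms and vector-valued modular forms -/

open EvenLattice in
/-- The theta decomposition of a Hermitian Jacobi form. -/
theorem IsHermitianJacobiForm.exists_isModularForm {L : EvenLattice d V} {v : GrJ L} {k l : ℤ}
    {Γ : Subgroup (unitaryZ d)} {Φ : UpperHalfPlane → VC d V → VCbar d V → ℂ}
    (hΦ : IsHermitianJacobiForm L v k l Γ Φ) :
    ∃ F : UpperHalfPlane → L.Disc → ℂ,
      (∀ τ ζ ω, Φ τ ζ ω = L.discPairing (L.theta v τ ζ ω) (F τ)) ∧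
      IsModularForm L (k - L.bPos) (l - L.bNeg) Γ F := by
  choose F hF using L.exists_theta_decomposition v hΦ.holomorphic hΦ.periodic
  refine ⟨F, hF, fun A hA τ => ?_, L.smoothH_of_discPairing v hΦ.smooth hF, fun γ => ?_⟩
  · have hj := fj_ne_zero A τ
    have hj' : (starRingEnd ℂ) (fj A τ) ≠ 0 := (map_ne_zero _).mpr hj
    -- Moving the theta matrix to the other side of the pairing, independence of theta turns the law
    -- of Φ into one for F(Aτ). Unitarity then inverts the transposed conjugate.
    have h1 : ((L.weilRepBar A).map (starRingEnd ℂ)).transpose.mulVec (F (act A τ)) =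
        (fj A τ ^ (k - L.bPos) * (starRingEnd ℂ) (fj A τ) ^ (l - L.bNeg)) • F τ := by
      refine L.discPairing_theta_injective v (τ := τ) fun ζ ω => ?_
      have h2 := hΦ.modular A hA τ ζ ω
      rw [hF, hF, L.theta_act v A, discPairing_smul_left] at h2
      have h3 := L.discPairing_mulVec ((L.weilRepBar A).map (starRingEnd ℂ)) 1 (L.theta v τ ζ ω)
        (F (act A τ))
      rw [Matrix.one_mulVec, Matrix.mul_one] at h3
      rw [h3] at h2
      rw [discPairing_smul_right, zpow_sub₀ hj, zpow_sub₀ hj', zpow_natCast, zpow_natCast]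
      have he := expC_ne_zero (entry A 1 0 * L.formC (v.posC ζ) (v.posCbar ω) / fj A τ
        + (starRingEnd ℂ) (entry A 1 0) * L.formC (v.negC ζ) (v.negCbar ω) /
          (starRingEnd ℂ) (fj A τ))
      generalize expC _ = e at h2 he
      have hp := pow_ne_zero L.bPos hj
      have hn := pow_ne_zero L.bNeg hj'
      field_simp
      -- Theta and Φ carry the same exponential factor, so only the weights remain.
      apply mul_left_cancel₀ he
      linear_combination h2
    have h4 : L.weilRepBar A * ((L.weilRepBar A).map (starRingEnd ℂ)).transpose = 1 :=
      mul_eq_one_comm.mp (L.conj_weilRepBar_transpose_mul v A)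
    have h5 := congrArg (L.weilRepBar A).mulVec h1
    rwa [Matrix.mulVec_mulVec, h4, Matrix.one_mulVec, Matrix.mulVec_smul] at h5
  · obtain ⟨x, rfl⟩ := L.disc_surjective γ
    -- The components of F are themselves the Fourier coefficients of Φ.
    refine hΦ.growth (fun x τ => F τ (L.disc x)) (fun τ ζ ω => ?_) x
    rw [hF]
    exact L.hasSum_mul_thetaTerm v τ ζ ω (F τ)

open EvenLattice in
/-- The pairing of the theta function with a modular form is a Hermitian Jacobi form. -/
theorem IsModularForm.isHermitianJacobiForm {L : EvenLattice d V} (v : GrJ L) {k l : ℤ}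
    {Γ : Subgroup (unitaryZ d)} {F : UpperHalfPlane → L.Disc → ℂ}
    (hF : IsModularForm L (k - L.bPos) (l - L.bNeg) Γ F) :
    IsHermitianJacobiForm L v k l Γ fun τ ζ ω => L.discPairing (L.theta v τ ζ ω) (F τ) where
  smooth := L.smoothProd_discPairing v hF.smooth
  holomorphic τ := L.holoProd_discPairing v τ (F τ)
  periodic σ hσ ν hν τ ζ ω := by
    rw [L.theta_shift v τ ζ ω hσ hν, discPairing_smul_left]
  modular A hA τ ζ ω := by
    have hj := fj_ne_zero A τ
    have hj' : (starRingEnd ℂ) (fj A τ) ≠ 0 := (map_ne_zero _).mpr hj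
    rw [hF.modular A hA, L.theta_act v A, discPairing_smul_left, discPairing_smul_right,
      discPairing_mulVec, L.conj_weilRepBar_transpose_mul v, Matrix.one_mulVec, zpow_sub₀ hj,
      zpow_sub₀ hj', zpow_natCast, zpow_natCast]
    have hp := pow_ne_zero L.bPos hj
    have hn := pow_ne_zero L.bNeg hj'
    field_simp
  growth f hf x := by
    -- Uniqueness of the expansion: any admissible family f is given by the components of F.
    have h : ∀ τ, (fun x => f x τ) = fun x => F τ (L.disc x) := by
      intro τ
      refine L.expansion_unique v (τ := τ) (φ := fun z => ∑ γ, L.thetaZ v τ z γ * F τ γ)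
        (fun z => ?_) fun z => L.hasSum_mul_zTerm v τ z (F τ)
      have h1 := hf τ (toVC z) (toVCbar z)
      simpa only [thetaTerm_eq_zTerm, discPairing_theta, toVC_add_toVCbar] using h1
    have h2 : f x = fun τ => F τ (L.disc x) := funext fun τ => congrFun (h τ) x
    rw [h2]
    exact hF.growth _

end HermJacobi

end

theorem mainTheorem3 (d : ℕ) [HermJacobi.IsNegDiscriminant d]
    {V : Type*} [AddCommGroup V] [Module (HermJacobi.QuadField d) V] [Module ℚ V]
    (L : HermJacobi.EvenLattice d V) (v : HermJacobi.GrJ L) (k l : ℤ)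
    (Γ : Subgroup (HermJacobi.unitaryZ d)) [Γ.FiniteIndex] :
    (∀ Φ : UpperHalfPlane → HermJacobi.VC d V → HermJacobi.VCbar d V → ℂ,
      HermJacobi.IsHermitianJacobiForm L v k l Γ Φ →
      ∃ F : UpperHalfPlane → L.Disc → ℂ,
        (∀ τ ζ ω, Φ τ ζ ω = L.discPairing (L.theta v τ ζ ω) (F τ)) ∧
        (∀ G : UpperHalfPlane → L.Disc → ℂ,
          (∀ τ ζ ω, Φ τ ζ ω = L.discPairing (L.theta v τ ζ ω) (G τ)) → G = F) ∧
        HermJacobi.IsModularForm L (k - L.bPos) (l - L.bNeg) Γ F) ∧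
    (∀ F : UpperHalfPlane → L.Disc → ℂ,
      HermJacobi.IsModularForm L (k - L.bPos) (l - L.bNeg) Γ F →
      HermJacobi.IsHermitianJacobiForm L v k l Γ
        (fun τ ζ ω => L.discPairing (L.theta v τ ζ ω) (F τ))) := by
  refine ⟨fun Φ hΦ => ?_, fun F hF => hF.isHermitianJacobiForm v⟩
  obtain ⟨F, hF, hmod⟩ := hΦ.exists_isModularForm
  refine ⟨F, hF, fun G hG => funext fun τ => ?_, hmod⟩
  exact L.discPairing_theta_injective v (τ := τ) fun ζ ω => (hG τ ζ ω).symm.trans (hF τ ζ ω)
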